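/- **Corollary 5.4 (periodic spectra near an embedded homoclinic eigenvalue).** *Setting.* For $0\le\varepsilon<\varepsilon_0$ consider the first-order $n\times n$ systems $W'=A^\varepsilon(x,\lambda)W$, $x\in\mathbb R$, $|\lambda|<M$, where $A^\varepsilon$ is $C^1$ in $x$ and analytic in $\lambda$, and for $\varepsilon>0$ is $X^\varepsilon$-periodic in $x$. Assume that for some constants $K$ and $\nu,\bar\theta>0$ and some matrix function $A^0_\infty(\lambda)$: - (H1) $X^\varepsilon\to\infty$ as $\varepsilon\to0^+$; - (H2) $|A^0(x,\lambda)-A^0_\infty(\lambda)|\le K e^{-\nu|x|}$ for $x\in\mathbb R$, $|\lambda|<M$; - (H3) $|A^\varepsilon(x,\lambda)-A^0(x,\lambda)|\le K e^{-\bar\theta X^\varepsilon/2}$ for $0<\varepsilon<\varepsilon_0$, $|x|\le X^\varepsilon/2$, $|\lambda|<M$. Let $\Psi^\varepsilon(x,\lambda)$ be the solution operator with $\Psi^\varepsilon(0,\lambda)=\mathrm{Id}$. For $|\gamma|=1$, the $\gamma$-eigenvalues, counted with multiplicity, are the zeros $\lambda$ of the periodic Evans function $E^\varepsilon(\lambda,\gamma)=\det(\Psi^\varepsilon(X^\varepsilon,\lambda)-\gamma\,\mathrm{Id})$.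 *Isolated arc.* Let $|\lambda_*|<M$ and $k_*\in\mathbb R$ be such that $ik_*$ is an algebraically simple eigenvalue of $A^0_\infty(\lambda_*)$ and every other eigenvalue $\mu$ of $A^0_\infty(\lambda_*)$ satisfies $|\mathrm{Re}\,\mu|\ge g$, for some $g>0$. Let $J\subset\mathbb R$ be a neighborhood of $k_*$ and $\lambda_j:J\to\mathbb C$ a curve with $\lambda_j(k_*)=\lambda_*$ and $i\kappa\in\sigma(A^0_\infty(\lambda_j(\kappa)))$ for $\kappa\in J$, differentiable at $k_*$ with $\lambda_j'(k_*)\ne0$. *Homoclinic Evans functions.* For $\lambda$ near $\lambda_*$ let $\mu_c(\lambda)$ be the eigenvalue of $A^0_\infty(\lambda)$ near $ik_*$. Let $P^0_\pm(x,\lambda)$, $x\gtrless0$, satisfy $(P^0_\pm)'=A^0P^0_\pm-P^0_\pm A^0_\infty$ and $|P^0_\pm-\mathrm{Id}|\to0$ exponentially as $x\to\pm\infty$. Set $$D^0_i(\lambda)=\frac{\det\big(P^0_-(0,\lambda)R^-_i,\ P^0_+(0,\lambda)R^+_i\big)}{\det\big(R^-_i,R^+_i\big)},\qquad i=1,2,$$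 where the columns of $R^-_i$ and $R^+_i$ are bases of the sums of generalized eigenspaces of $A^0_\infty(\lambda)$ for the unstable and the stable eigenvalues, respectively, with $\mu_c(\lambda)$ counted as unstable for $i=1$ and as stable for $i=2$. (The value does not depend on the choices. Thus $D^0_1$ and $D^0_2$ are the analytic extensions to a neighborhood of $\lambda_*$ of the homoclinic Evans functions defined on the sides $\mathrm{Re}\,\mu_c>0$ and $\mathrm{Re}\,\mu_c<0$ of the arc.) Assume that $D^0_1$ and $D^0_2$ both have a zero of exact order $m\ge1$ at $\lambda_*$. *Conclusion.* There exists $C_1>0$ such that for every $C>0$ and every $\tilde\eta$ with $0<\tilde\eta<\min\{\bar\theta,\nu,g\}$ there is $X_0>0$ such that, for all $0<\varepsilon<\varepsilon_0$ with $X^\varepsilon\ge X_0$ and all $k\in\mathbb R$, with $\gamma=e^{ikX^\varepsilon}$: the $\gamma$-eigenvalues in the open ball $B(\lambda_*,C/X^\varepsilon)$, counted with multiplicity as zeros of $E^\varepsilon(\cdot,\gamma)$, are finite in number and consist of two groups. Each point of the first group lies within $C_1/X^\varepsilon$ of some point of $$\{\lambda_j(\kappa):\ \kappa\in J,\ \kappa\equiv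 k \bmod 2\pi/X^\varepsilon\},$$ and the second group consists of exactly $m$ points, each lying within $C_1e^{-\tilde\eta X^\varepsilon/(2(m+1))}$ of $\lambda_*$. -/

import Mathlib

open scoped Matrix.Norms.Operator

noncomputable section

/-- `Psi` is the fundamental matrix of `W' = A(x) W` normalised by `Psi(0) = Id`. -/
def IsFundamentalMatrix {n : ℕ} (A Psi : ℝ → Matrix (Fin n) (Fin n) ℂ) : Prop :=
  Psi 0 = 1 ∧ ∀ x : ℝ, HasDerivAt Psi (A x * Psi x) x

open Classical in
/-- The solution operator of `W' = A(x) W` on the line. For continuous `A` there is exactly one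
fundamental matrix; the default value `1` is never used then. -/
def solutionOperator {n : ℕ} (A : ℝ → Matrix (Fin n) (Fin n) ℂ) :
    ℝ → Matrix (Fin n) (Fin n) ℂ :=
  if h : ∃ Psi, IsFundamentalMatrix A Psi then h.choose else fun _ => 1

/-- The periodic Evans function `E(lam, gam) = det (Psi(X, lam) - gam Id)` of the system
`W' = A(x, lam) W` over the period `X`. -/
def periodicEvans {n : ℕ} (A : ℝ → ℂ → Matrix (Fin n) (Fin n) ℂ) (X : ℝ) (gam lam : ℂ) : ℂ :=
  (solutionOperator (fun x => A x lam) X - gam • (1 : Matrix (Fin n) (Fin n) ℂ)).det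

/-- `P` conjugates `W' = A(x) W` to `Z' = B Z` through `W = P Z` on the half line `s`
(`s = [0, ∞)` or `s = (-∞, 0]`): `P' = A P - P B`, and `P` tends to the identity exponentially
at the infinite end of `s`. (Such a `P` is automatically invertible.) -/
def IsConjugator {n : ℕ} (A : ℝ → Matrix (Fin n) (Fin n) ℂ) (B : Matrix (Fin n) (Fin n) ℂ)
    (s : Set ℝ) (P : ℝ → Matrix (Fin n) (Fin n) ℂ) : Prop :=
  (∀ x ∈ s, HasDerivWithinAt P (A x * P x - P x * B) s x) ∧
    ∃ K θ : ℝ, 0 < θ ∧ ∀ x ∈ s, ‖P x - 1‖ ≤ K * Real.exp (-θ * |x|)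

/-- The sum of the generalised eigenspaces of `B` for the eigenvalues of real part `> c`;
for `c = 0` the unstable subspace. -/
def spectralAbove {n : ℕ} (B : Matrix (Fin n) (Fin n) ℂ) (c : ℝ) : Submodule ℂ (Fin n → ℂ) :=
  ⨆ μ : ℂ, ⨆ _ : c < μ.re, Module.End.maxGenEigenspace (Matrix.toLin' B) μ

/-- The sum of the generalised eigenspaces of `B` for the eigenvalues of real part `< c`;
for `c = 0` the stable subspace. -/
def spectralBelow {n : ℕ} (B : Matrix (Fin n) (Fin n) ℂ) (c : ℝ) : Submodule ℂ (Fin n → ℂ) :=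
  ⨆ μ : ℂ, ⨆ _ : μ.re < c, Module.End.maxGenEigenspace (Matrix.toLin' B) μ

/-- `d = det (P₋(0) R⁻, P₊(0) R⁺) / det (R⁻, R⁺)`, where `P₋`, `P₊` conjugate `W' = A(x) W` to
`Z' = B Z` on the two half lines, and `R = (R⁻, R⁺)` is an invertible matrix whose columns with
index in `S` (forming `R⁻`) are a basis of the part of `B` with real parts `> c` and whose other
columns (forming `R⁺`) are a basis of the part with real parts `< c`. The value `d` does not depend
on the choice of `P₋`, `P₊`, `R`, `S`; it exists only if no eigenvalue of `B` has real part `c`. -/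
def IsHomoclinicEvansValue {n : ℕ} (A : ℝ → Matrix (Fin n) (Fin n) ℂ)
    (B : Matrix (Fin n) (Fin n) ℂ) (c : ℝ) (d : ℂ) : Prop :=
  ∃ (Pm Pp : ℝ → Matrix (Fin n) (Fin n) ℂ) (R : Matrix (Fin n) (Fin n) ℂ) (S : Finset (Fin n)),
    IsConjugator A B (Set.Iic 0) Pm ∧ IsConjugator A B (Set.Ici 0) Pp ∧ R.det ≠ 0 ∧
    (∀ j ∈ S, (fun i => R i j) ∈ spectralAbove B c) ∧
    (∀ j ∉ S, (fun i => R i j) ∈ spectralBelow B c) ∧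
    d = (Matrix.of fun i j => if j ∈ S then (Pm 0 * R) i j else (Pp 0 * R) i j).det / R.det

open Classical in
/-- The homoclinic Evans function of `W' = A(x) W` with limiting matrix `B = A(±∞)`, at one value of
the spectral parameter, for the splitting of the spectrum of `B` at the abscissa `c`.

For `c = 0` this is the Evans function on the domains of hyperbolicity. Near a point `lam` at which
`B` has a single, simple, imaginary eigenvalue `μ_c`, a small `c < 0` counts `μ_c` with the unstable
eigenvalues and thus gives the analytic extension of the Evans function from the side `Re μ_c > 0`;
a small `c > 0` counts `μ_c` with the stable ones and gives the extension from `Re μ_c < 0`. -/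
def homoclinicEvans {n : ℕ} (A : ℝ → Matrix (Fin n) (Fin n) ℂ)
    (B : Matrix (Fin n) (Fin n) ℂ) (c : ℝ) : ℂ :=
  if h : ∃ d, IsHomoclinicEvansValue A B c d then h.choose else 0

theorem maxGenEigenspace_eq_bot_of_notMem {n : ℕ} (B : Matrix (Fin n) (Fin n) ℂ) (μ : ℂ)
    (h : μ ∉ spectrum ℂ B) : Module.End.maxGenEigenspace (Matrix.toLin' B) μ = ⊥ := by
  by_contra hne
  apply h
  rw [← Matrix.spectrum_toLin']
  have hu : Module.End.HasUnifEigenvalue (Matrix.toLin' B) μ ⊤ := hne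
  exact Module.End.hasEigenvalue_iff_mem_spectrum.1 (hu.lt zero_lt_one)

/-- Moving the abscissa without crossing an eigenvalue does not change the Evans function. In
particular the extensions above agree with the Evans function (`c = 0`) on their sides. -/
theorem homoclinicEvans_congr {n : ℕ} (A : ℝ → Matrix (Fin n) (Fin n) ℂ)
    (B : Matrix (Fin n) (Fin n) ℂ) (c c' : ℝ)
    (h : ∀ μ ∈ spectrum ℂ B, (c < μ.re ↔ c' < μ.re) ∧ (μ.re < c ↔ μ.re < c')) :
    homoclinicEvans A B c = homoclinicEvans A B c' := by
  have hA : spectralAbove B c = spectralAbove B c' := by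
    unfold spectralAbove
    refine iSup_congr fun μ => ?_
    by_cases hμ : μ ∈ spectrum ℂ B
    · simp only [(h μ hμ).1]
    · simp [maxGenEigenspace_eq_bot_of_notMem B μ hμ]
  have hB : spectralBelow B c = spectralBelow B c' := by
    unfold spectralBelow
    refine iSup_congr fun μ => ?_
    by_cases hμ : μ ∈ spectrum ℂ B
    · simp only [(h μ hμ).2]
    · simp [maxGenEigenspace_eq_bot_of_notMem B μ hμ]
  have hv : IsHomoclinicEvansValue A B c = IsHomoclinicEvansValue A B c' := by
    unfold IsHomoclinicEvansValue
    rw [hA, hB]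
  unfold homoclinicEvans
  rw [hv]

/-- Points of the arc `lamj`, defined on the set `J` of frequencies, whose frequency is congruent
to `k` modulo `2π / X`. -/
def latticeOnArc (lamj : ℝ → ℂ) (J : Set ℝ) (X k : ℝ) : Set ℂ :=
  {w | ∃ κ ∈ J, (∃ p : ℤ, κ = k + p * (2 * Real.pi / X)) ∧ w = lamj κ}

end

/-! Let Ψ be the solution operator and X the period. Periodicity gives Ψ(X) = Ψ(-X/2)⁻¹ Ψ(X/2), so
only the interval on which the homoclinic system is a good approximation matters. The periodic Evans
function is expanded in traces of exterior powers, det(Ψ(X) - γ) = Σ_k (-γ)^(n-k) tr Λ^k Ψ(X)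
(`det_add_smul_one`).

Let u be the number of unstable eigenvalues at λ*, σ their sum continued to nearby λ, and μ the
centre eigenvalue. The powers Λ^u and Λ^(u+1) of the limiting flow have a simple dominant rate, σ
and σ + μ, with a spectral gap just below g; every other power is smaller than e^(σx) by that gap
(`IsCenterFrame.eventually_dominant`). On each half line the normalised power of the perturbed
system therefore converges, at a rate η below the gap and the decay of the coefficients, to a limit
given by the conjugators (`exists_scaledCompound_sub_le`). The trace of the product of the left and
the right limit is a homoclinic Evans function times det P₊(0)⁻¹, and this last factor is divided
out by means of det Ψ(X/2). The outcome (`exists_evans_asymptotics`,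
`IsCenterFrame.exists_evans_estimate`) is that, for a zero-free analytic factor N, E N = e^(μX) D₁ -
γ D₂ + O((1 + |e^(μX)|) e^(-ηX/2)), uniformly near λ*. Only growth rates enter, so no analytic
choice of bases or conjugators is needed; it suffices to block diagonalise the limiting matrix into
unstable, centre and stable part (`exists_isCenterFrame`).

Write D_i = (λ - λ*)^m a_i with a_i(λ*) ≠ 0 and h = e^(μX) a₁ - γ a₂. Then E N is a small
perturbation of (λ - λ*)^m h, and the rest is a study of its zeros (`exists_zero_groups`). Near λ*
the function h is almost affine with slope of order X, so on one of the circles of radius ρ and 3ρ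
it is at least of order Xρ. With ρ^(m+1) = e^(-ηX/2) the main term beats the error there, and
Rouché's theorem yields at least m zeros inside; m of them form the second group. At any zero
farther than 1/X from λ*, division by (λ - λ*)^m costs at most X^m, hence h is small, |e^(μX)| is
bounded above and below, and Re μ = O(1/X); within 1/X of λ* this is immediate. So μ lies within
O(1/X) of some iκ with κ ≡ k mod 2π/X. Differentiating μ(λ_j(κ)) = iκ shows μ' ≠ 0, so μ is locally
invertible and the zero lies within O(1/X) of λ_j(κ). -/

/-! ### Exterior powers of matrices. -/

/-- The action of a matrix on the `k`-th exterior power, realised on antisymmetric tensors. -/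
noncomputable def compound {m : Type*} (k : ℕ) (M : Matrix m m ℂ) :
    Matrix (Fin k → m) (Fin k → m) ℂ :=
  Matrix.of fun i j => (k.factorial : ℂ)⁻¹ * (M.submatrix i j).det

/-- The coordinate projection onto the indices in `J`. -/
noncomputable def coordProj {m : Type*} [DecidableEq m] (J : Finset m) : Matrix m m ℂ :=
  Matrix.diagonal fun j => if j ∈ J then 1 else 0

section compound
variable {m : Type*} [Fintype m] [DecidableEq m] {k : ℕ}

theorem det_submatrix_mul (M N : Matrix m m ℂ) (i j : Fin k → m) :
    ((M * N).submatrix i j).det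
      = ∑ l : Fin k → m, (M.submatrix i l).det * ∏ a, N (l a) (j a) := by
  simp only [Matrix.det_apply', Matrix.submatrix_apply, Matrix.mul_apply, Finset.sum_mul]
  rw [Finset.sum_comm]
  refine Finset.sum_congr rfl fun σ _ => ?_
  rw [Finset.prod_univ_sum, Finset.mul_sum]
  refine Finset.sum_congr (by ext; simp) fun l _ => ?_
  rw [Finset.prod_mul_distrib, mul_assoc]

/-- Cauchy–Binet over all index maps: expanding the second minor over permutations and absorbing
each permutation into the summation index gives k! equal sums, which the normalisation cancels.
Consequently `compound k 1` is idempotent; it is the antisymmetriser, not the identity matrix, and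
has to be carried along as the unit below. -/
theorem compound_mul (M N : Matrix m m ℂ) :
    compound k (M * N) = compound k M * compound k N := by
  ext i j
  simp only [compound, Matrix.of_apply, Matrix.mul_apply]
  have hk : (k.factorial : ℂ) ≠ 0 := by exact_mod_cast k.factorial_ne_zero
  have key : ∑ l : Fin k → m, (M.submatrix i l).det * (N.submatrix l j).det
      = k.factorial * ((M * N).submatrix i j).det := by
    have h1 : ∀ l : Fin k → m, (M.submatrix i l).det * (N.submatrix l j).det
        = ∑ π : Equiv.Perm (Fin k), (M.submatrix i (l ∘ π)).det * ∏ a, N ((l ∘ π) a) (j a) := by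
      intro l
      rw [Matrix.det_apply' (N.submatrix l j), Finset.mul_sum]
      refine Finset.sum_congr rfl fun π _ => ?_
      have h2 : (M.submatrix i (l ∘ π)).det = Equiv.Perm.sign π * (M.submatrix i l).det := by
        rw [← Matrix.det_permute' π (M.submatrix i l)]; rfl
      rw [h2]
      simp only [Matrix.submatrix_apply, Function.comp]
      ring
    simp only [h1]
    rw [Finset.sum_comm]
    have h3 : ∀ π : Equiv.Perm (Fin k), ∑ l : Fin k → m,
        (M.submatrix i (l ∘ π)).det * ∏ a, N ((l ∘ π) a) (j a)
        = ((M * N).submatrix i j).det := by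
      intro π
      rw [det_submatrix_mul]
      exact Fintype.sum_equiv (Equiv.arrowCongr π.symm (Equiv.refl m)) _ _ fun l => rfl
    simp only [h3, Finset.sum_const, Finset.card_univ, Fintype.card_perm, Fintype.card_fin,
      nsmul_eq_mul]
  calc _ = (k.factorial : ℂ)⁻¹ * (k.factorial : ℂ)⁻¹ *
        (k.factorial * ((M * N).submatrix i j).det) := by field_simp
    _ = _ := by
      rw [← key, Finset.mul_sum]
      exact Finset.sum_congr rfl fun l _ => by ring

theorem compound_transpose (M : Matrix m m ℂ) :
    compound k M.transpose = (compound k M).transpose := by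
  ext i j
  simp only [compound, Matrix.of_apply, Matrix.transpose_apply]
  rw [← Matrix.det_transpose]; rfl

theorem coordProj_mul_self (J : Finset m) : coordProj J * coordProj J = coordProj J := by
  simp [coordProj, Matrix.diagonal_mul_diagonal]

theorem coordProj_mul_apply (J : Finset m) (M : Matrix m m ℂ) (i j : m) :
    (coordProj J * M) i j = if i ∈ J then M i j else 0 := by
  simp [coordProj, Matrix.diagonal_mul]

theorem mul_coordProj_apply (J : Finset m) (M : Matrix m m ℂ) (i j : m) :
    (M * coordProj J) i j = if j ∈ J then M i j else 0 := by
  simp [coordProj, Matrix.mul_diagonal]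

theorem coordProj_compl (J : Finset m) : coordProj Jᶜ = 1 - coordProj J := by
  ext i j
  by_cases h : i = j <;> by_cases hj : j ∈ J <;>
    simp [coordProj, h, hj]

/-- The principal minor on `s`, as a determinant of full size. -/
theorem det_coordProj_add (M : Matrix m m ℂ) (s : Finset m) (e : Fin k ≃ s) :
    (coordProj s * M + coordProj sᶜ).det = (M.submatrix (fun a => (e a : m)) fun a => e a).det := by
  rw [Matrix.twoBlockTriangular_det _ (· ∈ s)]
  · have h1 : (Matrix.toSquareBlockProp (coordProj s * M + coordProj sᶜ) (fun i => ¬ i ∈ s)) = 1 := by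
      ext i j
      have hi := i.2
      have hj := j.2
      change (coordProj s * M + coordProj sᶜ) i.1 j.1 = _
      rw [Matrix.add_apply, coordProj_mul_apply, if_neg hi]
      by_cases hij : i = j <;>
        simp [coordProj, Matrix.one_apply, hj, ← Subtype.ext_iff, hij]
    rw [h1, Matrix.det_one, mul_one]
    refine Eq.trans (by convert (Matrix.det_submatrix_equiv_self e (Matrix.toSquareBlockProp
      (coordProj s * M + coordProj sᶜ) (· ∈ s))).symm) ?_
    congr 1
    ext a b
    change (coordProj s * M + coordProj sᶜ) (e a).1 (e b).1 = M (e a) (e b)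
    have ha := (e a).2
    rw [Matrix.add_apply, coordProj_mul_apply, if_pos ha]
    simp [coordProj, Matrix.diagonal_apply]
  · intro i hi j hj
    have : i ≠ j := fun h => hi (h ▸ hj)
    simp [hi, coordProj, this]

/-- Only injective index maps contribute, and the k! enumerations of a k-element set all give its
principal minor. -/
theorem trace_compound (M : Matrix m m ℂ) :
    (compound k M).trace
      = ∑ s ∈ Finset.powersetCard k Finset.univ, (coordProj s * M + coordProj sᶜ).det := by
  have hk : (k.factorial : ℂ) ≠ 0 := by exact_mod_cast k.factorial_ne_zero
  simp only [Matrix.trace, compound, Matrix.diag_apply, Matrix.of_apply]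
  rw [← Finset.mul_sum]
  have hinj : ∑ i : Fin k → m, (M.submatrix i i).det
      = ∑ i : Fin k → m with Function.Injective i, (M.submatrix i i).det := by
    rw [Finset.sum_filter]
    refine Finset.sum_congr rfl fun i _ => ?_
    split_ifs with h
    · rfl
    · simp only [Function.Injective, not_forall] at h
      obtain ⟨a, b, hab, hne⟩ := h
      exact Matrix.det_zero_of_row_eq hne (by ext c; simp [hab])
  have hmap : ∀ i ∈ Finset.univ.filter (fun i : Fin k → m => Function.Injective i),
      Finset.univ.image i ∈ Finset.powersetCard k (Finset.univ : Finset m) := by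
    intro i hi
    rw [Finset.mem_powersetCard]
    exact ⟨Finset.subset_univ _, by
      rw [Finset.card_image_of_injective _ (by simpa using hi)]; simp⟩
  rw [hinj, ← Finset.sum_fiberwise_of_maps_to hmap, Finset.mul_sum]
  refine Finset.sum_congr rfl fun s hs => ?_
  have hcard : s.card = k := (Finset.mem_powersetCard.1 hs).2
  have e0 : Fin k ≃ s := (Fintype.equivFinOfCardEq (by simp [hcard])).symm
  have hval : ∀ i ∈ (Finset.univ.filter (fun i : Fin k → m => Function.Injective i)).filter
      (fun i => Finset.univ.image i = s), (M.submatrix i i).det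
        = (coordProj s * M + coordProj sᶜ).det := by
    intro i hi
    simp only [Finset.mem_filter, Finset.mem_univ, true_and] at hi
    have hb : Function.Bijective
        (fun a => (⟨i a, hi.2 ▸ Finset.mem_image_of_mem i (Finset.mem_univ a)⟩ : s)) := by
      rw [Fintype.bijective_iff_injective_and_card]
      exact ⟨fun a b h => hi.1 (Subtype.ext_iff.1 h), by simp [hcard]⟩
    rw [det_coordProj_add M s (Equiv.ofBijective _ hb)]
    rfl
  rw [Finset.sum_congr rfl hval, Finset.sum_const, nsmul_eq_mul]
  have hcnt : ((Finset.univ.filter (fun i : Fin k → m => Function.Injective i)).filter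
      (fun i => Finset.univ.image i = s)).card = k.factorial := by
    have : Fintype.card (Fin k ≃ s) = k.factorial := by
      rw [Fintype.card_equiv e0, Fintype.card_fin]
    rw [← this, ← Finset.card_univ]
    symm
    refine Finset.card_bij (fun e _ a => (e a : m)) ?_ ?_ ?_
    · intro e _
      simp only [Finset.mem_filter, Finset.mem_univ, true_and]
      refine ⟨fun a b h => e.injective (Subtype.ext h), ?_⟩
      ext x
      simp only [Finset.mem_image, Finset.mem_univ, true_and]
      exact ⟨fun ⟨a, ha⟩ => ha ▸ (e a).2, fun hx => ⟨e.symm ⟨x, hx⟩, by simp⟩⟩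
    · intro e _ e' _ h
      ext a
      exact congrFun h a
    · intro i hi
      simp only [Finset.mem_filter, Finset.mem_univ, true_and] at hi
      have hb : Function.Bijective
          (fun a => (⟨i a, hi.2 ▸ Finset.mem_image_of_mem i (Finset.mem_univ a)⟩ : s)) := by
        rw [Fintype.bijective_iff_injective_and_card]
        exact ⟨fun a b h => hi.1 (Subtype.ext_iff.1 h), by simp [hcard]⟩
      exact ⟨Equiv.ofBijective _ hb, Finset.mem_univ _, rfl⟩
  rw [hcnt, inv_mul_cancel_left₀ hk]

/-- Expansion of the shifted determinant in traces of exterior powers. -/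
theorem det_add_smul_one (M : Matrix m m ℂ) (z : ℂ) :
    (M + z • (1 : Matrix m m ℂ)).det
      = ∑ k ∈ Finset.range (Fintype.card m + 1),
          z ^ (Fintype.card m - k) * (compound k M).trace := by
  have h0 : (M + z • (1 : Matrix m m ℂ)).det
      = ∑ s : Finset m, (Matrix.of (fun i => if i ∈ s then M i else (z • (1 : Matrix m m ℂ)) i)).det :=
    (Matrix.detRowAlternating (R := ℂ) (n := m)).toMultilinearMap.map_add_univ M
      (z • (1 : Matrix m m ℂ) : Matrix m m ℂ)
  have h1 : ∀ s : Finset m, (Matrix.of (fun i => if i ∈ s then M i else (z • (1 : Matrix m m ℂ)) i)).det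
      = z ^ (Fintype.card m - s.card) * (coordProj s * M + coordProj sᶜ).det := by
    intro s
    have : Matrix.of (fun i => if i ∈ s then M i else (z • (1 : Matrix m m ℂ)) i)
        = Matrix.diagonal (fun i => if i ∈ s then 1 else z) *
          (coordProj s * M + coordProj sᶜ) := by
      ext i j
      rw [Matrix.diagonal_mul, Matrix.add_apply, coordProj_mul_apply]
      by_cases hi : i ∈ s <;>
        simp [hi, coordProj, Matrix.diagonal_apply, Matrix.one_apply]
    rw [this, Matrix.det_mul, Matrix.det_diagonal, Finset.prod_ite]
    simp only [Finset.prod_const_one, one_mul, Finset.prod_const]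
    rw [← Finset.card_compl]
    congr 3
    ext; simp
  rw [h0, Finset.sum_congr rfl fun s _ => h1 s]
  rw [← Finset.powerset_univ, Finset.sum_powerset]
  refine Finset.sum_congr (by simp) fun k _ => ?_
  rw [trace_compound, Finset.mul_sum]
  refine Finset.sum_congr rfl fun s hs => ?_
  rw [(Finset.mem_powersetCard.1 hs).2]

/-- Of the principal minors of the compressed matrix only that on `J` has no zero row. This is what
later turns a trace of exterior powers into the determinant of the homoclinic Evans function. -/
theorem trace_compound_coordProj (N : Matrix m m ℂ) (J : Finset m) (hJ : J.card = k) :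
    (compound k (coordProj J * N * coordProj J)).trace
      = (N * coordProj J + coordProj Jᶜ).det := by
  rw [trace_compound, Finset.sum_eq_single J]
  -- With e the projection, Ne + (1 - e) = (eNe + 1 - e)(1 + (1 - e)Ne), and the second factor is
  -- unipotent.
  · have h1 : N * coordProj J + coordProj Jᶜ
        = (coordProj J * (coordProj J * N * coordProj J) + coordProj Jᶜ)
          * (1 + (coordProj Jᶜ * N) * coordProj J) := by
      have hee := coordProj_mul_self J
      rw [coordProj_compl]
      generalize coordProj J = e at *
      have h2 : e * (e * N * e) = e * N * e := by rw [mul_assoc e N e, ← mul_assoc e e, hee]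
      have h3 : e * N * e * ((1 - e) * N * e) = 0 := by
        have : e * N * e * ((1 - e) * N * e) = e * N * (e - e * e) * (N * e) := by noncomm_ring
        rw [this, hee]; simp
      have h4 : (1 - e) * ((1 - e) * N * e) = (1 - e) * N * e := by
        have : (1 - e) * ((1 - e) * N * e) = (1 - e - e + e * e) * N * e := by noncomm_ring
        rw [this, hee]; noncomm_ring
      rw [h2, add_mul, mul_add, mul_add, h3, h4]
      noncomm_ring
    rw [h1, Matrix.det_mul, Matrix.det_one_add_mul_comm]
    have h5 : coordProj J * (coordProj Jᶜ * N) = 0 := by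
      rw [coordProj_compl, ← mul_assoc, mul_sub, coordProj_mul_self]; simp
    rw [h5]; simp
  · intro s hs hne
    have hc := (Finset.mem_powersetCard.1 hs).2
    obtain ⟨x, hx, hxJ⟩ : ∃ x ∈ s, x ∉ J := by
      by_contra! hcon
      exact hne (Finset.eq_of_subset_of_card_le hcon (by omega))
    refine Matrix.det_eq_zero_of_row_eq_zero x fun j => ?_
    rw [Matrix.add_apply, coordProj_mul_apply, if_pos hx, mul_assoc, coordProj_mul_apply,
      if_neg hxJ]
    by_cases hxj : x = j <;> simp [coordProj, hxj]
    exact hxj ▸ hx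
  · intro h
    exact absurd (Finset.mem_powersetCard.2 ⟨Finset.subset_univ _, hJ⟩) h

/-- The k-th exterior power of a k-dimensional coordinate space is a line, on which a block
preserving that space acts by its determinant. -/
theorem compound_mul_coordProj (M : Matrix m m ℂ) (J : Finset m) (hJ : J.card = k)
    (hM : M * coordProj J = coordProj J * M) :
    compound k (M * coordProj J)
      = (M * coordProj J + coordProj Jᶜ).det • compound k (coordProj J) := by
  have hrow : ∀ (N : Matrix m m ℂ) (i j : Fin k → m) (a : Fin k), i a ∉ J →
      ((coordProj J * N).submatrix i j).det = 0 := fun N i j a ha =>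
    Matrix.det_eq_zero_of_row_eq_zero a fun b => by
      rw [Matrix.submatrix_apply, coordProj_mul_apply, if_neg ha]
  have hcol : ∀ (N : Matrix m m ℂ) (i j : Fin k → m) (a : Fin k), j a ∉ J →
      ((N * coordProj J).submatrix i j).det = 0 := fun N i j a ha =>
    Matrix.det_eq_zero_of_column_eq_zero a fun b => by
      rw [Matrix.submatrix_apply, mul_coordProj_apply, if_neg ha]
  ext i j
  simp only [compound, Matrix.of_apply, Matrix.smul_apply, smul_eq_mul]
  rw [mul_left_comm]
  congr 1
  by_cases hi : ∀ a, i a ∈ J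
  swap
  · push Not at hi
    obtain ⟨a, ha⟩ := hi
    have h2 := hrow 1 i j a ha
    rw [mul_one] at h2
    rw [hM, hrow M i j a ha, h2, mul_zero]
  by_cases hj : ∀ a, j a ∈ J
  swap
  · push Not at hj
    obtain ⟨a, ha⟩ := hj
    have h2 := hcol 1 i j a ha
    rw [one_mul] at h2
    rw [hcol M i j a ha, h2, mul_zero]
  by_cases hii : Function.Injective i
  swap
  · simp only [Function.Injective, not_forall] at hii
    obtain ⟨a, b, hab, hne⟩ := hii
    rw [Matrix.det_zero_of_row_eq (M := (M * coordProj J).submatrix i j) hne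
      (by ext c; simp [hab]), Matrix.det_zero_of_row_eq (M := (coordProj J).submatrix i j) hne
      (by ext c; simp [hab]), mul_zero]
  by_cases hjj : Function.Injective j
  swap
  · simp only [Function.Injective, not_forall] at hjj
    obtain ⟨a, b, hab, hne⟩ := hjj
    rw [Matrix.det_zero_of_column_eq (M := (M * coordProj J).submatrix i j) hne
      (by intro c; simp [hab]), Matrix.det_zero_of_column_eq (M := (coordProj J).submatrix i j) hne
      (by intro c; simp [hab]), mul_zero]
  have hb : ∀ f : Fin k → m, ∀ hf : ∀ a, f a ∈ J, Function.Injective f →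
      Function.Bijective (fun a => (⟨f a, hf a⟩ : J)) := by
    intro f hf hfi
    rw [Fintype.bijective_iff_injective_and_card]
    exact ⟨fun a b h => hfi (Subtype.ext_iff.1 h), by simp [hJ]⟩
  set ei := Equiv.ofBijective _ (hb i hi hii) with hei
  set ej := Equiv.ofBijective _ (hb j hj hjj) with hej
  set π : Equiv.Perm (Fin k) := ei.trans ej.symm with hπ
  have hiπ : i = j ∘ π := by
    funext a
    have : ej (π a) = ei a := by simp [hπ]
    exact (Subtype.ext_iff.1 this).symm
  have hperm : ∀ N : Matrix m m ℂ, (N.submatrix i j).det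
      = Equiv.Perm.sign π * (N.submatrix j j).det := by
    intro N
    rw [hiπ, ← Matrix.det_permute π (N.submatrix j j)]; rfl
  have hdiag : ∀ N : Matrix m m ℂ, (N.submatrix j j).det
      = (coordProj J * N + coordProj Jᶜ).det := fun N => (det_coordProj_add N J ej).symm
  rw [hperm, hperm, hdiag, hdiag, coordProj_mul_self, ← mul_assoc, ← hM, mul_assoc,
    coordProj_mul_self, coordProj_compl]
  simp
  ring

theorem compound_eq_zero_of_not_injective (M : Matrix m m ℂ) (i j : Fin k → m)
    (hj : ¬ Function.Injective j) : compound k M i j = 0 := by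
  simp only [Function.Injective, not_forall] at hj
  obtain ⟨a, b, hab, hne⟩ := hj
  simp only [compound, Matrix.of_apply]
  rw [Matrix.det_zero_of_column_eq hne (by intro c; simp [hab]), mul_zero]

theorem compound_mul_coordProj_eq_zero (M : Matrix m m ℂ) (J : Finset m) (i j : Fin k → m)
    (a : Fin k) (ha : j a ∉ J) : compound k (M * coordProj J) i j = 0 := by
  simp only [compound, Matrix.of_apply]
  rw [Matrix.det_eq_zero_of_column_eq_zero a fun b => by
      rw [Matrix.submatrix_apply, mul_coordProj_apply, if_neg ha], mul_zero]

theorem compound_mul_coordProj_apply (M : Matrix m m ℂ) (J : Finset m) (i j : Fin k → m)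
    (hj : ∀ a, j a ∈ J) : compound k (M * coordProj J) i j = compound k M i j := by
  simp only [compound, Matrix.of_apply]
  congr 2
  ext a b
  rw [Matrix.submatrix_apply, mul_coordProj_apply, if_pos (hj b), Matrix.submatrix_apply]

/-- Hadamard-type bound of the exterior power in terms of the columns. -/
theorem norm_compound_apply_le (M : Matrix m m ℂ) (r : m → ℝ) (hM : ∀ i j, ‖M i j‖ ≤ r j)
    (i j : Fin k → m) : ‖compound k M i j‖ ≤ ∏ a, r (j a) := by
  have hk : (0 : ℝ) < k.factorial := by exact_mod_cast k.factorial_pos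
  simp only [compound, Matrix.of_apply, norm_mul, norm_inv, Complex.norm_natCast]
  rw [inv_mul_le_iff₀ hk, Matrix.det_apply']
  refine (norm_sum_le _ _).trans ?_
  have : ∀ σ ∈ (Finset.univ : Finset (Equiv.Perm (Fin k))),
      ‖((Equiv.Perm.sign σ : ℤ) : ℂ) * ∏ a, (M.submatrix i j) (σ a) a‖ ≤ ∏ a, r (j a) := by
    intro σ _
    rw [norm_mul, norm_prod]
    have hs : ‖((Equiv.Perm.sign σ : ℤ) : ℂ)‖ = 1 := by
      rcases Int.units_eq_one_or (Equiv.Perm.sign σ) with h | h <;> simp [h]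
    rw [hs, one_mul]
    exact Finset.prod_le_prod (fun _ _ => norm_nonneg _) fun a _ => hM _ _
  refine (Finset.sum_le_sum this).trans (le_of_eq ?_)
  simp [Finset.card_univ, Fintype.card_perm]

end compound

/-! ### Linear differential equations: existence, uniqueness, parameters. -/

section linearODE
open MeasureTheory Set Filter Topology Interval

/-- Global existence for linear equations in a Banach algebra. -/
theorem exists_hasDerivAt_mul {𝔸 : Type*} [NormedRing 𝔸] [NormedAlgebra ℝ 𝔸] [CompleteSpace 𝔸]
    (A : ℝ → 𝔸) (hA : Continuous A) (Y₀ : 𝔸) :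
    ∃ Y : ℝ → 𝔸, Y 0 = Y₀ ∧ ∀ x, HasDerivAt Y (A x * Y x) x := by
  obtain ⟨U, hU0, hUs⟩ : ∃ U : ℕ → ℝ → 𝔸, U 0 = (fun _ => Y₀) ∧
      ∀ j, U (j + 1) = fun x => ∫ t in (0 : ℝ)..x, A t * U j t :=
    ⟨fun j => Nat.rec (fun _ => Y₀) (fun _ u x => ∫ t in (0 : ℝ)..x, A t * u t) j, rfl,
      fun _ => rfl⟩
  have hUd : ∀ j, Continuous (U j) ∧ ∀ x, HasDerivAt (U (j + 1)) (A x * U j x) x := by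
    have step : ∀ j, Continuous (U j) → ∀ x, HasDerivAt (U (j + 1)) (A x * U j x) x := by
      intro j hj x
      rw [hUs]
      exact intervalIntegral.integral_hasDerivAt_right ((hA.mul hj).intervalIntegrable _ _)
        ((hA.mul hj).stronglyMeasurableAtFilter _ _) (hA.mul hj).continuousAt
    intro j
    induction j with
    | zero =>
      have h0 : Continuous (U 0) := hU0 ▸ continuous_const
      exact ⟨h0, step 0 h0⟩
    | succ j ih =>
      have : Continuous (U (j + 1)) :=
        continuous_iff_continuousAt.2 fun x => (ih.2 x).continuousAt
      exact ⟨this, step (j + 1) this⟩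
  -- The `U j` are the terms of the Picard series; the factorial bound makes the series and its
  -- termwise derivative converge locally uniformly.
  have hbound : ∀ R L : ℝ, 0 ≤ L → (∀ x ∈ Icc (-R) R, ‖A x‖ ≤ L) → ∀ j, ∀ x ∈ Icc (-R) R,
      ‖U j x‖ ≤ ‖Y₀‖ * (L ^ j * |x| ^ j / j.factorial) := by
    intro R L hL hAL j
    induction j with
    | zero => intro x _; simp [hU0]
    | succ j ih =>
      intro x hx
      rw [hUs, intervalIntegral.norm_integral_eq_norm_integral_uIoc]
      have hsub : ∀ t ∈ Ι (0 : ℝ) x, t ∈ Icc (-R) R := by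
        intro t ht
        rw [mem_uIoc] at ht
        rw [mem_Icc] at hx ⊢
        rcases ht with h | h <;> constructor <;> linarith [h.1, h.2, hx.1, hx.2]
      have hle : ‖∫ t in Ι (0 : ℝ) x, A t * U j t‖
          ≤ ∫ t in Ι (0 : ℝ) x, (‖Y₀‖ * L ^ (j + 1) / j.factorial) * |t - 0| ^ j := by
        refine norm_integral_le_of_norm_le ?_ ?_
        · exact Continuous.integrableOn_uIoc (by fun_prop)
        · refine (ae_restrict_iff' measurableSet_uIoc).2 (Eventually.of_forall fun t ht => ?_)
          refine (norm_mul_le _ _).trans ?_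
          refine (mul_le_mul (hAL t (hsub t ht)) (ih t (hsub t ht)) (norm_nonneg _) hL).trans
            (le_of_eq ?_)
          rw [sub_zero]
          ring
      refine hle.trans (le_of_eq ?_)
      rw [integral_const_mul, integral_pow_abs_sub_uIoc, sub_zero, Nat.factorial_succ]
      push_cast
      field_simp
  -- `g' j` is the derivative of `U j`: the index is shifted by one, because `U (j + 1)` integrates
  -- `A * U j`, and the first term is constant.
  obtain ⟨g', hg0, hgs⟩ : ∃ g' : ℕ → ℝ → 𝔸, g' 0 = (fun _ => 0) ∧
      ∀ j, g' (j + 1) = fun x => A x * U j x :=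
    ⟨fun j x => Nat.rec 0 (fun i _ => A x * U i x) j, rfl, fun _ => rfl⟩
  have key : ∀ x, HasDerivAt (fun z => ∑' j, U j z) (∑' j, g' j x) x ∧ Summable fun j => U j x := by
    intro x
    set R := |x| + 1 with hR
    obtain ⟨L, hL⟩ := (isCompact_Icc (a := -R) (b := R)).exists_bound_of_continuousOn
      hA.continuousOn
    have hxR : x ∈ Ioo (-R) R := by
      rw [mem_Ioo]; constructor <;> linarith [neg_abs_le x, le_abs_self x]
    have h0R : (0 : ℝ) ∈ Ioo (-R) R := by
      rw [mem_Ioo]; constructor <;> linarith [abs_nonneg x]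
    have hL0 : 0 ≤ L := (norm_nonneg _).trans (hL 0 (Ioo_subset_Icc_self h0R))
    have hb : ∀ j, ∀ y ∈ Ioo (-R) R, ‖U j y‖ ≤ ‖Y₀‖ * ((L * R) ^ j / j.factorial) := by
      intro j y hy
      refine (hbound R L hL0 hL j y (Ioo_subset_Icc_self hy)).trans ?_
      have : |y| ≤ R := abs_le.2 ⟨hy.1.le, hy.2.le⟩
      rw [mul_pow]
      gcongr
    have hs : Summable fun j : ℕ => ‖Y₀‖ * ((L * R) ^ j / j.factorial) :=
      (Real.summable_pow_div_factorial _).mul_left _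
    let u : ℕ → ℝ := fun j => Nat.rec 0 (fun i _ => L * (‖Y₀‖ * ((L * R) ^ i / i.factorial))) j
    have hu : Summable u := by
      rw [← summable_nat_add_iff 1]
      exact hs.mul_left L
    have hsum : ∀ y ∈ Ioo (-R) R, Summable fun j => U j y := fun y hy =>
      Summable.of_norm_bounded hs fun j => hb j y hy
    refine ⟨hasDerivAt_tsum_of_isPreconnected hu isOpen_Ioo isPreconnected_Ioo ?_ ?_ h0R
      (hsum 0 h0R) hxR, hsum x hxR⟩
    · intro j y _
      cases j with
      | zero => rw [hU0, hg0]; exact hasDerivAt_const y Y₀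
      | succ j => rw [hgs]; exact (hUd j).2 y
    · intro j y hy
      cases j with
      | zero => simp [hg0, u]
      | succ j =>
        rw [hgs]
        exact (norm_mul_le _ _).trans (mul_le_mul (hL y (Ioo_subset_Icc_self hy)) (hb j y hy)
          (norm_nonneg _) hL0)
  refine ⟨fun z => ∑' j, U j z, ?_, fun x => ?_⟩
  · change ∑' j, U j 0 = Y₀
    rw [tsum_eq_single 0, hU0]
    intro j hj
    obtain ⟨i, rfl⟩ := Nat.exists_eq_succ_of_ne_zero hj
    simp [hUs]
  · have h := (key x).1
    have hg : ∑' j, g' j x = A x * ∑' j, U j x := by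
      rw [← (key x).2.tsum_mul_left]
      have hs' : Summable fun j => g' j x := by
        rw [← summable_nat_add_iff 1]
        simpa only [hgs] using (key x).2.mul_left _
      rw [hs'.tsum_eq_zero_add]
      simp [hg0, hgs]
    rwa [hg] at h

variable {n : ℕ}

theorem LinearMap.hasDerivAt_comp_real {V W : Type*} [NormedAddCommGroup V] [NormedSpace ℝ V]
    [FiniteDimensional ℝ V] [NormedAddCommGroup W] [NormedSpace ℝ W] (l : V →ₗ[ℝ] W)
    {f : ℝ → V} {f' : V} {x : ℝ} (h : HasDerivAt f f' x) :
    HasDerivAt (fun y => l (f y)) (l f') x :=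
  (LinearMap.toContinuousLinearMap l).hasFDerivAt.comp_hasDerivAt x h

theorem HasDerivAt.matrix_transpose' {f : ℝ → Matrix (Fin n) (Fin n) ℂ}
    {f' : Matrix (Fin n) (Fin n) ℂ} {x : ℝ} (h : HasDerivAt f f' x) :
    HasDerivAt (fun y => (f y).transpose) f'.transpose x :=
  LinearMap.hasDerivAt_comp_real (Matrix.transposeLinearEquiv (Fin n) (Fin n) ℝ ℂ).toLinearMap h

theorem exists_isFundamentalMatrix {A : ℝ → Matrix (Fin n) (Fin n) ℂ} (hA : Continuous A) :
    ∃ Psi, IsFundamentalMatrix A Psi :=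
  exists_hasDerivAt_mul A hA 1

theorem isFundamentalMatrix_solutionOperator {A : ℝ → Matrix (Fin n) (Fin n) ℂ}
    (hA : Continuous A) : IsFundamentalMatrix A (solutionOperator A) := by
  have h := exists_isFundamentalMatrix hA
  rw [solutionOperator, dif_pos h]
  exact h.choose_spec

theorem eq_of_hasDerivWithinAt_zero {E : Type*} [NormedAddCommGroup E] [NormedSpace ℝ E]
    {f : ℝ → E} {s : Set ℝ} (hs : Convex ℝ s) (hf : ∀ x ∈ s, HasDerivWithinAt f 0 s x)
    {x y : ℝ} (hx : x ∈ s) (hy : y ∈ s) : f y = f x := by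
  have := hs.norm_image_sub_le_of_norm_hasDerivWithin_le (C := 0) hf (by simp) hx hy
  rw [zero_mul, norm_le_zero_iff, sub_eq_zero] at this
  exact this

theorem eq_of_hasDerivAt_zero {E : Type*} [NormedAddCommGroup E] [NormedSpace ℝ E]
    {f : ℝ → E} (hf : ∀ x, HasDerivAt f 0 x) (x y : ℝ) : f y = f x :=
  eq_of_hasDerivWithinAt_zero convex_univ (fun x _ => (hf x).hasDerivWithinAt)
    (mem_univ x) (mem_univ y)

namespace IsFundamentalMatrix
variable {A Psi : ℝ → Matrix (Fin n) (Fin n) ℂ}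

theorem continuous (h : IsFundamentalMatrix A Psi) : Continuous Psi :=
  continuous_iff_continuousAt.2 fun x => (h.2 x).continuousAt

/-- The inverse is obtained as a solution of the adjoint equation Φ' = -ΦA. Transposition brings
that equation into the left-multiplication form for which existence is known. -/
theorem exists_inverse (h : IsFundamentalMatrix A Psi) (hA : Continuous A) :
    ∃ Phi : ℝ → Matrix (Fin n) (Fin n) ℂ, (∀ x, HasDerivAt Phi (-(Phi x * A x)) x) ∧
      ∀ x, Phi x * Psi x = 1 := by
  obtain ⟨Y, hY0, hY⟩ := exists_hasDerivAt_mul (fun x => -(A x).transpose)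
    (hA.matrix_transpose.neg) 1
  have hd : ∀ x, HasDerivAt (fun x => (Y x).transpose) (-((Y x).transpose * A x)) x := by
    intro x
    have := (hY x).matrix_transpose'
    simpa [Matrix.transpose_mul] using this
  refine ⟨fun x => (Y x).transpose, hd, fun x => ?_⟩
  have hz : ∀ x, HasDerivAt (fun x => (Y x).transpose * Psi x) 0 x := by
    intro x
    exact ((hd x).mul (h.2 x)).congr_deriv (by noncomm_ring)
  have := eq_of_hasDerivAt_zero hz 0 x
  simpa [hY0, h.1] using this

theorem isUnit_det (h : IsFundamentalMatrix A Psi) (hA : Continuous A) (x : ℝ) :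
    IsUnit (Psi x).det := by
  obtain ⟨Phi, -, hPhi⟩ := h.exists_inverse hA
  have := congrArg Matrix.det (hPhi x)
  rw [Matrix.det_mul, Matrix.det_one] at this
  exact IsUnit.of_mul_eq_one_right _ this

theorem hasDerivAt_inv (h : IsFundamentalMatrix A Psi) (hA : Continuous A) (x : ℝ) :
    HasDerivAt (fun x => (Psi x)⁻¹) (-((Psi x)⁻¹ * A x)) x := by
  obtain ⟨Phi, hd, hPhi⟩ := h.exists_inverse hA
  have : (fun x => (Psi x)⁻¹) = Phi := by
    funext x
    exact Matrix.inv_eq_left_inv (hPhi x)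
  rw [this, congrFun this x]
  exact hd x

theorem inv_mul_cancel (h : IsFundamentalMatrix A Psi) (hA : Continuous A) (x : ℝ) :
    (Psi x)⁻¹ * Psi x = 1 := Matrix.nonsing_inv_mul _ (h.isUnit_det hA x)

theorem mul_inv_cancel (h : IsFundamentalMatrix A Psi) (hA : Continuous A) (x : ℝ) :
    Psi x * (Psi x)⁻¹ = 1 := Matrix.mul_nonsing_inv _ (h.isUnit_det hA x)

theorem eq_mul_of_hasDerivWithinAt (h : IsFundamentalMatrix A Psi) (hA : Continuous A)
    {s : Set ℝ} (hs : Convex ℝ s) (h0 : (0 : ℝ) ∈ s) {W : ℝ → Matrix (Fin n) (Fin n) ℂ}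
    (hW : ∀ x ∈ s, HasDerivWithinAt W (A x * W x) s x) {x : ℝ} (hx : x ∈ s) :
    W x = Psi x * W 0 := by
  have hz : ∀ x ∈ s, HasDerivWithinAt (fun x => (Psi x)⁻¹ * W x) 0 s x := by
    intro x hx
    exact ((h.hasDerivAt_inv hA x).hasDerivWithinAt.mul (hW x hx)).congr_deriv (by noncomm_ring)
  have := eq_of_hasDerivWithinAt_zero hs hz h0 hx
  rw [h.1, inv_one, one_mul] at this
  rw [← this, ← mul_assoc, h.mul_inv_cancel hA, one_mul]

/-- Floquet's relation. -/
theorem add_period (h : IsFundamentalMatrix A Psi) (hA : Continuous A) {X : ℝ}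
    (hX : ∀ x, A (x + X) = A x) (x : ℝ) : Psi (x + X) = Psi x * Psi X := by
  have hW : ∀ x ∈ univ, HasDerivWithinAt (fun x => Psi (x + X)) (A x * Psi (x + X)) univ x := by
    intro x _
    have := (h.2 (x + X)).comp_add_const x X
    rw [hX] at this
    exact this.hasDerivWithinAt
  have := h.eq_mul_of_hasDerivWithinAt hA convex_univ (mem_univ 0) hW (mem_univ x)
  simpa using this

theorem norm_le_of_norm_le (h : IsFundamentalMatrix A Psi) {R L : ℝ}
    (hL : ∀ x ∈ Icc (-R) R, ‖A x‖ ≤ L) {x : ℝ} (hx : x ∈ Icc (-R) R) :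
    ‖Psi x‖ ≤ ‖(1 : Matrix (Fin n) (Fin n) ℂ)‖ * Real.exp (L * R) := by
  have hR : 0 ≤ R := by linarith [hx.1.trans hx.2]
  have hL0 : 0 ≤ L := (norm_nonneg _).trans (hL x hx)
  have aux : ∀ Y B : ℝ → Matrix (Fin n) (Fin n) ℂ, Y 0 = 1 →
      (∀ x, HasDerivAt Y (B x * Y x) x) → (∀ x ∈ Icc (-R) R, ‖B x‖ ≤ L) → ∀ x ∈ Icc 0 R,
      ‖Y x‖ ≤ ‖(1 : Matrix (Fin n) (Fin n) ℂ)‖ * Real.exp (L * R) := by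
    intro Y B hY0 hY hB x hx
    have := norm_le_gronwallBound_of_norm_deriv_right_le (f := Y) (f' := fun x => B x * Y x)
      (δ := ‖(1 : Matrix (Fin n) (Fin n) ℂ)‖) (K := L) (ε := 0) (a := 0) (b := R)
      (fun x _ => (hY x).continuousAt.continuousWithinAt)
      (fun x _ => (hY x).hasDerivWithinAt) (by rw [hY0])
      (fun x hx => by
        rw [add_zero]
        exact (norm_mul_le _ _).trans (mul_le_mul_of_nonneg_right
          (hB x ⟨by linarith [hx.1], hx.2.le⟩) (norm_nonneg _))) x hx
    rw [gronwallBound_ε0, sub_zero] at this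
    refine this.trans ?_
    gcongr
    exact hx.2
  rcases le_total 0 x with h0 | h0
  · exact aux Psi A h.1 h.2 hL x ⟨h0, hx.2⟩
  · have := aux (fun x => Psi (-x)) (fun x => -A (-x)) (by simp [h.1]) (fun x => by
      have := (h.2 (-x)).scomp x (hasDerivAt_neg x)
      exact this.congr_deriv (by simp)) (fun x hx => by
        rw [norm_neg]; exact hL _ ⟨by linarith [hx.2], by linarith [hx.1]⟩) (-x)
      ⟨by linarith, by linarith [hx.1]⟩
    simpa using this

end IsFundamentalMatrix

/-- Variation of constants for two linear systems. -/
theorem inv_mul_fundamental_sub_one {A B Psi Phi : ℝ → Matrix (Fin n) (Fin n) ℂ}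
    (hA : Continuous A) (hB : Continuous B) (hPsi : IsFundamentalMatrix A Psi)
    (hPhi : IsFundamentalMatrix B Phi) (x : ℝ) :
    (Psi x)⁻¹ * Phi x - 1 = ∫ y in (0 : ℝ)..x, (Psi y)⁻¹ * (B y - A y) * Phi y := by
  have hd : ∀ y, HasDerivAt (fun y => (Psi y)⁻¹ * Phi y) ((Psi y)⁻¹ * (B y - A y) * Phi y) y := by
    intro y
    exact ((hPsi.hasDerivAt_inv hA y).mul (hPhi.2 y)).congr_deriv (by noncomm_ring)
  have hc : Continuous fun y => (Psi y)⁻¹ * (B y - A y) * Phi y :=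
    ((continuous_iff_continuousAt.2 fun x => (hPsi.hasDerivAt_inv hA x).continuousAt).mul
      (hB.sub hA)).mul hPhi.continuous
  rw [intervalIntegral.integral_eq_sub_of_hasDerivAt (fun y _ => hd y) (hc.intervalIntegrable _ _)]
  simp [hPsi.1, hPhi.1]

/-- Fundamental matrices depend holomorphically on parameters. -/
theorem differentiableAt_fundamentalMatrix {A Psi : ℝ → ℂ → Matrix (Fin n) (Fin n) ℂ} {z₀ : ℂ}
    {r R L : ℝ} (hr : 0 < r) (hA : ∀ z ∈ Metric.ball z₀ r, Continuous fun x => A x z)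
    (hPsi : ∀ z ∈ Metric.ball z₀ r, IsFundamentalMatrix (fun x => A x z) fun x => Psi x z)
    (hd : ∀ x, DifferentiableOn ℂ (A x) (Metric.ball z₀ r))
    (hL : ∀ x ∈ Icc (-R) R, ∀ z ∈ Metric.ball z₀ r, ‖A x z‖ ≤ L) {x : ℝ} (hx : x ∈ Icc (-R) R) :
    DifferentiableAt ℂ (Psi x) z₀ := by
  have hz₀ : z₀ ∈ Metric.ball z₀ r := Metric.mem_ball_self hr
  have hR : 0 ≤ R := by linarith [hx.1.trans hx.2]
  have hL0 : 0 ≤ L := (norm_nonneg _).trans (hL x hx z₀ hz₀)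
  set Phi : ℝ → Matrix (Fin n) (Fin n) ℂ := fun y => (Psi y z₀)⁻¹ with hPhi
  have hPhic : Continuous Phi := continuous_iff_continuousAt.2 fun y =>
    ((hPsi z₀ hz₀).hasDerivAt_inv (hA z₀ hz₀) y).continuousAt
  obtain ⟨C, hC⟩ := (isCompact_Icc (a := -R) (b := R)).exists_bound_of_continuousOn
    hPhic.continuousOn
  have hC0 : 0 ≤ C := (norm_nonneg _).trans (hC x hx)
  set P := ‖(1 : Matrix (Fin n) (Fin n) ℂ)‖ * Real.exp (L * R) with hP
  have hPsib : ∀ z ∈ Metric.ball z₀ r, ∀ y ∈ Icc (-R) R, ‖Psi y z‖ ≤ P := fun z hz y hy =>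
    (hPsi z hz).norm_le_of_norm_le (fun x hx => hL x hx z hz) hy
  have hP0 : 0 ≤ P := (norm_nonneg _).trans (hPsib z₀ hz₀ x hx)
  -- The Schwarz lemma turns the uniform bound on the ball into a Lipschitz estimate at the centre,
  -- uniform in y.
  have hslope : ∀ y ∈ Icc (-R) R, ∀ z ∈ Metric.ball z₀ r,
      dist (A y z) (A y z₀) ≤ (2 * L) / r * dist z z₀ := by
    intro y hy z hz
    refine Complex.dist_le_div_mul_dist_of_mapsTo_ball (hd y) (fun w hw => ?_) hz
    rw [Metric.mem_closedBall, dist_eq_norm]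
    refine (norm_sub_le _ _).trans ?_
    linarith [hL y hy w hw, hL y hy z₀ hz₀]
  have hsub : ∀ y ∈ Icc (-R) R, ∀ t ∈ Ι (0 : ℝ) y, t ∈ Icc (-R) R := by
    intro y hy t ht
    rw [mem_uIoc] at ht
    rw [mem_Icc] at hy ⊢
    rcases ht with h | h <;> constructor <;> linarith [h.1, h.2, hy.1, hy.2]
  have hrep : ∀ y, ∀ z ∈ Metric.ball z₀ r, Psi y z - Psi y z₀
      = Psi y z₀ * ∫ t in (0 : ℝ)..y, Phi t * (A t z - A t z₀) * Psi t z := by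
    intro y z hz
    rw [← inv_mul_fundamental_sub_one (hA z₀ hz₀) (hA z hz) (hPsi z₀ hz₀) (hPsi z hz), mul_sub,
      ← mul_assoc, (hPsi z₀ hz₀).mul_inv_cancel (hA z₀ hz₀)]
    simp
  have hball : ∀ᶠ z in 𝓝[≠] z₀, z ∈ Metric.ball z₀ r :=
    nhdsWithin_le_nhds (Metric.ball_mem_nhds z₀ hr)
  have hcont : ∀ y ∈ Icc (-R) R, Tendsto (Psi y) (𝓝[≠] z₀) (𝓝 (Psi y z₀)) := by
    intro y hy
    refine tendsto_iff_norm_sub_tendsto_zero.2 ?_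
    have hb : ∀ᶠ z in 𝓝[≠] z₀, ‖Psi y z - Psi y z₀‖
        ≤ P * ((C * (2 * L / r * dist z z₀) * P) * |y - 0|) := by
      filter_upwards [hball] with z hz
      rw [hrep y z hz]
      refine (norm_mul_le _ _).trans (mul_le_mul (hPsib z₀ hz₀ y hy) ?_ (norm_nonneg _) hP0)
      refine intervalIntegral.norm_integral_le_of_norm_le_const fun t ht => ?_
      have ht' := hsub y hy t ht
      refine (norm_mul_le _ _).trans (mul_le_mul ((norm_mul_le _ _).trans (mul_le_mul (hC t ht')
        ?_ (norm_nonneg _) hC0)) (hPsib z hz t ht') (norm_nonneg _) (by positivity))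
      rw [← dist_eq_norm]
      exact hslope t ht' z hz
    have hlim : Tendsto (fun z => P * ((C * (2 * L / r * dist z z₀) * P) * |y - 0|)) (𝓝[≠] z₀)
        (𝓝 0) := by
      have h1 : Tendsto (fun z => P * ((C * (2 * L / r * dist z z₀) * P) * |y - 0|)) (𝓝 z₀)
          (𝓝 (P * ((C * (2 * L / r * dist z₀ z₀) * P) * |y - 0|))) :=
        Continuous.tendsto (by fun_prop) z₀
      simp only [dist_self, mul_zero, zero_mul] at h1
      exact h1.mono_left nhdsWithin_le_nhds
    exact squeeze_zero' (Eventually.of_forall fun _ => norm_nonneg _) hb hlim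
  -- The variation of constants formula divided by z - z₀ is an integral of slopes of A, and
  -- `hslope` supplies the constant majorant for dominated convergence.
  have hlim : Tendsto (fun z => ∫ t in (0 : ℝ)..x, Phi t * (slope (A t) z₀ z) * Psi t z)
      (𝓝[≠] z₀) (𝓝 (∫ t in (0 : ℝ)..x, Phi t * (deriv (A t) z₀) * Psi t z₀)) := by
    refine intervalIntegral.tendsto_integral_filter_of_dominated_convergence
      (fun _ => C * (2 * L / r) * P) ?_ ?_ (by simp) ?_
    · filter_upwards [hball] with z hz
      refine Continuous.aestronglyMeasurable ?_
      have h1 : Continuous fun t => slope (A t) z₀ z := by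
        simp only [slope_def_module]
        exact ((hA z hz).sub (hA z₀ hz₀)).const_smul ((z - z₀)⁻¹)
      exact (hPhic.mul h1).mul (hPsi z hz).continuous
    · filter_upwards [hball, self_mem_nhdsWithin] with z hz hne
      refine Eventually.of_forall fun t ht => ?_
      have ht' := hsub x hx t ht
      refine (norm_mul_le _ _).trans (mul_le_mul ((norm_mul_le _ _).trans (mul_le_mul (hC t ht')
        ?_ (norm_nonneg _) hC0)) (hPsib z hz t ht') (norm_nonneg _) (by positivity))
      have h0 : 0 < ‖z - z₀‖ := norm_pos_iff.2 (sub_ne_zero.2 hne)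
      rw [slope_def_module, norm_smul, norm_inv, ← div_eq_inv_mul, div_le_iff₀ h0]
      have := hslope t ht' z hz
      rwa [dist_eq_norm, dist_eq_norm] at this
    · refine Eventually.of_forall fun t ht => ?_
      have ht' := hsub x hx t ht
      have h1 : HasDerivAt (A t) (deriv (A t) z₀) z₀ :=
        ((hd t).differentiableAt (Metric.ball_mem_nhds z₀ hr)).hasDerivAt
      exact ((hasDerivAt_iff_tendsto_slope.1 h1).const_mul _).mul (hcont t ht')
  refine HasDerivAt.differentiableAt (hasDerivAt_iff_tendsto_slope.2
    ((hlim.const_mul (Psi x z₀)).congr' ?_))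
  filter_upwards [hball] with z hz
  rw [slope_def_module, hrep x z hz, ← mul_smul_comm, ← intervalIntegral.integral_smul]
  congr 1
  refine intervalIntegral.integral_congr fun t _ => ?_
  simp only [slope_def_module]
  rw [mul_smul_comm, smul_mul_assoc]

end linearODE

/-! ### Decaying perturbations of semigroups on a half line. -/

section dichotomy
open MeasureTheory Set Filter Topology

/-- Gronwall's inequality in integral form. -/
theorem gronwall_integral {φ κ : ℝ → ℝ} {c a : ℝ} (hφ : Continuous φ) (hκ : Continuous κ)
    (hκ0 : ∀ s ∈ Icc 0 a, 0 ≤ κ s)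
    (h : ∀ x ∈ Icc 0 a, φ x ≤ c + ∫ s in (0 : ℝ)..x, κ s * φ s) {x : ℝ} (hx : x ∈ Icc 0 a) :
    φ x ≤ c * Real.exp (∫ s in (0 : ℝ)..x, κ s) := by
  set F : ℝ → ℝ := fun x => c + ∫ s in (0 : ℝ)..x, κ s * φ s with hF
  set k : ℝ → ℝ := fun x => ∫ s in (0 : ℝ)..x, κ s with hk
  have hFd : ∀ x, HasDerivAt F (κ x * φ x) x := fun x =>
    (intervalIntegral.integral_hasDerivAt_right ((hκ.mul hφ).intervalIntegrable _ _)
      ((hκ.mul hφ).stronglyMeasurableAtFilter _ _) (hκ.mul hφ).continuousAt).const_add c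
  have hkd : ∀ x, HasDerivAt k (κ x) x := fun x =>
    intervalIntegral.integral_hasDerivAt_right (hκ.intervalIntegrable _ _)
      (hκ.stronglyMeasurableAtFilter _ _) hκ.continuousAt
  have hGd : ∀ x, HasDerivAt (fun x => F x * Real.exp (-k x))
      (κ x * φ x * Real.exp (-k x) + F x * (Real.exp (-k x) * -κ x)) x := fun x =>
    (hFd x).mul (hkd x).neg.exp
  have hanti : AntitoneOn (fun x => F x * Real.exp (-k x)) (Icc 0 a) := by
    refine antitoneOn_of_deriv_nonpos (convex_Icc 0 a)
      (fun x _ => (hGd x).continuousAt.continuousWithinAt)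
      (fun x _ => (hGd x).differentiableAt.differentiableWithinAt) fun x hx => ?_
    rw [(hGd x).deriv]
    have hx' : x ∈ Icc 0 a := interior_subset hx
    have h1 : φ x ≤ F x := h x hx'
    have h2 := hκ0 x hx'
    have h3 := Real.exp_pos (-k x)
    have : κ x * φ x * Real.exp (-k x) + F x * (Real.exp (-k x) * -κ x)
        = -(κ x * Real.exp (-k x) * (F x - φ x)) := by ring
    rw [this, neg_nonpos]
    exact mul_nonneg (mul_nonneg h2 h3.le) (by linarith)
  have h0 : (0 : ℝ) ∈ Icc 0 a := ⟨le_refl _, hx.1.trans hx.2⟩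
  have := hanti h0 hx hx.1
  simp only [hF, hk, intervalIntegral.integral_same, neg_zero, Real.exp_zero, mul_one,
    add_zero] at this
  refine (h x hx).trans ?_
  rw [Real.exp_neg, ← div_eq_mul_inv, div_le_iff₀ (Real.exp_pos _)] at this
  exact this

theorem integral_exp_neg_mul_le {κ : ℝ} (hκ : 0 < κ) (b x : ℝ) :
    ∫ s in b..x, Real.exp (-κ * s) ≤ Real.exp (-κ * b) / κ := by
  have hd : ∀ s, HasDerivAt (fun s => -Real.exp (-κ * s) / κ) (Real.exp (-κ * s)) s := by
    intro s
    have := (((hasDerivAt_id s).const_mul (-κ)).exp.neg.div_const κ)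
    refine this.congr_deriv ?_
    simp only [id_eq]
    field_simp
  rw [intervalIntegral.integral_eq_sub_of_hasDerivAt (fun s _ => hd s)
    (Continuous.intervalIntegrable (by fun_prop) _ _)]
  have : 0 ≤ Real.exp (-κ * x) / κ := by positivity
  rw [neg_div, neg_div]
  linarith

theorem integral_exp_convolution_le {g η : ℝ} (h : η < g) (a : ℝ) :
    ∫ s in (0 : ℝ)..a, Real.exp (-g * (a - s)) * Real.exp (-η * s)
      ≤ Real.exp (-η * a) / (g - η) := by
  have hpos : 0 < g - η := sub_pos.2 h
  have hd : ∀ s, HasDerivAt (fun s => Real.exp (-g * (a - s)) * Real.exp (-η * s) / (g - η))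
      (Real.exp (-g * (a - s)) * Real.exp (-η * s)) s := by
    intro s
    have h1 : HasDerivAt (fun s => -g * (a - s)) g s := by
      have := ((hasDerivAt_id s).const_sub a).const_mul (-g)
      refine this.congr_deriv (by simp)
    have h2 : HasDerivAt (fun s => -η * s) (-η) s := by
      simpa using (hasDerivAt_id s).const_mul (-η)
    refine ((h1.exp.mul h2.exp).div_const (g - η)).congr_deriv ?_
    field_simp
    ring
  rw [intervalIntegral.integral_eq_sub_of_hasDerivAt (fun s _ => hd s)
    (Continuous.intervalIntegrable (by fun_prop) _ _)]
  have : 0 ≤ Real.exp (-g * (a - 0)) * Real.exp (-η * 0) / (g - η) := by positivity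
  have h2 : Real.exp (-g * (a - a)) * Real.exp (-η * a) / (g - η)
      = Real.exp (-η * a) / (g - η) := by simp
  rw [h2]
  linarith

/-- An error of constant size e^(-κa), integrated over an interval of length a, costs the factor a;
the strict inequality η < κ absorbs it. -/
theorem mul_exp_neg_le {κ η : ℝ} (h : η < κ) (a : ℝ) :
    a * Real.exp (-κ * a) ≤ Real.exp (-η * a) / (κ - η) := by
  have hpos : 0 < κ - η := sub_pos.2 h
  rw [le_div_iff₀ hpos]
  have h1 : a * (κ - η) ≤ Real.exp ((κ - η) * a) := by
    have := Real.add_one_le_exp ((κ - η) * a)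
    linarith
  calc a * Real.exp (-κ * a) * (κ - η) = a * (κ - η) * Real.exp (-κ * a) := by ring
    _ ≤ Real.exp ((κ - η) * a) * Real.exp (-κ * a) := by gcongr
    _ = Real.exp (-η * a) := by rw [← Real.exp_add]; congr 1; ring

variable {𝔐 : Type*} [NormedRing 𝔐] [NormedAlgebra ℝ 𝔐] [CompleteSpace 𝔐]

/-- Variation of constants around a semigroup. -/
theorem duhamel {S V f : ℝ → 𝔐} {G u : 𝔐} (hS : ∀ t, HasDerivAt S (S t * G) t) (hS0 : S 0 = u)
    (hf : Continuous f) (hV : ∀ x, HasDerivAt V (G * V x + f x) x) (b x : ℝ) :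
    u * V x = S (x - b) * V b + ∫ s in b..x, S (x - s) * f s := by
  -- The left end of the formula is u V(x), since the semigroup starts at `u`. For exterior powers
  -- `u` is the antisymmetriser and fixes V without being the identity.
  have hd : ∀ s, HasDerivAt (fun s => S (x - s) * V s) (S (x - s) * f s) s := by
    intro s
    have h1 : HasDerivAt (fun s => S (x - s)) (-(S (x - s) * G)) s := by
      have := (hS (x - s)).scomp s ((hasDerivAt_id s).const_sub x)
      exact this.congr_deriv (by simp)
    refine (h1.mul (hV s)).congr_deriv ?_
    noncomm_ring
  have hSc : Continuous S := continuous_iff_continuousAt.2 fun t => (hS t).continuousAt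
  rw [intervalIntegral.integral_eq_sub_of_hasDerivAt (fun s _ => hd s)
    (Continuous.intervalIntegrable (by fun_prop) _ _)]
  simp [hS0]

theorem norm_integral_semigroup_le {S f : ℝ → 𝔐} {C b x : ℝ} {φ : ℝ → ℝ} (hbx : b ≤ x)
    (hS : ∀ t, 0 ≤ t → ‖S t‖ ≤ C) (hφ : Continuous φ)
    (hf : ∀ s ∈ Icc b x, ‖f s‖ ≤ φ s) :
    ‖∫ s in b..x, S (x - s) * f s‖ ≤ C * ∫ s in b..x, φ s := by
  have hC : 0 ≤ C := (norm_nonneg _).trans (hS 0 le_rfl)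
  rw [← intervalIntegral.integral_const_mul]
  refine intervalIntegral.norm_integral_le_of_norm_le hbx ?_
    (Continuous.intervalIntegrable (by fun_prop) _ _)
  refine Eventually.of_forall fun s hs => (norm_mul_le _ _).trans ?_
  exact mul_le_mul (hS _ (by linarith [hs.2])) (hf s ⟨hs.1.le, hs.2⟩) (norm_nonneg _) hC

/-- An exponentially decaying perturbation of a bounded semigroup has bounded solutions, also in the
presence of a bounded inhomogeneity. -/
theorem norm_le_of_decaying_perturbation {S V Ξ f : ℝ → 𝔐} {G u : 𝔐} {C k κ a c : ℝ}
    (hS : ∀ t, HasDerivAt S (S t * G) t) (hS0 : S 0 = u) (hC : ∀ t, 0 ≤ t → ‖S t‖ ≤ C)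
    (hΞc : Continuous Ξ) (hf : Continuous f)
    (hV : ∀ x, HasDerivAt V (G * V x + (Ξ x * V x + f x)) x) (huV : ∀ x, u * V x = V x)
    (hκ : 0 < κ) (hk : 0 ≤ k) (hΞ : ∀ s ∈ Icc 0 a, ‖Ξ s‖ ≤ k * Real.exp (-κ * s))
    (hc : ∀ s ∈ Icc 0 a, ‖f s‖ ≤ c) {x : ℝ} (hx : x ∈ Icc 0 a) :
    ‖V x‖ ≤ C * (‖V 0‖ + a * c) * Real.exp (C * k / κ) := by
  have hC0 : 0 ≤ C := (norm_nonneg _).trans (hC 0 le_rfl)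
  have ha : 0 ≤ a := hx.1.trans hx.2
  have hc0 : 0 ≤ c := (norm_nonneg _).trans (hc 0 ⟨le_rfl, ha⟩)
  have hVc : Continuous V := continuous_iff_continuousAt.2 fun t => (hV t).continuousAt
  have key : ∀ x ∈ Icc 0 a, ‖V x‖ ≤ C * (‖V 0‖ + a * c)
      + ∫ s in (0 : ℝ)..x, (C * k * Real.exp (-κ * s)) * ‖V s‖ := by
    intro x hx
    have hdu := duhamel hS hS0 ((hΞc.mul hVc).add hf) hV 0 x
    rw [huV, sub_zero] at hdu
    rw [hdu]
    refine (norm_add_le _ _).trans ?_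
    have h1 : ‖S x * V 0‖ ≤ C * ‖V 0‖ :=
      (norm_mul_le _ _).trans (mul_le_mul_of_nonneg_right (hC x hx.1) (norm_nonneg _))
    have h2 := norm_integral_semigroup_le (S := S) (f := fun s => Ξ s * V s + f s)
      (φ := fun s => k * Real.exp (-κ * s) * ‖V s‖ + c) hx.1 hC (by fun_prop) fun s hs => by
        have hs' : s ∈ Icc 0 a := ⟨hs.1, hs.2.trans hx.2⟩
        refine (norm_add_le _ _).trans (add_le_add ((norm_mul_le _ _).trans ?_) (hc s hs'))
        exact mul_le_mul_of_nonneg_right (hΞ s hs') (norm_nonneg _)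
    rw [intervalIntegral.integral_add (Continuous.intervalIntegrable (by fun_prop) _ _)
      (Continuous.intervalIntegrable (by fun_prop) _ _), mul_add,
      ← intervalIntegral.integral_const_mul] at h2
    simp only [intervalIntegral.integral_const, sub_zero, smul_eq_mul] at h2
    have h3 : C * (x * c) ≤ C * (a * c) := by gcongr; exact hx.2
    simp only [← mul_assoc] at h2 h3 ⊢
    simp only [mul_add, ← mul_assoc] at h2 h3 ⊢
    change _ + ‖∫ s in (0 : ℝ)..x, S (x - s) * (Ξ s * V s + f s)‖ ≤ _
    simp only [mul_add, ← mul_assoc] at h2 h3 ⊢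
    linarith
  have hk' : ∀ s ∈ Icc 0 a, 0 ≤ C * k * Real.exp (-κ * s) := fun s _ => by positivity
  refine (gronwall_integral hVc.norm (by fun_prop) hk' key hx).trans ?_
  refine mul_le_mul_of_nonneg_left (Real.exp_le_exp.2 ?_) (by positivity)
  rw [intervalIntegral.integral_const_mul, mul_div_assoc, mul_assoc]
  refine mul_le_mul_of_nonneg_left ?_ hC0
  rw [div_eq_mul_inv]
  refine mul_le_mul_of_nonneg_left ?_ hk
  simpa using integral_exp_neg_mul_le hκ 0 x

/-- Uniform bounds on a half line for a decaying perturbation of a semigroup; the component along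
`q`, where the semigroup decays, decays as well. -/
theorem exists_norm_le_and_decay (C k κ g η v : ℝ) (hk : 0 ≤ k) (hκ : 0 < κ) (hηκ : η < κ)
    (hηg : η < g) : ∃ Q : ℝ, 0 ≤ Q ∧ ∀ (S V Ξ : ℝ → 𝔐) (G u q : 𝔐) (a : ℝ), 0 ≤ a →
      (∀ t, HasDerivAt S (S t * G) t) → S 0 = u → (∀ t, 0 ≤ t → ‖S t‖ ≤ C) →
      (∀ t, 0 ≤ t → ‖q * S t‖ ≤ C * Real.exp (-g * t)) → Continuous Ξ →
      (∀ x, HasDerivAt V (G * V x + Ξ x * V x) x) → (∀ x, u * V x = V x) → q * u = q →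
      (∀ s ∈ Icc 0 a, ‖Ξ s‖ ≤ k * Real.exp (-κ * s)) → ‖V 0‖ ≤ v →
      (∀ x ∈ Icc 0 a, ‖V x‖ ≤ Q) ∧ ‖q * V a‖ ≤ Q * Real.exp (-η * a) := by
  set Q₁ := |C| * |v| * Real.exp (|C| * k / κ) with hQ₁
  have hgη : 0 < g - η := sub_pos.2 hηg
  -- `Q₁` is the Gronwall bound of V, the second term the decay of the initial value under qS, the
  -- third the convolution of that decay with the decaying coefficient.
  refine ⟨Q₁ + |C| * |v| + |C| * (k * Q₁) / (g - η), by positivity, ?_⟩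
  intro S V Ξ G u q a ha hS hS0 hC hqC hΞc hV huV hqu hΞ hv
  have hC0 : 0 ≤ C := (norm_nonneg _).trans (hC 0 le_rfl)
  have hv0 : 0 ≤ v := (norm_nonneg _).trans hv
  have hVc : Continuous V := continuous_iff_continuousAt.2 fun t => (hV t).continuousAt
  have hQ0 : 0 ≤ Q₁ := by positivity
  have hb : ∀ x ∈ Icc 0 a, ‖V x‖ ≤ Q₁ := by
    intro x hx
    have := norm_le_of_decaying_perturbation (f := fun _ => 0) (c := 0) hS hS0 hC hΞc
      continuous_const (fun x => by simpa using hV x) huV hκ hk hΞ (by simp) hx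
    rw [mul_zero, add_zero] at this
    refine this.trans ?_
    rw [hQ₁, abs_of_nonneg hC0, abs_of_nonneg hv0]
    gcongr
  have hrest : 0 ≤ |C| * |v| + |C| * (k * Q₁) / (g - η) := by positivity
  refine ⟨fun x hx => (hb x hx).trans (by linarith), ?_⟩
  have hdu := duhamel hS hS0 (hΞc.mul hVc) hV 0 a
  rw [huV, sub_zero] at hdu
  rw [hdu, mul_add]
  have h1 : ‖q * (S a * V 0)‖ ≤ |C| * |v| * Real.exp (-η * a) := by
    rw [← mul_assoc]
    refine (norm_mul_le _ _).trans ((mul_le_mul (hqC a ha) hv (norm_nonneg _)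
      (by positivity)).trans ?_)
    rw [abs_of_nonneg hC0, abs_of_nonneg hv0]
    have : Real.exp (-g * a) ≤ Real.exp (-η * a) := by
      apply Real.exp_le_exp.2; nlinarith
    calc C * Real.exp (-g * a) * v = C * v * Real.exp (-g * a) := by ring
      _ ≤ _ := by gcongr
  have h2 : ‖q * ∫ s in (0 : ℝ)..a, S (a - s) * (Ξ s * V s)‖
      ≤ |C| * (k * Q₁) / (g - η) * Real.exp (-η * a) := by
    have hSc : Continuous S := continuous_iff_continuousAt.2 fun t => (hS t).continuousAt
    have e1 : q * ∫ s in (0 : ℝ)..a, S (a - s) * (Ξ s * V s)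
        = ∫ s in (0 : ℝ)..a, q * (S (a - s) * (Ξ s * V s)) := by
      have := (ContinuousLinearMap.mul ℝ 𝔐 q).intervalIntegral_comp_comm
        (μ := volume) (f := fun s => S (a - s) * (Ξ s * V s)) (a := 0) (b := a)
        (Continuous.intervalIntegrable (by fun_prop) _ _)
      simpa using this.symm
    rw [e1]
    have h3 : ‖∫ s in (0 : ℝ)..a, q * (S (a - s) * (Ξ s * V s))‖
        ≤ ∫ s in (0 : ℝ)..a, (C * (k * Q₁)) * (Real.exp (-g * (a - s)) * Real.exp (-η * s)) := by
      refine intervalIntegral.norm_integral_le_of_norm_le ha ?_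
        (Continuous.intervalIntegrable (by fun_prop) _ _)
      refine Eventually.of_forall fun s hs => ?_
      rw [← mul_assoc]
      have hs' : s ∈ Icc 0 a := ⟨hs.1.le, hs.2⟩
      have e2 : Real.exp (-κ * s) ≤ Real.exp (-η * s) := by
        apply Real.exp_le_exp.2; nlinarith [hs'.1]
      refine (norm_mul_le _ _).trans ((mul_le_mul (hqC (a - s) (by linarith [hs.2]))
        ((norm_mul_le _ _).trans (mul_le_mul ((hΞ s hs').trans (mul_le_mul_of_nonneg_left e2 hk))
          (hb s hs') (norm_nonneg _) (by positivity))) (norm_nonneg _) (by positivity)).trans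
          (le_of_eq ?_))
      ring
    refine h3.trans ?_
    rw [intervalIntegral.integral_const_mul, abs_of_nonneg hC0]
    have := mul_le_mul_of_nonneg_left (integral_exp_convolution_le hηg a)
      (show 0 ≤ C * (k * Q₁) by positivity)
    refine this.trans (le_of_eq ?_)
    ring
  refine (norm_add_le _ _).trans ((add_le_add h1 h2).trans ?_)
  rw [← add_mul]
  refine mul_le_mul_of_nonneg_right ?_ (Real.exp_pos _).le
  linarith

/-- Comparison of a perturbed system at `a` with the limiting system at later points. -/
theorem exists_norm_sub_le (C k κ g η v : ℝ) (hk : 0 ≤ k) (hκ : 0 < κ) (hηκ : η < κ)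
    (hηg : η < g) : ∃ Q : ℝ, 0 ≤ Q ∧ ∀ (S V W Ξ Ω : ℝ → 𝔐) (G u q : 𝔐) (a : ℝ), 0 ≤ a →
      (∀ t, HasDerivAt S (S t * G) t) → S 0 = u → (∀ t, 0 ≤ t → ‖S t‖ ≤ C) →
      (∀ t, 0 ≤ t → ‖q * S t‖ ≤ C * Real.exp (-g * t)) → (∀ t, S t - u = (S t - u) * q) →
      Continuous Ξ → Continuous Ω →
      (∀ x, HasDerivAt V (G * V x + Ξ x * V x) x) → (∀ x, u * V x = V x) →
      (∀ x, HasDerivAt W (G * W x + Ω x * W x) x) → (∀ x, u * W x = W x) → q * u = q →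
      (∀ s ∈ Icc 0 a, ‖Ξ s‖ ≤ k * Real.exp (-κ * s)) →
      (∀ s, 0 ≤ s → ‖Ω s‖ ≤ k * Real.exp (-κ * s)) →
      (∀ s ∈ Icc 0 a, ‖Ξ s - Ω s‖ ≤ k * Real.exp (-κ * a)) → V 0 = W 0 → ‖W 0‖ ≤ v →
      ∀ x, a ≤ x → ‖V a - W x‖ ≤ Q * Real.exp (-η * a) := by
  obtain ⟨Q₁, hQ₁, H⟩ := exists_norm_le_and_decay (𝔐 := 𝔐) C k κ g η v hk hκ hηκ hηg
  have hκη : 0 < κ - η := sub_pos.2 hηκ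
  refine ⟨|C| * (k * Q₁) * Real.exp (|C| * k / κ) / (κ - η) + 2 * |C| * Q₁ + |C| * (k * Q₁) / κ,
    by positivity, ?_⟩
  intro S V W Ξ Ω G u q a ha hS hS0 hC hqC hSq hΞc hΩc hV huV hW huW hqu hΞ hΩ hΞΩ hVW hv x hx
  have hC0 : 0 ≤ C := (norm_nonneg _).trans (hC 0 le_rfl)
  rw [abs_of_nonneg hC0]
  have hVc : Continuous V := continuous_iff_continuousAt.2 fun t => (hV t).continuousAt
  have hWc : Continuous W := continuous_iff_continuousAt.2 fun t => (hW t).continuousAt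
  have hVb := (H S V Ξ G u q a ha hS hS0 hC hqC hΞc hV huV hqu hΞ (hVW ▸ hv)).1
  have hWb := H S W Ω G u q a ha hS hS0 hC hqC hΩc hW huW hqu (fun s hs => hΩ s hs.1) hv
  have hWx := (H S W Ω G u q x (ha.trans hx) hS hS0 hC hqC hΩc hW huW hqu
    (fun s hs => hΩ s hs.1) hv).1
  -- The difference satisfies the W-equation with zero initial value and the inhomogeneity (Ξ - Ω)V,
  -- which is of size e^(-κa) on the whole interval.
  have h1 : ‖V a - W a‖ ≤ C * (k * Q₁) * Real.exp (C * k / κ) / (κ - η) * Real.exp (-η * a) := by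
    have := norm_le_of_decaying_perturbation (V := fun x => V x - W x) (Ξ := Ω)
      (f := fun x => (Ξ x - Ω x) * V x) (c := k * Real.exp (-κ * a) * Q₁) hS hS0 hC hΩc
      (by fun_prop) (fun x => ((hV x).sub (hW x)).congr_deriv (by noncomm_ring))
      (fun x => by rw [mul_sub, huV, huW]) hκ hk (fun s hs => hΩ s hs.1)
      (fun s hs => (norm_mul_le _ _).trans (mul_le_mul (hΞΩ s hs) (hVb s hs) (norm_nonneg _)
        (by positivity))) (x := a) ⟨ha, le_rfl⟩
    rw [hVW, sub_self, norm_zero, zero_add] at this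
    refine this.trans ?_
    calc C * (a * (k * Real.exp (-κ * a) * Q₁)) * Real.exp (C * k / κ)
        = C * (k * Q₁) * Real.exp (C * k / κ) * (a * Real.exp (-κ * a)) := by ring
      _ ≤ C * (k * Q₁) * Real.exp (C * k / κ) * (Real.exp (-η * a) / (κ - η)) := by
        gcongr
        exact mul_exp_neg_le hηκ a
      _ = _ := by ring
  have h2 : ‖W x - W a‖ ≤ (2 * C * Q₁ + C * (k * Q₁) / κ) * Real.exp (-η * a) := by
    have hdu := duhamel hS hS0 (hΩc.mul hWc) hW a x
    rw [huW] at hdu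
    -- S - u annihilates the limiting component, so only qW(a), already of size e^(-ηa), can still
    -- move after a; the integral is a tail of the decaying coefficient.
    have e1 : W x - W a = (S (x - a) - u) * (q * W a)
        + ∫ s in a..x, S (x - s) * (Ω s * W s) := by
      rw [← mul_assoc, ← hSq, sub_mul, huW, hdu]
      simp only [Pi.mul_apply]
      abel
    rw [e1]
    have hu : ‖u‖ ≤ C := hS0 ▸ hC 0 le_rfl
    have h3 : ‖(S (x - a) - u) * (q * W a)‖ ≤ 2 * C * Q₁ * Real.exp (-η * a) := by
      refine (norm_mul_le _ _).trans ?_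
      rw [mul_assoc]
      refine mul_le_mul ((norm_sub_le _ _).trans ?_) hWb.2 (norm_nonneg _) (by positivity)
      linarith [hC (x - a) (by linarith)]
    have h4 := norm_integral_semigroup_le (S := S) (f := fun s => Ω s * W s)
      (φ := fun s => k * Q₁ * Real.exp (-κ * s)) hx hC (by fun_prop) fun s hs => by
        refine (norm_mul_le _ _).trans ((mul_le_mul (hΩ s (ha.trans hs.1))
          (hWx s ⟨ha.trans hs.1, hs.2⟩) (norm_nonneg _) (by positivity)).trans (le_of_eq ?_))
        ring
    rw [intervalIntegral.integral_const_mul] at h4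
    have h5 : C * (k * Q₁ * ∫ s in a..x, Real.exp (-κ * s))
        ≤ C * (k * Q₁) / κ * Real.exp (-η * a) := by
      have e2 : Real.exp (-κ * a) ≤ Real.exp (-η * a) := by
        apply Real.exp_le_exp.2; nlinarith
      calc C * (k * Q₁ * ∫ s in a..x, Real.exp (-κ * s))
          ≤ C * (k * Q₁ * (Real.exp (-κ * a) / κ)) := by
            gcongr; exact integral_exp_neg_mul_le hκ a x
        _ ≤ C * (k * Q₁ * (Real.exp (-η * a) / κ)) := by gcongr
        _ = _ := by ring
    refine (norm_add_le _ _).trans ((add_le_add h3 (h4.trans h5)).trans (le_of_eq ?_))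
    ring
  have : V a - W x = (V a - W a) - (W x - W a) := by abel
  rw [this]
  refine (norm_sub_le _ _).trans ((add_le_add h1 h2).trans (le_of_eq ?_))
  ring

end dichotomy

/-! ### Matrix norms, entries, and smoothness of minors. -/

section normBounds
variable {m : Type*} [Fintype m] [DecidableEq m]

theorem norm_entry_le_norm (M : Matrix m m ℂ) (i j : m) : ‖M i j‖ ≤ ‖M‖ := by
  rw [Matrix.linfty_opNorm_def]
  have h1 : ‖M i j‖₊ ≤ ∑ j, ‖M i j‖₊ :=
    Finset.single_le_sum (f := fun j => ‖M i j‖₊) (fun _ _ => zero_le) (Finset.mem_univ j)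
  have h2 : ∑ j, ‖M i j‖₊ ≤ Finset.univ.sup fun i => ∑ j, ‖M i j‖₊ :=
    Finset.le_sup (f := fun i => ∑ j, ‖M i j‖₊) (Finset.mem_univ i)
  exact_mod_cast h1.trans h2

theorem norm_le_card_mul (M : Matrix m m ℂ) {b : ℝ} (hb : 0 ≤ b) (h : ∀ i j, ‖M i j‖ ≤ b) :
    ‖M‖ ≤ Fintype.card m * b := by
  rw [Matrix.linfty_opNorm_def]
  lift b to NNReal using hb
  have : (Finset.univ.sup fun i => ∑ j, ‖M i j‖₊) ≤ Fintype.card m * b := by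
    refine Finset.sup_le fun i _ => ?_
    refine (Finset.sum_le_card_nsmul _ _ b fun j _ => ?_).trans (by simp [Finset.card_univ])
    exact_mod_cast h i j
  exact_mod_cast this

theorem norm_transpose_le (M : Matrix m m ℂ) : ‖M.transpose‖ ≤ Fintype.card m * ‖M‖ :=
  norm_le_card_mul _ (norm_nonneg _) fun i j => norm_entry_le_norm M j i

theorem norm_trace_le (M : Matrix m m ℂ) : ‖M.trace‖ ≤ Fintype.card m * ‖M‖ := by
  refine (norm_sum_le _ _).trans ((Finset.sum_le_card_nsmul _ _ ‖M‖ fun j _ => ?_).trans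
    (by simp [Finset.card_univ]))
  exact norm_entry_le_norm M j j

/-- Entries as continuous linear functionals. -/
noncomputable def entryCLM (i j : m) : Matrix m m ℂ →L[ℂ] ℂ :=
  LinearMap.toContinuousLinearMap (Matrix.entryLinearMap ℂ ℂ i j)

theorem contDiff_of_entries {E : Type*} [NormedAddCommGroup E] [NormedSpace ℂ E]
    {f : E → Matrix m m ℂ} {N : WithTop ℕ∞} (h : ∀ i j, ContDiff ℂ N fun x => f x i j) :
    ContDiff ℂ N f := by
  have : f = fun x => ∑ i, ∑ j, f x i j • (Matrix.single i j (1 : ℂ)) := by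
    funext x
    conv_lhs => rw [Matrix.matrix_eq_sum_single (f x)]
    simp
  rw [this]
  exact ContDiff.sum fun i _ => ContDiff.sum fun j _ => (h i j).smul contDiff_const

theorem contDiff_entry {N : WithTop ℕ∞} (i j : m) : ContDiff ℂ N fun M : Matrix m m ℂ => M i j :=
  (entryCLM i j).contDiff

theorem contDiff_det {N : WithTop ℕ∞} : ContDiff ℂ N fun M : Matrix m m ℂ => M.det := by
  simp only [Matrix.det_apply']
  exact ContDiff.sum fun σ _ => contDiff_const.mul (contDiff_prod fun i _ => contDiff_entry _ _)

theorem contDiff_compound {N : WithTop ℕ∞} (k : ℕ) :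
    ContDiff ℂ N (compound k : Matrix m m ℂ → _) := by
  refine contDiff_of_entries fun i j => ?_
  simp only [compound, Matrix.of_apply, Matrix.det_apply', Matrix.submatrix_apply]
  exact contDiff_const.mul
    (ContDiff.sum fun σ _ => contDiff_const.mul (contDiff_prod fun a _ => contDiff_entry _ _))

end normBounds

/-! ### Multiplicative maps along linear flows. -/

section multiplicative
variable {𝔸 𝔐 : Type*} [NormedRing 𝔸] [NormedAlgebra ℂ 𝔸] [NormedRing 𝔐] [NormedAlgebra ℂ 𝔐]
  {C : 𝔸 → 𝔐}

/-- The infinitesimal generator of a multiplicative map. -/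
noncomputable def infGen (C : 𝔸 → 𝔐) : 𝔸 →L[ℂ] 𝔐 := fderiv ℂ C 1

/-- Differentiate C(xb) = C(x)C(b) at x = 1. It follows that C maps solutions of a linear equation
to solutions of a linear equation; this is used for the exterior powers and for the determinant. -/
theorem fderiv_mul_right_apply (hC : Differentiable ℂ C) (hmul : ∀ a b, C (a * b) = C a * C b)
    (a b : 𝔸) : fderiv ℂ C b (a * b) = infGen C a * C b := by
  have h1 : HasFDerivAt (fun x => C (x * b)) ((fderiv ℂ C (1 * b)).comp
      ((ContinuousLinearMap.mul ℂ 𝔸).flip b)) 1 :=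
    (hC (1 * b)).hasFDerivAt.comp 1 ((ContinuousLinearMap.mul ℂ 𝔸).flip b).hasFDerivAt
  have h2 : HasFDerivAt (fun x => C (x * b)) (((ContinuousLinearMap.mul ℂ 𝔐).flip (C b)).comp
      (fderiv ℂ C 1)) 1 := by
    simp only [hmul]
    exact ((ContinuousLinearMap.mul ℂ 𝔐).flip (C b)).hasFDerivAt.comp 1 (hC 1).hasFDerivAt
  have := congrArg (fun l => l a) (h1.unique h2)
  simpa [infGen] using this

theorem fderiv_mul_left_apply (hC : Differentiable ℂ C) (hmul : ∀ a b, C (a * b) = C a * C b)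
    (a b : 𝔸) : fderiv ℂ C b (b * a) = C b * infGen C a := by
  have h1 : HasFDerivAt (fun x => C (b * x)) ((fderiv ℂ C (b * 1)).comp
      (ContinuousLinearMap.mul ℂ 𝔸 b)) 1 :=
    (hC (b * 1)).hasFDerivAt.comp 1 (ContinuousLinearMap.mul ℂ 𝔸 b).hasFDerivAt
  have h2 : HasFDerivAt (fun x => C (b * x)) ((ContinuousLinearMap.mul ℂ 𝔐 (C b)).comp
      (fderiv ℂ C 1)) 1 := by
    simp only [hmul]
    exact (ContinuousLinearMap.mul ℂ 𝔐 (C b)).hasFDerivAt.comp 1 (hC 1).hasFDerivAt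
  have := congrArg (fun l => l a) (h1.unique h2)
  simpa [infGen] using this

theorem infGen_commute (hC : Differentiable ℂ C) (hmul : ∀ a b, C (a * b) = C a * C b)
    {a b : 𝔸} (h : a * b = b * a) : infGen C a * C b = C b * infGen C a := by
  rw [← fderiv_mul_right_apply hC hmul, ← fderiv_mul_left_apply hC hmul, h]

theorem hasDerivAt_mul_map (hC : Differentiable ℂ C) (hmul : ∀ a b, C (a * b) = C a * C b)
    {Φ : ℝ → 𝔸} {A : 𝔸} {x : ℝ} (h : HasDerivAt Φ (A * Φ x) x) :
    HasDerivAt (fun x => C (Φ x)) (infGen C A * C (Φ x)) x := by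
  have := ((hC (Φ x)).hasFDerivAt.restrictScalars ℝ).comp_hasDerivAt x h
  refine this.congr_deriv ?_
  exact fderiv_mul_right_apply hC hmul A (Φ x)

theorem hasDerivAt_mul_map' (hC : Differentiable ℂ C) (hmul : ∀ a b, C (a * b) = C a * C b)
    {Φ : ℝ → 𝔸} {A : 𝔸} {x : ℝ} (h : HasDerivAt Φ (Φ x * A) x) :
    HasDerivAt (fun x => C (Φ x)) (C (Φ x) * infGen C A) x := by
  have := ((hC (Φ x)).hasFDerivAt.restrictScalars ℝ).comp_hasDerivAt x h
  refine this.congr_deriv ?_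
  exact fderiv_mul_left_apply hC hmul A (Φ x)

end multiplicative

/-! ### Persistence of growth rates under small perturbations. -/

section perturbation
open Set MeasureTheory
variable {𝔐 : Type*} [NormedRing 𝔐] [NormedAlgebra ℝ 𝔐] [CompleteSpace 𝔐]

/-- A small perturbation commuting with `q` changes the growth rate on the range of `q` little. -/
theorem norm_le_of_small_perturbation {S Y : ℝ → 𝔐} {G E u q : 𝔐} {C b : ℝ}
    (hS : ∀ t, HasDerivAt S (S t * G) t) (hS0 : S 0 = u) (hC0 : 0 ≤ C)
    (hC : ∀ t, 0 ≤ t → ‖S t * q‖ ≤ C * Real.exp (b * t)) (hE : E * q = q * E)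
    (hY : ∀ t, HasDerivAt Y ((G + E) * Y t) t) (huY : ∀ t, u * Y t = Y t)
    (hqY : ∀ t, q * Y t = Y t) {t : ℝ} (ht : 0 ≤ t) :
    ‖Y t‖ ≤ C * ‖Y 0‖ * Real.exp ((b + C * ‖E‖) * t) := by
  have hYc : Continuous Y := continuous_iff_continuousAt.2 fun t => (hY t).continuousAt
  have hSc : Continuous S := continuous_iff_continuousAt.2 fun t => (hS t).continuousAt
  have key : ∀ x ∈ Icc 0 t, Real.exp (-b * x) * ‖Y x‖ ≤ C * ‖Y 0‖
      + ∫ s in (0 : ℝ)..x, (C * ‖E‖) * (Real.exp (-b * s) * ‖Y s‖) := by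
    intro x hx
    have hdu := duhamel hS hS0 (f := fun s => E * Y s) (by fun_prop)
      (fun s => (hY s).congr_deriv (add_mul _ _ _)) 0 x
    rw [huY, sub_zero] at hdu
    have h1 : ‖S x * Y 0‖ ≤ C * Real.exp (b * x) * ‖Y 0‖ := by
      rw [← hqY 0, ← mul_assoc]
      refine (norm_mul_le _ _).trans ?_
      rw [hqY 0]
      exact mul_le_mul_of_nonneg_right (hC x hx.1) (norm_nonneg _)
    have h2 : ‖∫ s in (0 : ℝ)..x, S (x - s) * (E * Y s)‖
        ≤ ∫ s in (0 : ℝ)..x, Real.exp (b * x) *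
          ((C * ‖E‖) * (Real.exp (-b * s) * ‖Y s‖)) := by
      refine intervalIntegral.norm_integral_le_of_norm_le hx.1 ?_
        (Continuous.intervalIntegrable (by fun_prop) _ _)
      refine Filter.Eventually.of_forall fun s hs => ?_
      -- Here the commutation of E with q enters: S is controlled at rate b only after
      -- multiplication by q.
      have e1 : S (x - s) * (E * Y s) = S (x - s) * q * (E * Y s) := by
        conv_lhs => rw [← hqY s, ← mul_assoc E, hE]
        noncomm_ring
      rw [e1]
      refine (norm_mul_le _ _).trans ((mul_le_mul (hC (x - s) (by linarith [hs.2]))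
        (norm_mul_le _ _) (norm_nonneg _) (by positivity)).trans (le_of_eq ?_))
      have : Real.exp (b * (x - s)) = Real.exp (b * x) * Real.exp (-b * s) := by
        rw [← Real.exp_add]; congr 1; ring
      rw [this]; ring
    rw [intervalIntegral.integral_const_mul] at h2
    have h3 : ‖Y x‖ ≤ Real.exp (b * x) * (C * ‖Y 0‖
        + ∫ s in (0 : ℝ)..x, (C * ‖E‖) * (Real.exp (-b * s) * ‖Y s‖)) := by
      conv_lhs => rw [hdu]
      refine (norm_add_le _ _).trans ((add_le_add h1 h2).trans (le_of_eq ?_))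
      ring
    calc Real.exp (-b * x) * ‖Y x‖ ≤ Real.exp (-b * x) * (Real.exp (b * x) * (C * ‖Y 0‖
        + ∫ s in (0 : ℝ)..x, (C * ‖E‖) * (Real.exp (-b * s) * ‖Y s‖))) := by gcongr
      _ = _ := by
        rw [← mul_assoc, ← Real.exp_add]
        simp
  have := gronwall_integral (κ := fun _ => C * ‖E‖) (by fun_prop) continuous_const
    (fun _ _ => by positivity) key (x := t) ⟨ht, le_rfl⟩
  rw [intervalIntegral.integral_const, sub_zero, smul_eq_mul] at this
  calc ‖Y t‖ = Real.exp (b * t) * (Real.exp (-b * t) * ‖Y t‖) := by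
        rw [← mul_assoc, ← Real.exp_add]; simp
    _ ≤ Real.exp (b * t) * (C * ‖Y 0‖ * Real.exp (t * (C * ‖E‖))) := by gcongr
    _ = _ := by
      rw [mul_left_comm, ← Real.exp_add]; congr 2; ring

end perturbation

/-! ### Bases of generalised eigenvectors. -/

section spectralBasis
open Module
variable {n : ℕ}

/-- A basis of generalised eigenvectors, as an invertible matrix. -/
theorem exists_spectral_basis (B : Matrix (Fin n) (Fin n) ℂ) :
    ∃ (T : Matrix (Fin n) (Fin n) ℂ) (μ : Fin n → ℂ), IsUnit T.det ∧
      (∀ j, (fun i => T i j) ∈ End.maxGenEigenspace (Matrix.toLin' B) (μ j)) ∧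
      (∀ ν v, v ∈ End.maxGenEigenspace (Matrix.toLin' B) ν → ∀ i, μ i ≠ ν →
        T⁻¹.mulVec v i = 0) ∧
      ∀ ν, (Finset.univ.filter fun j => μ j = ν).card = B.charpoly.rootMultiplicity ν := by
  classical
  set φ := Matrix.toLin' B with hφ
  have hint : DirectSum.IsInternal fun ν : ℂ => End.maxGenEigenspace φ ν :=
    DirectSum.isInternal_submodule_of_iSupIndep_of_iSup_eq_top
      (End.independent_maxGenEigenspace φ) (End.iSup_maxGenEigenspace_eq_top φ)
  set b := hint.collectedBasis fun ν => finBasis ℂ (End.maxGenEigenspace φ ν) with hb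
  have : Finite (Σ ν : ℂ, Fin (finrank ℂ (End.maxGenEigenspace φ ν))) := Module.Finite.finite_basis b
  have := Fintype.ofFinite (Σ ν : ℂ, Fin (finrank ℂ (End.maxGenEigenspace φ ν)))
  have hcard : Fintype.card (Σ ν : ℂ, Fin (finrank ℂ (End.maxGenEigenspace φ ν)))
      = Fintype.card (Fin n) := by
    rw [← finrank_eq_card_basis b, Module.finrank_fin_fun, Fintype.card_fin]
  let e := Fintype.equivOfCardEq hcard
  set b' := b.reindex e with hb'
  set T : Matrix (Fin n) (Fin n) ℂ := (Pi.basisFun ℂ (Fin n)).toMatrix b' with hT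
  have hTapp : ∀ i j, T i j = b' j i := fun i j => by simp [hT, Basis.toMatrix_apply]
  have hTinv : b'.toMatrix (Pi.basisFun ℂ (Fin n)) * T = 1 :=
    b'.toMatrix_mul_toMatrix_flip (Pi.basisFun ℂ (Fin n))
  have hdet : IsUnit T.det := by
    have := congrArg Matrix.det hTinv
    rw [Matrix.det_mul, Matrix.det_one] at this
    exact IsUnit.of_mul_eq_one_right _ this
  have hinv : T⁻¹ = b'.toMatrix (Pi.basisFun ℂ (Fin n)) := Matrix.inv_eq_left_inv hTinv
  refine ⟨T, fun j => (e.symm j).1, hdet, fun j => ?_, fun ν v hv i hi => ?_, fun ν => ?_⟩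
  · have h1 : (fun i => T i j) = b (e.symm j) := by
      funext i; rw [hTapp, hb', Basis.reindex_apply]
    rw [h1]
    exact hint.collectedBasis_mem _ _
  · have h1 : T⁻¹.mulVec v i = b'.repr v i := by
      rw [hinv]
      have := Basis.toMatrix_mulVec_repr (b := Pi.basisFun ℂ (Fin n)) (b' := b') (m := v)
      rw [← this]
      simp only [Matrix.mulVec, dotProduct, Pi.basisFun_repr]
    rw [h1, hb', Basis.repr_reindex_apply]
    exact hint.collectedBasis_repr_of_mem_ne _ hi.symm hv
  · rw [← Matrix.charpoly_toLin', ← LinearMap.finrank_maxGenEigenspace_eq]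
    rw [← Fintype.card_fin (finrank ℂ (End.maxGenEigenspace (Matrix.toLin' B) ν)),
      ← Finset.card_univ]
    symm
    refine Finset.card_bij (fun a _ => e ⟨ν, a⟩) ?_ ?_ ?_
    · intro a _; simp
    · intro a _ a' _ h
      have := e.injective h
      simpa using this
    · intro j hj
      simp only [Finset.mem_filter, Finset.mem_univ, true_and] at hj
      subst hj
      exact ⟨(e.symm j).2, Finset.mem_univ _, by simp⟩

/-- A matrix commuting with B preserves the generalised eigenspaces of B, so in an adapted basis it
cannot link indices belonging to different eigenvalues. -/
theorem apply_eq_zero_of_commute {B T : Matrix (Fin n) (Fin n) ℂ} {μ : Fin n → ℂ}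
    (hT : IsUnit T.det)
    (hcol : ∀ j, (fun i => T i j) ∈ End.maxGenEigenspace (Matrix.toLin' B) (μ j))
    (hinv : ∀ ν v, v ∈ End.maxGenEigenspace (Matrix.toLin' B) ν → ∀ i, μ i ≠ ν →
        T⁻¹.mulVec v i = 0) {h : Matrix (Fin n) (Fin n) ℂ}
    (hc : h * (T⁻¹ * B * T) = (T⁻¹ * B * T) * h) {i j : Fin n} (hij : μ i ≠ μ j) : h i j = 0 := by
  have hTT : T * T⁻¹ = 1 := Matrix.mul_nonsing_inv _ hT
  have hTT' : T⁻¹ * T = 1 := Matrix.nonsing_inv_mul _ hT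
  have hcomm : Commute (Matrix.toLin' B) (Matrix.toLin' (T * h * T⁻¹)) := by
    change Matrix.toLin' B ∘ₗ Matrix.toLin' (T * h * T⁻¹)
      = Matrix.toLin' (T * h * T⁻¹) ∘ₗ Matrix.toLin' B
    rw [← Matrix.toLin'_mul, ← Matrix.toLin'_mul]
    congr 1
    calc B * (T * h * T⁻¹) = (T * T⁻¹) * B * (T * h * T⁻¹) := by rw [hTT, one_mul]
      _ = T * ((T⁻¹ * B * T) * h) * T⁻¹ := by noncomm_ring
      _ = T * (h * (T⁻¹ * B * T)) * T⁻¹ := by rw [hc]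
      _ = (T * h * T⁻¹) * B * (T * T⁻¹) := by noncomm_ring
      _ = _ := by rw [hTT, mul_one]
  have h1 := End.mapsTo_maxGenEigenspace_of_comm hcomm (μ j) (hcol j)
  have h2 := hinv (μ j) _ h1 i hij
  have h3 : T⁻¹.mulVec (Matrix.toLin' (T * h * T⁻¹) fun i => T i j) i = (T⁻¹ * (T * h * T⁻¹) * T) i j := by
    rw [Matrix.toLin'_apply, Matrix.mulVec_mulVec]
    simp only [Matrix.mulVec, dotProduct, Matrix.mul_apply]
  rw [h3] at h2
  have h4 : T⁻¹ * (T * h * T⁻¹) * T = h := by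
    calc T⁻¹ * (T * h * T⁻¹) * T = (T⁻¹ * T) * h * (T⁻¹ * T) := by noncomm_ring
      _ = h := by rw [hTT', one_mul, mul_one]
  rwa [h4] at h2

end spectralBasis

/-! ### Growth of orbits in generalised eigenspaces. -/

section growth
open Module NormedSpace Set
variable {n : ℕ}

theorem hasDerivAt_exp_real_smul {𝔸 : Type*} [NormedRing 𝔸] [NormedAlgebra ℝ 𝔸] [CompleteSpace 𝔸]
    (B : 𝔸) (t : ℝ) : HasDerivAt (fun t : ℝ => exp (t • B)) (exp (t • B) * B) t :=
  hasDerivAt_exp_smul_const B t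

theorem hasDerivAt_exp_mulVec (B : Matrix (Fin n) (Fin n) ℂ) (v : Fin n → ℂ) (t : ℝ) :
    HasDerivAt (fun t : ℝ => (exp (t • B)).mulVec v) ((exp (t • B)).mulVec (B.mulVec v)) t := by
  have h := LinearMap.hasDerivAt_comp_real
    (((Matrix.mulVecBilin ℝ ℂ : Matrix (Fin n) (Fin n) ℂ →ₗ[ℝ] _).flip v)) (hasDerivAt_exp_real_smul B t)
  refine h.congr_deriv ?_
  change (exp (t • B) * B).mulVec v = _
  exact (Matrix.mulVec_mulVec _ _ _).symm

/-- Induction on the order of the generalised eigenvector: the derivative of e^(-μt) e^(tB) v is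
e^(-μt) e^(tB) (B - μ)v, where (B - μ)v has lower order. Integrating a bound of size e^((a - Re μ)t)
reproduces that rate, so polynomial factors never appear. -/
theorem exists_norm_exp_mulVec_le (B : Matrix (Fin n) (Fin n) ℂ) (μ : ℂ) {a : ℝ} (ha : μ.re < a)
    {v : Fin n → ℂ} (hv : v ∈ End.maxGenEigenspace (Matrix.toLin' B) μ) :
    ∃ C : ℝ, ∀ t : ℝ, 0 ≤ t → ‖(exp (t • B)).mulVec v‖ ≤ C * Real.exp (a * t) := by
  rw [End.mem_maxGenEigenspace] at hv
  obtain ⟨k, hk⟩ := hv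
  induction k generalizing v with
  | zero =>
    refine ⟨0, fun t _ => ?_⟩
    have : v = 0 := by simpa using hk
    simp [this]
  | succ k ih =>
    obtain ⟨C₀, hC₀⟩ := ih (v := (Matrix.toLin' B - μ • 1) v) (by rwa [pow_succ] at hk)
    set C := |C₀| with hC
    set δ := a - μ.re with hδ
    have hδ0 : 0 < δ := sub_pos.2 ha
    set w := B.mulVec v - μ • v with hw
    have hw' : (Matrix.toLin' B - μ • 1) v = w := by simp [hw, Matrix.toLin'_apply]
    rw [hw'] at hC₀
    have hd : ∀ t : ℝ, HasDerivAt (fun t : ℝ => Complex.exp (-μ * t) • (exp (t • B)).mulVec v)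
        (Complex.exp (-μ * t) • (exp (t • B)).mulVec w) t := by
      intro t
      have h1 : HasDerivAt (fun t : ℝ => Complex.exp (-μ * t)) (Complex.exp (-μ * t) * -μ) t := by
        have := ((hasDerivAt_id t).ofReal_comp.const_mul (-μ)).cexp
        simpa using this
      refine (h1.smul (hasDerivAt_exp_mulVec B v t)).congr_deriv ?_
      rw [hw, Matrix.mulVec_sub, Matrix.mulVec_smul, smul_sub, smul_smul, mul_neg, neg_smul]
      abel
    have hn : ∀ t : ℝ, ‖Complex.exp (-μ * t)‖ = Real.exp (-μ.re * t) := by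
      intro t
      rw [Complex.norm_exp]; simp
    have hB : ∀ t : ℝ, HasDerivAt (fun t => ‖v‖ + C / δ * Real.exp (δ * t))
        (C * Real.exp (δ * t)) t := by
      intro t
      have := ((((hasDerivAt_id t).const_mul δ).exp).const_mul (C / δ)).const_add ‖v‖
      refine this.congr_deriv ?_
      simp only [id_eq]
      field_simp
    refine ⟨‖v‖ + C / δ, fun t ht => ?_⟩
    have := image_norm_le_of_norm_deriv_right_le_deriv_boundary (a := 0) (b := t)
      (f := fun t : ℝ => Complex.exp (-μ * t) • (exp (t • B)).mulVec v)
      (fun t _ => (hd t).continuousAt.continuousWithinAt) (fun t _ => (hd t).hasDerivWithinAt)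
      (by simp; positivity) hB (fun s hs => by
        rw [norm_smul, hn]
        calc Real.exp (-μ.re * s) * ‖(exp (s • B)).mulVec w‖
            ≤ Real.exp (-μ.re * s) * (C * Real.exp (a * s)) := by
              gcongr
              exact (hC₀ s hs.1).trans (by gcongr; exact le_abs_self _)
          _ = C * Real.exp (δ * s) := by
              rw [mul_left_comm, ← Real.exp_add]; congr 2; rw [hδ]; ring) (x := t) ⟨ht, le_rfl⟩
    rw [norm_smul, hn] at this
    have h1 : 1 ≤ Real.exp (δ * t) := Real.one_le_exp (by positivity)
    calc ‖(exp (t • B)).mulVec v‖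
        = Real.exp (μ.re * t) * (Real.exp (-μ.re * t) * ‖(exp (t • B)).mulVec v‖) := by
          rw [← mul_assoc, ← Real.exp_add]; simp
      _ ≤ Real.exp (μ.re * t) * (‖v‖ + C / δ * Real.exp (δ * t)) := by gcongr
      _ ≤ Real.exp (μ.re * t) * (‖v‖ * Real.exp (δ * t) + C / δ * Real.exp (δ * t)) := by
          gcongr
          exact le_mul_of_one_le_right (norm_nonneg _) h1
      _ = (‖v‖ + C / δ) * (Real.exp (μ.re * t) * Real.exp (δ * t)) := by ring
      _ = _ := by rw [← Real.exp_add]; congr 2; rw [hδ]; ring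

theorem mem_maxGenEigenspace_neg {B : Matrix (Fin n) (Fin n) ℂ} {μ : ℂ} {v : Fin n → ℂ}
    (hv : v ∈ End.maxGenEigenspace (Matrix.toLin' B) μ) :
    v ∈ End.maxGenEigenspace (Matrix.toLin' (-B)) (-μ) := by
  rw [End.mem_maxGenEigenspace] at hv ⊢
  obtain ⟨k, hk⟩ := hv
  refine ⟨k, ?_⟩
  set N : End ℂ (Fin n → ℂ) := Matrix.toLin' B - μ • 1 with hN
  have : (Matrix.toLin' (-B) - (-μ) • (1 : End ℂ (Fin n → ℂ)) : End ℂ (Fin n → ℂ)) = -N := by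
    refine LinearMap.ext fun w => ?_
    simp [hN]
    abel
  have hpow : ∀ (k : ℕ) w, ((-N) ^ k) w = (-1 : ℂ) ^ k • (N ^ k) w := fun k => by
    induction k with
    | zero => intro w; simp
    | succ k ih =>
      intro w
      rw [pow_succ (-N), Module.End.mul_apply, ih, LinearMap.neg_apply, map_neg, pow_succ N,
        Module.End.mul_apply, pow_succ (-1 : ℂ)]
      simp
  rw [this, hpow, hk, smul_zero]

/-- Vectors whose orbit under the flow of `B` grows at most at rate `a`. -/
def growthSubmodule (B : Matrix (Fin n) (Fin n) ℂ) (a : ℝ) : Submodule ℂ (Fin n → ℂ) where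
  carrier := {v | ∃ C : ℝ, ∀ t : ℝ, 0 ≤ t → ‖(exp (t • B)).mulVec v‖ ≤ C * Real.exp (a * t)}
  zero_mem' := ⟨0, fun t _ => by simp⟩
  add_mem' := by
    rintro v w ⟨C, hC⟩ ⟨D, hD⟩
    refine ⟨C + D, fun t ht => ?_⟩
    rw [Matrix.mulVec_add, add_mul]
    exact (norm_add_le _ _).trans (add_le_add (hC t ht) (hD t ht))
  smul_mem' := by
    rintro c v ⟨C, hC⟩
    refine ⟨‖c‖ * C, fun t ht => ?_⟩
    rw [Matrix.mulVec_smul, norm_smul, mul_assoc]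
    exact mul_le_mul_of_nonneg_left (hC t ht) (norm_nonneg _)

/-- Spectral subspaces are used in the sequel only through the growth of their orbits, which makes
continuity of spectral projections in the parameter unnecessary. -/
theorem spectralBelow_le_growthSubmodule (B : Matrix (Fin n) (Fin n) ℂ) (c : ℝ) :
    spectralBelow B c ≤ growthSubmodule B c :=
  iSup₂_le fun μ hμ _ hv => exists_norm_exp_mulVec_le B μ hμ hv

theorem spectralAbove_le_growthSubmodule (B : Matrix (Fin n) (Fin n) ℂ) (c : ℝ) :
    spectralAbove B c ≤ growthSubmodule (-B) (-c) :=
  iSup₂_le fun μ hμ _ hv => exists_norm_exp_mulVec_le (-B) (-μ) (by simpa using hμ)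
    (mem_maxGenEigenspace_neg hv)

theorem exp_real_smul_conj {T : Matrix (Fin n) (Fin n) ℂ} (hT : IsUnit T.det)
    (B : Matrix (Fin n) (Fin n) ℂ) (t : ℝ) :
    exp (t • (T⁻¹ * B * T)) = T⁻¹ * exp (t • B) * T := by
  rw [← Matrix.exp_conj' T (t • B) ((Matrix.isUnit_iff_isUnit_det T).2 hT), mul_smul_comm,
    smul_mul_assoc]

/-- In coordinates of generalised eigenvectors the columns of the flow have their own growth
rates. -/
theorem exists_norm_exp_apply_le {B T : Matrix (Fin n) (Fin n) ℂ} {ρ : Fin n → ℝ}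
    (hT : IsUnit T.det) (h : ∀ j, ∃ C : ℝ, ∀ t : ℝ, 0 ≤ t →
      ‖(exp (t • B)).mulVec (fun i => T i j)‖ ≤ C * Real.exp (ρ j * t)) :
    ∃ C : ℝ, 1 ≤ C ∧ ∀ t : ℝ, 0 ≤ t → ∀ i j,
      ‖exp (t • (T⁻¹ * B * T)) i j‖ ≤ C * Real.exp (ρ j * t) := by
  choose C hC using h
  refine ⟨1 + ‖T⁻¹‖ * ∑ j, |C j|, ?_, fun t ht i j => ?_⟩
  · have : 0 ≤ ‖T⁻¹‖ * ∑ j, |C j| := by positivity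
    linarith
  have h1 : exp (t • (T⁻¹ * B * T)) i j
      = T⁻¹.mulVec ((exp (t • B)).mulVec (fun i => T i j)) i := by
    rw [exp_real_smul_conj hT, mul_assoc, Matrix.mul_apply]
    simp only [Matrix.mulVec, dotProduct, Matrix.mul_apply]
  rw [h1]
  refine (norm_le_pi_norm _ i).trans ((Matrix.linfty_opNorm_mulVec _ _).trans ?_)
  have h2 : C j ≤ ∑ j, |C j| := (le_abs_self _).trans
    (Finset.single_le_sum (f := fun j => |C j|) (fun _ _ => abs_nonneg _) (Finset.mem_univ j))
  calc ‖T⁻¹‖ * ‖(exp (t • B)).mulVec (fun i => T i j)‖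
      ≤ ‖T⁻¹‖ * ((∑ j, |C j|) * Real.exp (ρ j * t)) := by
        gcongr
        exact (hC j t ht).trans (by gcongr)
    _ ≤ (1 + ‖T⁻¹‖ * ∑ j, |C j|) * Real.exp (ρ j * t) := by
        have := Real.exp_pos (ρ j * t)
        nlinarith

end growth

/-! ### Block diagonalisation near a block diagonal matrix. -/

section blockDiagonal
open Filter Topology
variable {n : ℕ} {ι : Type*} [DecidableEq ι]

/-- The block diagonal part with respect to a colouring of the indices. -/
def blockPart (col : Fin n → ι) : Matrix (Fin n) (Fin n) ℂ →ₗ[ℂ] Matrix (Fin n) (Fin n) ℂ where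
  toFun y := Matrix.of fun i j => if col i = col j then y i j else 0
  map_add' x y := by ext i j; simp only [Matrix.of_apply, Matrix.add_apply]; split_ifs <;> simp
  map_smul' c y := by ext i j; simp only [Matrix.of_apply, Matrix.smul_apply, RingHom.id_apply]; split_ifs <;> simp

theorem blockPart_apply (col : Fin n → ι) (y : Matrix (Fin n) (Fin n) ℂ) (i j : Fin n) :
    blockPart col y i j = if col i = col j then y i j else 0 := rfl

theorem blockPart_blockPart (col : Fin n → ι) (y : Matrix (Fin n) (Fin n) ℂ) :
    blockPart col (blockPart col y) = blockPart col y := by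
  ext i j; simp only [blockPart_apply]; split_ifs <;> rfl

theorem blockPart_mul_off {col : Fin n → ι} {B h : Matrix (Fin n) (Fin n) ℂ}
    (hB : blockPart col B = B) (hh : blockPart col h = 0) :
    blockPart col (h * B) = 0 ∧ blockPart col (B * h) = 0 := by
  have hB' : ∀ i j, col i ≠ col j → B i j = 0 := fun i j hij => by
    rw [← hB, blockPart_apply, if_neg hij]
  have hh' : ∀ i j, col i = col j → h i j = 0 := fun i j hij => by
    have := congrFun (congrFun hh i) j
    rwa [blockPart_apply, if_pos hij] at this
  constructor <;> ext i j <;> rw [blockPart_apply, Matrix.zero_apply] <;> split_ifs with hij <;>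
    try rfl
  all_goals
    rw [Matrix.mul_apply]
    refine Finset.sum_eq_zero fun l _ => ?_
  · by_cases hl : col l = col j
    · rw [hh' i l (hij.trans hl.symm), zero_mul]
    · rw [hB' l j hl, mul_zero]
  · by_cases hl : col i = col l
    · rw [hh' l j (hl.symm.trans hij), mul_zero]
    · rw [hB' i l hl, zero_mul]

/-- Block diagonalisation of a family of matrices near a block diagonal one whose commutant is block
diagonal. -/
theorem exists_block_diagonalization {B : ℂ → Matrix (Fin n) (Fin n) ℂ} {z₀ : ℂ} (col : Fin n → ι)
    (hB : ContDiffAt ℂ 1 B z₀) (hB0 : blockPart col (B z₀) = B z₀)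
    (hcomm : ∀ h, h * B z₀ = B z₀ * h → blockPart col h = h) :
    ∃ H D : ℂ → Matrix (Fin n) (Fin n) ℂ, ContinuousAt H z₀ ∧ H z₀ = 0 ∧ ContDiffAt ℂ 1 D z₀ ∧
      D z₀ = B z₀ ∧ (∀ z, blockPart col (D z) = D z) ∧
      ∀ᶠ z in 𝓝 z₀, IsUnit (1 + H z) ∧ B z * (1 + H z) = (1 + H z) * D z := by
  set B₀ := B z₀ with hB₀
  let P : Matrix (Fin n) (Fin n) ℂ →L[ℂ] Matrix (Fin n) (Fin n) ℂ :=
    LinearMap.toContinuousLinearMap (blockPart col)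
  let O : Matrix (Fin n) (Fin n) ℂ →L[ℂ] Matrix (Fin n) (Fin n) ℂ :=
    ContinuousLinearMap.id ℂ _ - P
  have hP : ∀ y, P y = blockPart col y := fun _ => rfl
  have hO : ∀ y, O y = y - blockPart col y := fun _ => rfl
  have hPO : ∀ y, blockPart col (O y) = 0 := fun y => by
    rw [hO, map_sub, blockPart_blockPart, sub_self]
  -- The unknown y encodes both objects sought: its off-diagonal part gives the conjugation 1 + O y,
  -- its block diagonal part the new matrix B₀ + P y. Inverting F near B₀ by the inverse function
  -- theorem conjugates every nearby matrix to block form.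
  let F : Matrix (Fin n) (Fin n) ℂ → Matrix (Fin n) (Fin n) ℂ :=
    fun y => (1 + O y) * (B₀ + P y) * Ring.inverse (1 + O y)
  let L : Matrix (Fin n) (Fin n) ℂ →L[ℂ] Matrix (Fin n) (Fin n) ℂ :=
    LinearMap.toContinuousLinearMap
      { toFun := fun y => O y * B₀ - B₀ * O y + P y
        map_add' := fun x y => by simp only [map_add]; noncomm_ring
        map_smul' := fun c y => by
          simp only [map_smul, smul_mul_assoc, mul_smul_comm, RingHom.id_apply, smul_add, smul_sub] }
  have hL : ∀ y, L y = O y * B₀ - B₀ * O y + P y := fun _ => rfl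
  -- The commutator of B₀ with an off-diagonal matrix is off-diagonal. Both summands of L y
  -- therefore vanish separately, and an off-diagonal matrix commuting with B₀ is zero by `hcomm`.
  have hLinj : Function.Injective L := by
    rw [injective_iff_map_eq_zero]
    intro y hy
    rw [hL] at hy
    have h1 := congrArg (blockPart col) hy
    rw [map_add, map_sub, (blockPart_mul_off hB0 (hPO y)).1, (blockPart_mul_off hB0 (hPO y)).2,
      hP, blockPart_blockPart, map_zero, sub_zero, zero_add] at h1
    rw [hP, h1, add_zero, sub_eq_zero] at hy
    have h2 := hcomm _ hy
    rw [hPO] at h2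
    have h3 := hO y
    rw [← h2, h1, sub_zero] at h3
    exact h3.symm
  let Le : Matrix (Fin n) (Fin n) ℂ ≃L[ℂ] Matrix (Fin n) (Fin n) ℂ :=
    (LinearEquiv.ofInjectiveEndo (L : Matrix (Fin n) (Fin n) ℂ →ₗ[ℂ] _) hLinj).toContinuousLinearEquiv
  have hLe : (Le : Matrix (Fin n) (Fin n) ℂ →L[ℂ] Matrix (Fin n) (Fin n) ℂ) = L := by
    ext y : 1; rfl
  have hO0 : O 0 = 0 := map_zero O
  have hF0 : F 0 = B₀ := by simp [F]
  have hFs : ContDiffAt ℂ 1 F 0 := by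
    have hinv : ContDiffAt ℂ 1 (fun y => Ring.inverse (1 + O y)) 0 := by
      have h1 : ContDiffAt ℂ 1 (Ring.inverse : Matrix (Fin n) (Fin n) ℂ → _) (1 + O 0) := by
        rw [hO0, add_zero]
        exact contDiffAt_ringInverse ℂ (1 : (Matrix (Fin n) (Fin n) ℂ)ˣ)
      exact h1.comp 0 (contDiffAt_const.add O.contDiff.contDiffAt)
    exact ((contDiffAt_const.add O.contDiff.contDiffAt).mul
      (contDiffAt_const.add P.contDiff.contDiffAt)).mul hinv
  have hFd : HasFDerivAt F (Le : Matrix (Fin n) (Fin n) ℂ →L[ℂ] Matrix (Fin n) (Fin n) ℂ) 0 := by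
    rw [hLe]
    have hinv : HasFDerivAt (fun y => Ring.inverse (1 + O y)) (-O) 0 := by
      have h1 : HasFDerivAt (Ring.inverse : Matrix (Fin n) (Fin n) ℂ → _)
          (-ContinuousLinearMap.id ℂ _) (1 + O 0) := by
        rw [hO0, add_zero]
        refine (hasFDerivAt_ringInverse (𝕜 := ℂ) (1 : (Matrix (Fin n) (Fin n) ℂ)ˣ)).congr_fderiv ?_
        ext x : 1
        simp
        rfl
      have h2 := h1.comp 0 (O.hasFDerivAt.const_add 1)
      have h3 : (-ContinuousLinearMap.id ℂ (Matrix (Fin n) (Fin n) ℂ)).comp O = -O := by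
        ext x : 1
        rfl
      exact h2.congr_fderiv h3
    refine (((O.hasFDerivAt.const_add 1).mul' (P.hasFDerivAt.const_add B₀)).mul'
      hinv).congr_fderiv ?_
    ext y : 1
    change ((1 + O 0) * (B₀ + P 0)) * (-(O y)) + ((1 + O 0) * P y + O y * (B₀ + P 0)) *
      Ring.inverse (1 + O 0) = O y * B₀ - B₀ * O y + P y
    rw [hO0, map_zero, add_zero, add_zero, Ring.inverse_one]
    noncomm_ring
  set g := hFs.localInverse hFd one_ne_zero with hg
  have hgc : ContDiffAt ℂ 1 g (F 0) := hFs.to_localInverse hFd one_ne_zero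
  have hg0 : g (F 0) = 0 := hFs.localInverse_apply_image hFd one_ne_zero
  have hgr : ∀ᶠ y in 𝓝 (F 0), F (g y) = y :=
    (hFs.hasStrictFDerivAt' hFd one_ne_zero).eventually_right_inverse
  rw [hF0] at hgc hg0 hgr
  have hgB : ContDiffAt ℂ 1 (fun z => g (B z)) z₀ := ContDiffAt.comp z₀ hgc hB
  have hOc : ContinuousAt (fun z => O (g (B z))) z₀ :=
    (O.contDiff.contDiffAt.comp z₀ hgB).continuousAt
  refine ⟨fun z => O (g (B z)), fun z => B₀ + P (g (B z)), hOc, ?_,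
    contDiffAt_const.add (P.contDiff.contDiffAt.comp z₀ hgB), ?_, fun z => ?_, ?_⟩
  · change O (g B₀) = 0; rw [hg0, hO0]
  · change B₀ + P (g B₀) = B₀; rw [hg0, map_zero, add_zero]
  · rw [map_add, hB0, hP, blockPart_blockPart]
    rfl
  · have hunit : ∀ᶠ z in 𝓝 z₀, IsUnit (1 + O (g (B z))) := by
      have h1 : ContinuousAt (fun z => 1 + O (g (B z))) z₀ := continuousAt_const.add hOc
      refine h1.eventually (p := fun x => IsUnit x) (Units.isOpen.mem_nhds ?_)
      change IsUnit (1 + O (g B₀))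
      rw [hg0, hO0, add_zero]
      exact isUnit_one
    filter_upwards [hunit, hB.continuousAt.eventually hgr] with z hz1 hz2
    refine ⟨hz1, ?_⟩
    calc B z * (1 + O (g (B z))) = F (g (B z)) * (1 + O (g (B z))) := by rw [hz2]
      _ = (1 + O (g (B z))) * (B₀ + P (g (B z))) := by
        simp only [F]
        rw [mul_assoc, Ring.inverse_mul_cancel _ hz1, mul_one]

end blockDiagonal

/-! ### Liouville's formula for flows and their blocks. -/

section determinantFlow
open NormedSpace
variable {n : ℕ}

theorem infGen_det (B : Matrix (Fin n) (Fin n) ℂ) :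
    infGen (Matrix.det : Matrix (Fin n) (Fin n) ℂ → ℂ) B = B.trace := by
  have h1 : HasDerivAt (fun z : ℂ => (1 + z • B).det) (infGen Matrix.det B) 0 := by
    have h2 : HasDerivAt (fun z : ℂ => 1 + z • B) B 0 := by
      have := ((hasDerivAt_id (0 : ℂ)).smul_const B).const_add 1
      exact this.congr_deriv (one_smul _ _)
    have h3 : HasFDerivAt (Matrix.det : Matrix (Fin n) (Fin n) ℂ → ℂ) (infGen Matrix.det)
        (1 + (0 : ℂ) • B) := by
      rw [zero_smul, add_zero]
      exact ((contDiff_det (N := 1)).differentiable one_ne_zero 1).hasFDerivAt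
    exact h3.comp_hasDerivAt 0 h2
  obtain ⟨c, hc⟩ : ∃ c : Polynomial ℂ, ∀ z : ℂ, (1 + z • B).det
      = 1 + B.trace * z + c.eval z * z ^ 2 := ⟨_, fun z => Matrix.det_one_add_smul z B⟩
  have h4 : HasDerivAt (fun z : ℂ => (1 + z • B).det) B.trace 0 := by
    simp only [hc]
    have := (((hasDerivAt_id (0 : ℂ)).const_mul B.trace).const_add 1).add
      ((c.hasDerivAt 0).mul (hasDerivAt_pow 2 (0 : ℂ)))
    exact this.congr_deriv (by simp)
  exact h1.unique h4

theorem hasDerivAt_det {Φ : ℝ → Matrix (Fin n) (Fin n) ℂ} {A : Matrix (Fin n) (Fin n) ℂ} {x : ℝ}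
    (h : HasDerivAt Φ (A * Φ x) x) :
    HasDerivAt (fun x => (Φ x).det) (A.trace * (Φ x).det) x := by
  rw [← infGen_det]
  exact hasDerivAt_mul_map ((contDiff_det (N := 1)).differentiable one_ne_zero) Matrix.det_mul h

theorem hasDerivAt_cexp_mul (σ : ℂ) (t : ℝ) :
    HasDerivAt (fun t : ℝ => Complex.exp (σ * t)) (σ * Complex.exp (σ * t)) t := by
  have := ((hasDerivAt_id t).ofReal_comp.const_mul σ).cexp
  simpa [mul_comm] using this

theorem norm_cexp_mul_ofReal (σ : ℂ) (t : ℝ) :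
    ‖Complex.exp (σ * t)‖ = Real.exp (σ.re * t) := by
  rw [Complex.norm_exp]; simp

/-- Adding the complementary projection turns the determinant of the `J`-block into one of full
size, to which Liouville's formula applies with generator D times the projection. -/
theorem det_exp_coordProj {D : Matrix (Fin n) (Fin n) ℂ} {J : Finset (Fin n)}
    (hD : D * coordProj J = coordProj J * D) (t : ℝ) :
    (exp (t • D) * coordProj J + coordProj Jᶜ).det
      = Complex.exp ((D * coordProj J).trace * t) := by
  set e := coordProj J with he
  have hee : e * e = e := coordProj_mul_self J
  have hc : coordProj Jᶜ = 1 - e := coordProj_compl J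
  set τ := (D * e).trace
  have hd : ∀ t : ℝ, HasDerivAt (fun t : ℝ => exp (t • D) * e + coordProj Jᶜ)
      (D * e * (exp (t • D) * e + coordProj Jᶜ)) t := by
    intro t
    have h1 := ((hasDerivAt_exp_smul_const' D t).mul_const e).add_const (coordProj Jᶜ)
    refine h1.congr_deriv ?_
    have hce : exp (t • D) * e = e * exp (t • D) :=
      ((show Commute D e from hD).smul_left t).exp_left.eq
    rw [hc, hce]
    have : D * e * (e * exp (t • D) + (1 - e)) = D * (e * e) * exp (t • D) + D * e - D * (e * e) := by
      noncomm_ring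
    rw [this, hee, mul_assoc, mul_assoc, add_sub_cancel_right]
    exact congrArg (D * ·) hce
  have hz : ∀ t : ℝ, HasDerivAt (fun t : ℝ =>
      Complex.exp (-τ * t) * (exp (t • D) * e + coordProj Jᶜ).det) 0 t := by
    intro t
    refine ((hasDerivAt_cexp_mul (-τ) t).mul (hasDerivAt_det (hd t))).congr_deriv ?_
    simp only [τ]
    ring
  have h0 := eq_of_hasDerivAt_zero hz 0 t
  simp only [zero_smul, exp_zero, one_mul, Complex.ofReal_zero, mul_zero, Complex.exp_zero] at h0
  rw [hc, add_sub_cancel, Matrix.det_one, ← hc] at h0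
  have h2 : Complex.exp (-τ * t) * Complex.exp (τ * t) = 1 := by
    rw [← Complex.exp_add]; simp
  calc _ = (Complex.exp (-τ * t) * Complex.exp (τ * t)) *
        (exp (t • D) * e + coordProj Jᶜ).det := by rw [h2, one_mul]
    _ = Complex.exp (τ * t) * (Complex.exp (-τ * t) * (exp (t • D) * e + coordProj Jᶜ).det) := by
        ring
    _ = _ := by rw [h0, mul_one]

theorem det_exp_smul (D : Matrix (Fin n) (Fin n) ℂ) (t : ℝ) :
    (exp (t • D)).det = Complex.exp (D.trace * t) := by
  have hu : (coordProj Finset.univ : Matrix (Fin n) (Fin n) ℂ) = 1 := by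
    have := coordProj_compl (Finset.univ : Finset (Fin n))
    ext i j
    simp [coordProj, Matrix.diagonal_apply, Matrix.one_apply]
  have := det_exp_coordProj (D := D) (J := Finset.univ) (by rw [hu, one_mul, mul_one]) t
  rw [coordProj_compl, hu] at this
  simpa using this

theorem norm_det_le (M : Matrix (Fin n) (Fin n) ℂ) (r : Fin n → ℝ) (hM : ∀ i j, ‖M i j‖ ≤ r j) :
    ‖M.det‖ ≤ n.factorial * ∏ j, r j := by
  have h := norm_compound_apply_le (k := n) M r hM id id
  have hk : (0 : ℝ) < n.factorial := by exact_mod_cast n.factorial_pos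
  simp only [compound, Matrix.of_apply, norm_mul, norm_inv, Complex.norm_natCast] at h
  rw [inv_mul_le_iff₀ hk] at h
  simpa using h

end determinantFlow

/-! ### Dominant exterior powers of a flow and their stability. -/

section dominantMinor
open NormedSpace Filter Topology
variable {n : ℕ}

/-- The `k`-th compound of the flow of `D` is dominated by the exponential rate `σ`, taken on the
range of `p`, with gap `g`. -/
structure IsDominantMinor (k : ℕ) (D : Matrix (Fin n) (Fin n) ℂ) (σ : ℂ)
    (p : Matrix (Fin k → Fin n) (Fin k → Fin n) ℂ) (C g : ℝ) : Prop where
  compound_one_mul : compound k 1 * p = p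
  mul_compound_one : p * compound k 1 = p
  exp_mul : ∀ t : ℝ, compound k (exp (t • D)) * p = Complex.exp (σ * t) • p
  mul_exp : ∀ t : ℝ, p * compound k (exp (t • D)) = Complex.exp (σ * t) • p
  norm_le : ∀ t : ℝ, 0 ≤ t →
    ‖compound k (exp (t • D)) - Complex.exp (σ * t) • p‖ ≤ C * Real.exp ((σ.re - g) * t)
  norm_proj_le : ‖p‖ ≤ C

/-- The rank one projection onto the coordinate `k`-vector of `J`, zero if `J` has another size. -/
noncomputable def minorProj (k : ℕ) (J : Finset (Fin n)) :
    Matrix (Fin k → Fin n) (Fin k → Fin n) ℂ :=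
  if J.card = k then compound k (coordProj J) else 0

theorem minorProj_mul_self (k : ℕ) (J : Finset (Fin n)) :
    minorProj k J * minorProj k J = minorProj k J := by
  unfold minorProj
  split_ifs
  · rw [← compound_mul, coordProj_mul_self]
  · rw [zero_mul]

theorem compound_mul_minorProj {k : ℕ} {M : Matrix (Fin n) (Fin n) ℂ} {J : Finset (Fin n)}
    (hM : M * coordProj J = coordProj J * M) :
    compound k M * minorProj k J = (M * coordProj J + coordProj Jᶜ).det • minorProj k J := by
  unfold minorProj
  split_ifs with h
  · rw [← compound_mul, compound_mul_coordProj M J h hM]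
  · rw [mul_zero, smul_zero]

theorem minorProj_mul_compound {k : ℕ} {M : Matrix (Fin n) (Fin n) ℂ} {J : Finset (Fin n)}
    (hM : M * coordProj J = coordProj J * M) :
    minorProj k J * compound k M = (M * coordProj J + coordProj Jᶜ).det • minorProj k J := by
  unfold minorProj
  split_ifs with h
  · rw [← compound_mul, ← hM, compound_mul_coordProj M J h hM]
  · rw [zero_mul, smul_zero]

/-- A column of the exterior power is bounded by the product of the bounds of the columns it
involves, hence by the total rate of its index set. The subtracted term removes exactly the columns
whose index set is `J`. -/
theorem norm_compound_sub_minorProj_le {k : ℕ} {M : Matrix (Fin n) (Fin n) ℂ}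
    {J : Finset (Fin n)} {C g : ℝ} {ρ : Fin n → ℝ} (hC : 0 ≤ C)
    (hM : ∀ i j, ‖M i j‖ ≤ C * Real.exp (ρ j))
    (hg : ∀ K : Finset (Fin n), K.card = k → K ≠ J → ∑ j ∈ K, ρ j ≤ g) :
    ‖compound k M - compound k M * minorProj k J‖
      ≤ Fintype.card (Fin k → Fin n) * (C ^ k * Real.exp g) := by
  have key : ∀ i j : Fin k → Fin n, (∀ h : J.card = k, ∃ a, j a ∉ J) →
      ‖compound k M i j‖ ≤ C ^ k * Real.exp g := by
    intro i j hj
    by_cases hinj : Function.Injective j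
    · refine (norm_compound_apply_le M _ hM i j).trans ?_
      rw [Finset.prod_mul_distrib, Finset.prod_const, Finset.card_univ, Fintype.card_fin,
        ← Real.exp_sum]
      gcongr
      have hK : (Finset.univ.image j).card = k := by
        rw [Finset.card_image_of_injective _ hinj, Finset.card_univ, Fintype.card_fin]
      have := hg (Finset.univ.image j) hK (by
        rintro rfl
        obtain ⟨a, ha⟩ := hj hK
        exact ha (Finset.mem_image_of_mem _ (Finset.mem_univ a)))
      rwa [Finset.sum_image hinj.injOn] at this
    · rw [compound_eq_zero_of_not_injective M i j hinj, norm_zero]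
      positivity
  refine norm_le_card_mul _ (by positivity) fun i j => ?_
  rw [Matrix.sub_apply]
  unfold minorProj
  split_ifs with h
  · rw [← compound_mul]
    by_cases hj : ∀ a, j a ∈ J
    · rw [compound_mul_coordProj_apply M J i j hj, sub_self, norm_zero]
      positivity
    · push Not at hj
      obtain ⟨a, ha⟩ := hj
      rw [compound_mul_coordProj_eq_zero M J i j a ha, sub_zero]
      exact key i j fun _ => ⟨a, ha⟩
  · rw [mul_zero, Matrix.zero_apply, sub_zero]
    exact key i j fun h' => absurd h' h

/-- The determinant of the backward flow on the block `J` has modulus e^(-t Re τ), τ being the trace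
of the block, while the column bounds give at most a constant times e^(-t Σρ). Letting t grow
compares the exponents. -/
theorem le_re_trace_of_norm_exp_le {B : Matrix (Fin n) (Fin n) ℂ} {J : Finset (Fin n)}
    {C : ℝ} {ρ : Fin n → ℝ} (hC : 1 ≤ C) (hB : B * coordProj J = coordProj J * B)
    (h : ∀ t : ℝ, 0 ≤ t → ∀ i j, ‖exp (t • (-B)) i j‖ ≤ C * Real.exp (-ρ j * t)) :
    ∑ j ∈ J, ρ j ≤ (B * coordProj J).trace.re := by
  set s := ∑ j ∈ J, ρ j
  set τ := (B * coordProj J).trace with hτ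
  have hneg : (-B) * coordProj J = coordProj J * (-B) := by rw [neg_mul, mul_neg, hB]
  have hb : ∀ t : ℝ, 0 ≤ t → Real.exp ((s - τ.re) * t) ≤ n.factorial * C ^ n := by
    intro t ht
    have h1 := norm_det_le (exp (t • (-B)) * coordProj J + coordProj Jᶜ)
      (fun j => C * if j ∈ J then Real.exp (-ρ j * t) else 1) (by
        intro i j
        rw [Matrix.add_apply, mul_coordProj_apply]
        by_cases hj : j ∈ J
        · have : (coordProj Jᶜ : Matrix (Fin n) (Fin n) ℂ) i j = 0 := by
            simp only [coordProj, Matrix.diagonal_apply]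
            split_ifs with h1 h2
            · subst h1; simp [hj] at h2
            · rfl
            · rfl
          rw [if_pos hj, if_pos hj, this, add_zero]
          exact h t ht i j
        · rw [if_neg hj, if_neg hj, zero_add, mul_one]
          simp only [coordProj, Matrix.diagonal_apply]
          split_ifs <;> simp <;> linarith)
    rw [det_exp_coordProj hneg, norm_cexp_mul_ofReal, neg_mul, Matrix.trace_neg, ← hτ,
      Finset.prod_mul_distrib, Finset.prod_const, Finset.card_univ, Fintype.card_fin,
      Finset.prod_ite_mem, Finset.univ_inter, ← Real.exp_sum] at h1
    have h2 : ∑ j ∈ J, -ρ j * t = -(s * t) := by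
      rw [← Finset.sum_mul, Finset.sum_neg_distrib, neg_mul]
    rw [h2, Complex.neg_re] at h1
    calc Real.exp ((s - τ.re) * t) = Real.exp (-τ.re * t) * Real.exp (s * t) := by
          rw [← Real.exp_add]; congr 1; ring
      _ ≤ (n.factorial * (C ^ n * Real.exp (-(s * t)))) * Real.exp (s * t) := by gcongr
      _ = n.factorial * C ^ n * (Real.exp (-(s * t)) * Real.exp (s * t)) := by ring
      _ = _ := by rw [← Real.exp_add]; simp
  by_contra hlt
  push Not at hlt
  have hpos : 0 < s - τ.re := by linarith
  have hlim : Tendsto (fun t : ℝ => Real.exp ((s - τ.re) * t)) atTop atTop :=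
    Real.tendsto_exp_atTop.comp (tendsto_id.const_mul_atTop hpos)
  obtain ⟨t, ht, ht0⟩ := ((hlim.eventually_gt_atTop (n.factorial * C ^ n)).and
    (eventually_ge_atTop 0)).exists
  exact absurd (hb t ht0) (not_le.2 ht)

theorem differentiable_compound (k : ℕ) :
    Differentiable ℂ (compound k : Matrix (Fin n) (Fin n) ℂ → _) :=
  (contDiff_compound (N := 1) k).differentiable one_ne_zero

/-- At z₀ the gap follows from the column rates. For z nearby the generator of the exterior power
changes by a small amount that commutes with the projection off `J`, so the growth on the
complementary part changes little, while on the range of `minorProj k J` the flow is a scalar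
exponential exactly. -/
theorem eventually_isDominantMinor {D : ℂ → Matrix (Fin n) (Fin n) ℂ} {z₀ : ℂ}
    {ρ : Fin n → ℝ} {J : Finset (Fin n)} {k : ℕ} {g g' : ℝ} (hgg : g' < g)
    (hD : ContinuousAt D z₀) (hcomm : ∀ z, D z * coordProj J = coordProj J * D z)
    (hpos : ∀ δ > 0, ∃ C : ℝ, 1 ≤ C ∧ ∀ t : ℝ, 0 ≤ t → ∀ i j,
      ‖exp (t • D z₀) i j‖ ≤ C * Real.exp ((ρ j + δ) * t))
    (hneg : ∀ δ > 0, ∃ C : ℝ, 1 ≤ C ∧ ∀ t : ℝ, 0 ≤ t → ∀ i j,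
      ‖exp (t • (-D z₀)) i j‖ ≤ C * Real.exp ((-ρ j + δ) * t))
    (hgap : ∀ K : Finset (Fin n), K.card = k → K ≠ J → ∑ j ∈ K, ρ j ≤ ∑ j ∈ J, ρ j - g) :
    ∃ C : ℝ, ∀ᶠ z in 𝓝 z₀,
      IsDominantMinor k (D z) (D z * coordProj J).trace (minorProj k J) C g' := by
  set s := ∑ j ∈ J, ρ j with hs
  set p := minorProj k J with hp
  set u := compound k (1 : Matrix (Fin n) (Fin n) ℂ) with hu
  set q := u - p with hq
  -- The loss g - g' is shared out: kδ for the k columns of a minor, nδ for the lower bound of the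
  -- trace at z₀, one δ for the perturbed generator and one for the variation of the trace with z.
  obtain ⟨δ, hδ, hδ'⟩ : ∃ δ > 0, (k + n + 2) * δ = g - g' :=
    ⟨(g - g') / (k + n + 2), div_pos (by linarith) (by positivity), by field_simp⟩
  obtain ⟨C₁, hC₁, h₁⟩ := hpos δ hδ
  obtain ⟨C₂, hC₂, h₂⟩ := hneg δ hδ
  have hτ : s - n * δ ≤ (D z₀ * coordProj J).trace.re := by
    have := le_re_trace_of_norm_exp_le (ρ := fun j => ρ j - δ) hC₂ (hcomm z₀)
      (fun t ht i j => (h₂ t ht i j).trans (by simp; ring_nf; rfl))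
    rw [Finset.sum_sub_distrib, Finset.sum_const, nsmul_eq_mul] at this
    have hcard : (J.card : ℝ) ≤ n := by
      exact_mod_cast (Finset.card_le_univ J).trans (Fintype.card_fin n).le
    nlinarith
  set N : ℝ := ((Fintype.card (Fin k → Fin n) : ℕ) : ℝ) with hN
  set C₃ := N * C₁ ^ k with hC₃
  have hC₃0 : 0 ≤ C₃ := by positivity
  have h1e : (1 : Matrix (Fin n) (Fin n) ℂ) * coordProj J = coordProj J * 1 := by
    rw [one_mul, mul_one]
  have hdet1 : ((1 : Matrix (Fin n) (Fin n) ℂ) * coordProj J + coordProj Jᶜ).det = 1 := by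
    rw [one_mul, coordProj_compl, add_sub_cancel, Matrix.det_one]
  have hup : u * p = p := by
    rw [hu, hp, compound_mul_minorProj h1e, hdet1, one_smul]
  have hpu : p * u = p := by
    rw [hu, hp, minorProj_mul_compound h1e, hdet1, one_smul]
  have huu : u * u = u := by rw [hu, ← compound_mul, one_mul]
  have hpp : p * p = p := minorProj_mul_self k J
  have hqq : q * q = q := by
    rw [hq]
    have : (u - p) * (u - p) = u * u - u * p - p * u + p * p := by noncomm_ring
    rw [this, huu, hup, hpu, hpp]; abel
  have hcu : ∀ M, compound k M * u = compound k M := fun M => by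
    rw [hu, ← compound_mul, mul_one]
  have huc : ∀ M, u * compound k M = compound k M := fun M => by
    rw [hu, ← compound_mul, one_mul]
  have hB0 : ∀ t : ℝ, 0 ≤ t → ‖compound k (exp (t • D z₀)) * q‖
      ≤ C₃ * Real.exp ((s - g + k * δ) * t) := by
    intro t ht
    have := norm_compound_sub_minorProj_le (k := k) (J := J) (M := exp (t • D z₀))
      (ρ := fun j => (ρ j + δ) * t) (g := (s - g + k * δ) * t) (by linarith) (h₁ t ht) (by
        intro K hK hKJ
        rw [← Finset.sum_mul, Finset.sum_add_distrib, Finset.sum_const, hK, nsmul_eq_mul]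
        gcongr
        exact hgap K hK hKJ)
    rw [hq, mul_sub, hcu, hC₃, mul_assoc]
    exact this
  set G := infGen (compound k : Matrix (Fin n) (Fin n) ℂ → _) with hG
  have hdc := differentiable_compound (n := n) k
  have hmul : ∀ a b : Matrix (Fin n) (Fin n) ℂ, compound k (a * b) = compound k a * compound k b :=
    compound_mul
  have hE : ∀ᶠ z in 𝓝 z₀, C₃ * ‖G (D z - D z₀)‖ < δ := by
    have hc : ContinuousAt (fun z => C₃ * ‖G (D z - D z₀)‖) z₀ :=
      continuousAt_const.mul (G.continuous.continuousAt.comp (hD.sub continuousAt_const)).norm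
    refine hc.eventually (gt_mem_nhds ?_)
    simpa using hδ
  have hσ : ∀ᶠ z in 𝓝 z₀, s - n * δ - δ < (D z * coordProj J).trace.re := by
    have hc : ContinuousAt (fun z => (D z * coordProj J).trace.re) z₀ := by
      have h1 : Continuous fun M : Matrix (Fin n) (Fin n) ℂ => (M * coordProj J).trace.re :=
        Complex.continuous_re.comp (Continuous.matrix_trace (by fun_prop))
      exact h1.continuousAt.comp hD
    exact hc.eventually (lt_mem_nhds (by linarith))
  refine ⟨C₃ * ‖q‖ + ‖p‖, ?_⟩
  filter_upwards [hE, hσ] with z hz1 hz2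
  have hce : ∀ t : ℝ, exp (t • D z) * coordProj J = coordProj J * exp (t • D z) := fun t =>
    ((show Commute (D z) (coordProj J) from hcomm z).smul_left t).exp_left.eq
  have hexp : ∀ t : ℝ, compound k (exp (t • D z)) * p
      = Complex.exp ((D z * coordProj J).trace * t) • p := fun t => by
    rw [hp, compound_mul_minorProj (hce t), det_exp_coordProj (hcomm z)]
  have hexp' : ∀ t : ℝ, p * compound k (exp (t • D z))
      = Complex.exp ((D z * coordProj J).trace * t) • p := fun t => by
    rw [hp, minorProj_mul_compound (hce t), det_exp_coordProj (hcomm z)]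
  have hqc : ∀ t : ℝ, q * compound k (exp (t • D z)) = compound k (exp (t • D z)) * q := fun t => by
    rw [hq, sub_mul, mul_sub, huc, hcu, hexp, hexp']
  refine ⟨hup, hpu, hexp, hexp', fun t ht => ?_, by
    have : 0 ≤ C₃ * ‖q‖ := by positivity
    linarith⟩
  have hYd : ∀ t : ℝ, HasDerivAt (fun t : ℝ => compound k (exp (t • D z)) * q)
      ((G (D z₀) + G (D z - D z₀)) * (compound k (exp (t • D z)) * q)) t := by
    intro t
    have := (hasDerivAt_mul_map hdc hmul (hasDerivAt_exp_smul_const' (D z) t)).mul_const q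
    refine this.congr_deriv ?_
    rw [← map_add, add_sub_cancel, mul_assoc]
    rfl
  have hEq : G (D z - D z₀) * q = q * G (D z - D z₀) := by
    have hc1 : (D z - D z₀) * coordProj J = coordProj J * (D z - D z₀) := by
      rw [sub_mul, mul_sub, hcomm, hcomm]
    have h2 : G (D z - D z₀) * p = p * G (D z - D z₀) := by
      rw [hp, minorProj]
      split_ifs
      · exact infGen_commute hdc hmul hc1
      · rw [mul_zero, zero_mul]
    rw [hq, mul_sub, sub_mul, h2, hu, infGen_commute hdc hmul (by rw [mul_one, one_mul])]
  have hfin := norm_le_of_small_perturbation (S := fun t => compound k (exp (t • D z₀)))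
    (G := G (D z₀)) (E := G (D z - D z₀)) (u := u) (q := q) (C := C₃) (b := s - g + k * δ)
    (fun t => hasDerivAt_mul_map' hdc hmul (hasDerivAt_exp_smul_const (D z₀) t))
    (by simp [hu]) hC₃0 hB0 hEq hYd (fun t => by rw [← mul_assoc, huc])
    (fun t => by rw [← mul_assoc, hqc, mul_assoc, hqq]) ht
  have h0 : compound k (exp ((0 : ℝ) • D z)) * q = q := by
    rw [zero_smul, exp_zero, ← hu, hq, mul_sub, huu, hup]
  have hlhs : compound k (exp (t • D z)) - Complex.exp ((D z * coordProj J).trace * t) • p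
      = compound k (exp (t • D z)) * q := by
    rw [hq, mul_sub, hcu, hexp]
  rw [hlhs]
  simp only [h0] at hfin
  refine hfin.trans ?_
  gcongr
  · have := norm_nonneg p
    linarith
  · nlinarith

/-- The same perturbation argument for the flow itself. It will identify the spectral subspaces at
nearby parameters with coordinate subspaces. -/
theorem eventually_norm_exp_mul_coordProj_le {D : ℂ → Matrix (Fin n) (Fin n) ℂ} {z₀ : ℂ}
    {ρ : Fin n → ℝ} {J : Finset (Fin n)} {b b' : ℝ} (hbb : b < b')
    (hD : ContinuousAt D z₀) (hcomm : ∀ z, D z * coordProj J = coordProj J * D z)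
    (hpos : ∀ δ > 0, ∃ C : ℝ, 1 ≤ C ∧ ∀ t : ℝ, 0 ≤ t → ∀ i j,
      ‖exp (t • D z₀) i j‖ ≤ C * Real.exp ((ρ j + δ) * t))
    (hJ : ∀ j ∈ J, ρ j ≤ b) :
    ∃ C : ℝ, ∀ᶠ z in 𝓝 z₀, ∀ t : ℝ, 0 ≤ t →
      ‖exp (t • D z) * coordProj J‖ ≤ C * Real.exp (b' * t) := by
  set q := (coordProj J : Matrix (Fin n) (Fin n) ℂ) with hq
  have hqq : q * q = q := coordProj_mul_self J
  obtain ⟨C₁, hC₁, h₁⟩ := hpos ((b' - b) / 2) (by linarith)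
  set C₃ := n * C₁ with hC₃
  have hC₃0 : 0 ≤ C₃ := by positivity
  have hB0 : ∀ t : ℝ, 0 ≤ t → ‖exp (t • D z₀) * q‖ ≤ C₃ * Real.exp ((b + (b' - b) / 2) * t) := by
    intro t ht
    refine (norm_le_card_mul _ (b := C₁ * Real.exp ((b + (b' - b) / 2) * t)) (by positivity)
      fun i j => ?_).trans (by rw [Fintype.card_fin, hC₃, mul_assoc])
    rw [hq, mul_coordProj_apply]
    split_ifs with hj
    · refine (h₁ t ht i j).trans ?_
      gcongr
      exact hJ j hj
    · rw [norm_zero]; positivity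
  have hE : ∀ᶠ z in 𝓝 z₀, C₃ * ‖D z - D z₀‖ < (b' - b) / 2 := by
    have hc : ContinuousAt (fun z => C₃ * ‖D z - D z₀‖) z₀ :=
      continuousAt_const.mul (hD.sub continuousAt_const).norm
    refine hc.eventually (gt_mem_nhds ?_)
    simpa using hbb
  refine ⟨C₃ * ‖q‖, ?_⟩
  filter_upwards [hE] with z hz t ht
  have hce : ∀ t : ℝ, exp (t • D z) * q = q * exp (t • D z) := fun t =>
    ((show Commute (D z) q from hcomm z).smul_left t).exp_left.eq
  have hfin := norm_le_of_small_perturbation (S := fun t => exp (t • D z₀))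
    (Y := fun t => exp (t • D z) * q)
    (G := D z₀) (E := D z - D z₀) (u := 1) (q := q) (C := C₃) (b := b + (b' - b) / 2)
    (fun t => hasDerivAt_exp_smul_const (D z₀) t)
    (by simp) hC₃0 hB0 (by rw [sub_mul, mul_sub, hcomm, hcomm])
    (fun t => ((hasDerivAt_exp_smul_const' (D z) t).mul_const q).congr_deriv (by
      rw [add_sub_cancel, mul_assoc]; rfl)) (fun t => by rw [one_mul])
    (fun t => by rw [← mul_assoc, ← hce, mul_assoc, hqq]) ht
  simp only [zero_smul, exp_zero, one_mul] at hfin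
  refine hfin.trans ?_
  gcongr
  linarith

end dominantMinor

/-! ### Exterior powers of perturbed systems over a half period. -/

section minorAsymptotics
open NormedSpace Filter Topology Set
variable {n : ℕ}

theorem IsDominantMinor.transpose {k : ℕ} {D : Matrix (Fin n) (Fin n) ℂ} {σ : ℂ}
    {p : Matrix (Fin k → Fin n) (Fin k → Fin n) ℂ} {C g : ℝ} (h : IsDominantMinor k D σ p C g) :
    IsDominantMinor k D.transpose σ p.transpose (Fintype.card (Fin k → Fin n) * C) g := by
  have he : ∀ t : ℝ, compound k (exp (t • D.transpose)) = (compound k (exp (t • D))).transpose := by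
    intro t
    rw [← compound_transpose, ← Matrix.exp_transpose, Matrix.transpose_smul]
  have h1 : compound k (1 : Matrix (Fin n) (Fin n) ℂ) = (compound k 1).transpose := by
    rw [← compound_transpose, Matrix.transpose_one]
  refine ⟨?_, ?_, fun t => ?_, fun t => ?_, fun t ht => ?_, ?_⟩
  · rw [h1, ← Matrix.transpose_mul, h.mul_compound_one]
  · rw [h1, ← Matrix.transpose_mul, h.compound_one_mul]
  · rw [he, ← Matrix.transpose_mul, h.mul_exp, Matrix.transpose_smul]
  · rw [he, ← Matrix.transpose_mul, h.exp_mul, Matrix.transpose_smul]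
  · rw [he, ← Matrix.transpose_smul, ← Matrix.transpose_sub, mul_assoc]
    exact (norm_transpose_le _).trans (by gcongr; exact h.norm_le t ht)
  · exact (norm_transpose_le _).trans (by gcongr; exact h.norm_proj_le)

/-- The `k`-th compound of a fundamental matrix, normalised by the rate `σ`. -/
noncomputable def scaledCompound (k : ℕ) (σ : ℂ) (Φ : ℝ → Matrix (Fin n) (Fin n) ℂ) (x : ℝ) :
    Matrix (Fin k → Fin n) (Fin k → Fin n) ℂ :=
  Complex.exp (-σ * x) • compound k (Φ x)

theorem hasDerivAt_scaledCompound {k : ℕ} {σ : ℂ} {Φ : ℝ → Matrix (Fin n) (Fin n) ℂ}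
    {D E : Matrix (Fin n) (Fin n) ℂ} {x : ℝ} (h : HasDerivAt Φ ((D + E) * Φ x) x) :
    HasDerivAt (scaledCompound k σ Φ)
      ((infGen (compound k) D - σ • compound k 1) * scaledCompound k σ Φ x
        + infGen (compound k) E * scaledCompound k σ Φ x) x := by
  have h1 := (hasDerivAt_cexp_mul (-σ) x).smul
    (hasDerivAt_mul_map (differentiable_compound (n := n) k) compound_mul h)
  refine h1.congr_deriv ?_
  have h2 : compound k (Φ x) = compound k 1 * compound k (Φ x) := by
    rw [← compound_mul, one_mul]
  change Complex.exp (-σ * x) • (infGen (compound k) (D + E) * compound k (Φ x))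
    + (-σ * Complex.exp (-σ * x)) • compound k (Φ x) = _
  unfold scaledCompound
  rw [map_add, sub_mul, smul_mul_assoc, mul_smul_comm, mul_smul_comm, mul_smul_comm, ← compound_mul,
    one_mul, add_mul, smul_add, smul_smul, neg_mul, neg_mul, neg_smul]
  abel

/-- After division by e^(σx) the exterior power of the limiting flow is a bounded semigroup tending
to p, and its component along `compound k 1 - p` decays at rate g; the half-line estimates apply
with this component as q. The constant depends on D and Φ only through the displayed bounds, which
is the source of uniformity in the spectral parameter and in the period. -/
theorem exists_scaledCompound_bounds (k : ℕ) (C c κ g η : ℝ) (hc : 0 ≤ c) (hκ : 0 < κ)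
    (hηκ : η < κ) (hηg : η < g) (hg : 0 < g) :
    ∃ Q : ℝ, 0 ≤ Q ∧ ∀ (D : Matrix (Fin n) (Fin n) ℂ) (σ : ℂ)
      (p : Matrix (Fin k → Fin n) (Fin k → Fin n) ℂ) (Φ Φ₀ Ξ Ω : ℝ → Matrix (Fin n) (Fin n) ℂ)
      (a : ℝ), IsDominantMinor k D σ p C g → 0 ≤ a → Continuous Ξ → Continuous Ω →
      (∀ x, HasDerivAt Φ ((D + Ξ x) * Φ x) x) → (∀ x, HasDerivAt Φ₀ ((D + Ω x) * Φ₀ x) x) →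
      Φ 0 = 1 → Φ₀ 0 = 1 →
      (∀ s ∈ Icc 0 a, ‖Ξ s‖ ≤ c * Real.exp (-κ * s)) →
      (∀ s, 0 ≤ s → ‖Ω s‖ ≤ c * Real.exp (-κ * s)) →
      (∀ s ∈ Icc 0 a, ‖Ξ s - Ω s‖ ≤ c * Real.exp (-κ * a)) →
      ‖scaledCompound k σ Φ a‖ ≤ Q ∧ ∀ x, a ≤ x →
        ‖scaledCompound k σ Φ a - scaledCompound k σ Φ₀ x‖ ≤ Q * Real.exp (-η * a) := by
  set I := infGen (compound k : Matrix (Fin n) (Fin n) ℂ → _) with hI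
  set U : Matrix (Fin k → Fin n) (Fin k → Fin n) ℂ := compound k 1 with hU
  set C' := 2 * |C| with hC'
  obtain ⟨Q₁, hQ₁, H₁⟩ := exists_norm_le_and_decay (𝔐 := Matrix (Fin k → Fin n) (Fin k → Fin n) ℂ)
    C' (‖I‖ * c) κ g η ‖U‖ (by positivity) hκ hηκ hηg
  obtain ⟨Q₂, hQ₂, H₂⟩ := exists_norm_sub_le (𝔐 := Matrix (Fin k → Fin n) (Fin k → Fin n) ℂ)
    C' (‖I‖ * c) κ g η ‖U‖ (by positivity) hκ hηκ hηg
  refine ⟨Q₁ + Q₂, by positivity, ?_⟩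
  intro D σ p Φ Φ₀ Ξ Ω a h ha hΞc hΩc hΦ hΦ₀ hΦ0 hΦ₀0 hΞ hΩ hΞΩ
  have hUc : ∀ M, U * compound k M = compound k M := fun M => by
    rw [hU, ← compound_mul, one_mul]
  have hcU : ∀ M, compound k M * U = compound k M := fun M => by
    rw [hU, ← compound_mul, mul_one]
  have hUV : ∀ (Φ : ℝ → Matrix (Fin n) (Fin n) ℂ) x,
      U * scaledCompound k σ Φ x = scaledCompound k σ Φ x := fun Φ x => by
    rw [scaledCompound, mul_smul_comm, hUc]
  have hS0 : scaledCompound k σ (fun t => exp (t • D)) 0 = U := by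
    simp [scaledCompound, hU]
  have hV0 : ∀ Φ : ℝ → Matrix (Fin n) (Fin n) ℂ, Φ 0 = 1 → scaledCompound k σ Φ 0 = U := by
    intro Φ hΦ
    simp [scaledCompound, hU, hΦ]
  have hSd : ∀ t, HasDerivAt (scaledCompound k σ fun t => exp (t • D))
      (scaledCompound k σ (fun t => exp (t • D)) t * (I D - σ • U)) t := by
    intro t
    have h1 := (hasDerivAt_cexp_mul (-σ) t).smul
      (hasDerivAt_mul_map' (differentiable_compound (n := n) k) compound_mul
        (hasDerivAt_exp_smul_const D t))
    refine h1.congr_deriv ?_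
    change Complex.exp (-σ * t) • (compound k (exp (t • D)) * I D)
      + (-σ * Complex.exp (-σ * t)) • compound k (exp (t • D)) = _
    unfold scaledCompound
    rw [mul_sub, mul_smul_comm, smul_mul_assoc, smul_mul_assoc, hcU, smul_smul, neg_mul, neg_mul, neg_smul]
    abel
  have hee : ∀ t : ℝ, Complex.exp (-σ * t) * Complex.exp (σ * t) = 1 := fun t => by
    rw [← Complex.exp_add]; simp
  have hSp : ∀ t, scaledCompound k σ (fun t => exp (t • D)) t * p = p := by
    intro t
    rw [scaledCompound, smul_mul_assoc, h.exp_mul, smul_smul, hee, one_smul]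
  have hpS : ∀ t, p * scaledCompound k σ (fun t => exp (t • D)) t = p := by
    intro t
    rw [scaledCompound, mul_smul_comm, h.mul_exp, smul_smul, hee, one_smul]
  have hC0 : 0 ≤ C := (norm_nonneg _).trans h.norm_proj_le
  have hC'C : C' = 2 * C := by rw [hC', abs_of_nonneg hC0]
  have hSsub : ∀ t, 0 ≤ t → ‖scaledCompound k σ (fun t => exp (t • D)) t - p‖
      ≤ C * Real.exp (-g * t) := by
    intro t ht
    have : scaledCompound k σ (fun t => exp (t • D)) t - p
        = Complex.exp (-σ * t) • (compound k (exp (t • D)) - Complex.exp (σ * t) • p) := by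
      rw [scaledCompound, smul_sub, smul_smul, hee, one_smul]
    rw [this, norm_smul, norm_cexp_mul_ofReal]
    calc _ ≤ Real.exp ((-σ).re * t) * (C * Real.exp ((σ.re - g) * t)) := by
          gcongr; exact h.norm_le t ht
      _ = C * (Real.exp ((-σ).re * t) * Real.exp ((σ.re - g) * t)) := by ring
      _ = _ := by rw [← Real.exp_add]; congr 2; simp; ring
  have hSC : ∀ t, 0 ≤ t → ‖scaledCompound k σ (fun t => exp (t • D)) t‖ ≤ C' := by
    intro t ht
    calc _ = ‖(scaledCompound k σ (fun t => exp (t • D)) t - p) + p‖ := by rw [sub_add_cancel]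
      _ ≤ C * Real.exp (-g * t) + C := (norm_add_le _ _).trans
          (add_le_add (hSsub t ht) h.norm_proj_le)
      _ ≤ C * 1 + C := by
          gcongr
          exact Real.exp_le_one_iff.2 (by nlinarith)
      _ = C' := by rw [hC'C]; ring
  have hUS : ∀ t, U * scaledCompound k σ (fun t => exp (t • D)) t
      = scaledCompound k σ (fun t => exp (t • D)) t := hUV _
  have hqS : ∀ t, 0 ≤ t → ‖(U - p) * scaledCompound k σ (fun t => exp (t • D)) t‖
      ≤ C' * Real.exp (-g * t) := by
    intro t ht
    rw [sub_mul, hUS, hpS]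
    refine (hSsub t ht).trans ?_
    gcongr
    linarith
  have hqU : (U - p) * U = U - p := by
    rw [sub_mul, h.mul_compound_one, hU, ← compound_mul, one_mul]
  have hSq : ∀ t, scaledCompound k σ (fun t => exp (t • D)) t - U
      = (scaledCompound k σ (fun t => exp (t • D)) t - U) * (U - p) := by
    intro t
    have hSU : scaledCompound k σ (fun t => exp (t • D)) t * U
        = scaledCompound k σ (fun t => exp (t • D)) t := by
      rw [scaledCompound, smul_mul_assoc, hcU]
    have hUU : U * U = U := hUc 1
    rw [sub_mul, mul_sub, mul_sub, hSU, hSp, hUU, h.compound_one_mul]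
    abel
  have hΞI : ∀ s ∈ Icc 0 a, ‖I (Ξ s)‖ ≤ ‖I‖ * c * Real.exp (-κ * s) := fun s hs =>
    (I.le_opNorm _).trans (by rw [mul_assoc]; gcongr; exact hΞ s hs)
  have hΩI : ∀ s, 0 ≤ s → ‖I (Ω s)‖ ≤ ‖I‖ * c * Real.exp (-κ * s) := fun s hs =>
    (I.le_opNorm _).trans (by rw [mul_assoc]; gcongr; exact hΩ s hs)
  have hΞΩI : ∀ s ∈ Icc 0 a, ‖I (Ξ s) - I (Ω s)‖ ≤ ‖I‖ * c * Real.exp (-κ * a) := fun s hs => by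
    rw [← map_sub]
    exact (I.le_opNorm _).trans (by rw [mul_assoc]; gcongr; exact hΞΩ s hs)
  have hVd := fun x => hasDerivAt_scaledCompound (k := k) (σ := σ) (hΦ x)
  have hWd := fun x => hasDerivAt_scaledCompound (k := k) (σ := σ) (hΦ₀ x)
  have r1 := (H₁ _ _ (fun s => I (Ξ s)) (I D - σ • U) U (U - p) a ha hSd hS0 hSC hqS
    (I.continuous.comp hΞc) hVd (hUV Φ) hqU hΞI (by rw [hV0 Φ hΦ0])).1 a ⟨ha, le_rfl⟩
  have r2 := H₂ _ _ _ (fun s => I (Ξ s)) (fun s => I (Ω s)) (I D - σ • U) U (U - p) a ha hSd hS0 hSC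
    hqS hSq (I.continuous.comp hΞc) (I.continuous.comp hΩc) hVd (hUV Φ) hWd (hUV Φ₀) hqU hΞI hΩI
    hΞΩI (by rw [hV0 Φ hΦ0, hV0 Φ₀ hΦ₀0]) (by rw [hV0 Φ₀ hΦ₀0])
  exact ⟨r1.trans (le_add_of_nonneg_right hQ₂), fun x hx => (r2 x hx).trans
    (by gcongr; exact le_add_of_nonneg_left hQ₁)⟩

theorem scaledCompound_transpose (k : ℕ) (σ : ℂ) (Φ : ℝ → Matrix (Fin n) (Fin n) ℂ) (x : ℝ) :
    scaledCompound k σ (fun x => (Φ x).transpose) x = (scaledCompound k σ Φ x).transpose := by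
  rw [scaledCompound, compound_transpose, scaledCompound, Matrix.transpose_smul]

theorem IsFundamentalMatrix.hasDerivAt_inv_neg_transpose {A Φ : ℝ → Matrix (Fin n) (Fin n) ℂ}
    (h : IsFundamentalMatrix A Φ) (hA : Continuous A) (x : ℝ) :
    HasDerivAt (fun x => ((Φ (-x))⁻¹).transpose)
      ((A (-x)).transpose * ((Φ (-x))⁻¹).transpose) x := by
  have h1 := ((h.hasDerivAt_inv hA (-x)).scomp x (hasDerivAt_neg x)).matrix_transpose'
  refine h1.congr_deriv ?_
  rw [← Matrix.transpose_mul]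
  simp

/-- The period is cut at 0. The right half is governed by Φ(a); for the left half the transpose of
Φ(-x)⁻¹ solves a forward equation with limiting matrix Dᵀ, so the same bounds serve again. L and M
are the corresponding homoclinic limits, and 2a is the whole period. -/
theorem exists_scaledCompound_sub_le (k : ℕ) (C c κ g η : ℝ) (hc : 0 ≤ c) (hκ : 0 < κ)
    (hηκ : η < κ) (hηg : η < g) (hη : 0 < η) :
    ∃ Q : ℝ, 0 ≤ Q ∧ ∀ (D : Matrix (Fin n) (Fin n) ℂ) (σ : ℂ)
      (p L M : Matrix (Fin k → Fin n) (Fin k → Fin n) ℂ)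
      (Φ Φ₀ Ξ Ω : ℝ → Matrix (Fin n) (Fin n) ℂ)
      (a : ℝ), IsDominantMinor k D σ p C g → 0 ≤ a → Continuous Ξ → Continuous Ω →
      IsFundamentalMatrix (fun x => D + Ξ x) Φ → IsFundamentalMatrix (fun x => D + Ω x) Φ₀ →
      (∀ s, |s| ≤ a → ‖Ξ s‖ ≤ c * Real.exp (-κ * |s|)) →
      (∀ s, ‖Ω s‖ ≤ c * Real.exp (-κ * |s|)) →
      (∀ s, |s| ≤ a → ‖Ξ s - Ω s‖ ≤ c * Real.exp (-κ * a)) →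
      Tendsto (scaledCompound k σ Φ₀) atTop (𝓝 L) →
      Tendsto (scaledCompound k σ fun x => (Φ₀ (-x))⁻¹) atTop (𝓝 M) →
      ‖Complex.exp (-σ * (2 * a)) • compound k ((Φ (-a))⁻¹ * Φ a) - M * L‖
        ≤ Q * Real.exp (-η * a) := by
  set N : ℝ := ((Fintype.card (Fin k → Fin n) : ℕ) : ℝ) with hN
  obtain ⟨Q₁, hQ₁, H₁⟩ := exists_scaledCompound_bounds (n := n) k C c κ g η hc hκ hηκ hηg
    (hη.trans hηg)
  obtain ⟨Q₂, hQ₂, H₂⟩ := exists_scaledCompound_bounds (n := n) k (N * C) (n * c) κ g η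
    (by positivity) hκ hηκ hηg (hη.trans hηg)
  refine ⟨3 * (N * Q₂) * Q₁, by positivity, ?_⟩
  intro D σ p L M Φ Φ₀ Ξ Ω a h ha hΞc hΩc hΦ hΦ₀ hΞ hΩ hΞΩ hL hM
  have hE1 : Real.exp (-η * a) ≤ 1 := Real.exp_le_one_iff.2 (by nlinarith)
  have hAc : Continuous fun x => D + Ξ x := continuous_const.add hΞc
  have hA₀c : Continuous fun x => D + Ω x := continuous_const.add hΩc
  obtain ⟨hV, hVL⟩ := H₁ D σ p Φ Φ₀ Ξ Ω a h ha hΞc hΩc hΦ.2 hΦ₀.2 hΦ.1 hΦ₀.1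
    (fun s hs => by have := hΞ s (by rw [abs_of_nonneg hs.1]; exact hs.2)
                    rwa [abs_of_nonneg hs.1] at this)
    (fun s hs => by have := hΩ s; rwa [abs_of_nonneg hs] at this)
    (fun s hs => hΞΩ s (by rw [abs_of_nonneg hs.1]; exact hs.2))
  have hinv : ∀ {B Ψ : ℝ → Matrix (Fin n) (Fin n) ℂ} (hΨ : IsFundamentalMatrix (fun x => D + B x) Ψ)
      (hB : Continuous fun x => D + B x) (x : ℝ), HasDerivAt (fun x => ((Ψ (-x))⁻¹).transpose)
      ((D.transpose + (B (-x)).transpose) * ((Ψ (-x))⁻¹).transpose) x := by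
    intro B Ψ hΨ hB x
    have := hΨ.hasDerivAt_inv_neg_transpose hB x
    rwa [Matrix.transpose_add] at this
  have hnt : ∀ M : Matrix (Fin n) (Fin n) ℂ, ‖M.transpose‖ ≤ n * ‖M‖ := fun M => by
    simpa using norm_transpose_le M
  obtain ⟨hW, hWM⟩ := H₂ D.transpose σ p.transpose (fun x => ((Φ (-x))⁻¹).transpose)
    (fun x => ((Φ₀ (-x))⁻¹).transpose) (fun x => (Ξ (-x)).transpose)
    (fun x => (Ω (-x)).transpose) a h.transpose ha (hΞc.comp continuous_neg).matrix_transpose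
    (hΩc.comp continuous_neg).matrix_transpose (hinv hΦ hAc) (hinv hΦ₀ hA₀c)
    (by simp [hΦ.1]) (by simp [hΦ₀.1])
    (fun s hs => by
      have h1 := hΞ (-s) (by rw [abs_neg, abs_of_nonneg hs.1]; exact hs.2)
      rw [abs_neg, abs_of_nonneg hs.1] at h1
      rw [mul_assoc]
      exact (hnt _).trans (by gcongr))
    (fun s hs => by
      have h1 := hΩ (-s)
      rw [abs_neg, abs_of_nonneg hs] at h1
      rw [mul_assoc]
      exact (hnt _).trans (by gcongr))
    (fun s hs => by
      have h1 := hΞΩ (-s) (by rw [abs_neg, abs_of_nonneg hs.1]; exact hs.2)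
      rw [mul_assoc, ← Matrix.transpose_sub]
      exact (hnt _).trans (by gcongr))
  set V := scaledCompound k σ Φ
  set W := scaledCompound k σ fun x => (Φ (-x))⁻¹
  have hVL' : ‖V a - L‖ ≤ Q₁ * Real.exp (-η * a) :=
    le_of_tendsto (tendsto_const_nhds.sub hL).norm
      ((eventually_ge_atTop a).mono fun x hx => hVL x hx)
  have hWt : ‖W a‖ ≤ N * Q₂ := by
    have h1 := norm_transpose_le (W a).transpose
    rw [Matrix.transpose_transpose] at h1
    rw [scaledCompound_transpose] at hW
    exact h1.trans (by gcongr)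
  have hWM' : ‖W a - M‖ ≤ N * Q₂ * Real.exp (-η * a) := by
    refine le_of_tendsto (tendsto_const_nhds.sub hM).norm
      ((eventually_ge_atTop a).mono fun x hx => ?_)
    have h0 := hWM x hx
    rw [scaledCompound_transpose, scaledCompound_transpose, ← Matrix.transpose_sub] at h0
    have h1 := norm_transpose_le
      (W a - scaledCompound k σ (fun x => (Φ₀ (-x))⁻¹) x).transpose
    rw [Matrix.transpose_transpose] at h1
    rw [mul_assoc]
    exact h1.trans (by gcongr)
  have hLn : ‖L‖ ≤ 2 * Q₁ := by
    have : ‖L‖ ≤ ‖V a‖ + ‖V a - L‖ := by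
      calc ‖L‖ = ‖V a - (V a - L)‖ := by rw [sub_sub_cancel]
        _ ≤ _ := norm_sub_le _ _
    nlinarith
  have hprod : Complex.exp (-σ * (2 * a)) • compound k ((Φ (-a))⁻¹ * Φ a) = W a * V a := by
    simp only [W, V, scaledCompound]
    rw [compound_mul, smul_mul_assoc, mul_smul_comm, smul_smul, ← Complex.exp_add]
    congr 2
    ring
  rw [hprod]
  calc ‖W a * V a - M * L‖ = ‖W a * (V a - L) + (W a - M) * L‖ := by congr 1; noncomm_ring
    _ ≤ ‖W a‖ * ‖V a - L‖ + ‖W a - M‖ * ‖L‖ :=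
      (norm_add_le _ _).trans (add_le_add (norm_mul_le _ _) (norm_mul_le _ _))
    _ ≤ (N * Q₂) * (Q₁ * Real.exp (-η * a)) + (N * Q₂ * Real.exp (-η * a)) * (2 * Q₁) := by
      gcongr
    _ = _ := by ring

/-- The determinant of the fundamental matrix, relative to the limiting system. -/
theorem exists_scaledDet_bounds (c κ η : ℝ) (hc : 0 ≤ c) (hκ : 0 < κ) (hηκ : η < κ) :
    ∃ Q : ℝ, 0 ≤ Q ∧ ∀ (D : Matrix (Fin n) (Fin n) ℂ) (ℓ : ℂ)
      (Φ Φ₀ Ξ Ω : ℝ → Matrix (Fin n) (Fin n) ℂ) (a : ℝ), 0 ≤ a → Continuous Ξ → Continuous Ω →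
      IsFundamentalMatrix (fun x => D + Ξ x) Φ → IsFundamentalMatrix (fun x => D + Ω x) Φ₀ →
      (∀ s, |s| ≤ a → ‖Ξ s‖ ≤ c * Real.exp (-κ * |s|)) →
      (∀ s, ‖Ω s‖ ≤ c * Real.exp (-κ * |s|)) →
      (∀ s, |s| ≤ a → ‖Ξ s - Ω s‖ ≤ c * Real.exp (-κ * a)) →
      Tendsto (fun x : ℝ => Complex.exp (-D.trace * x) * (Φ₀ x).det) atTop (𝓝 ℓ) →
      ‖Complex.exp (-D.trace * a) * (Φ a).det - ℓ‖ ≤ Q * Real.exp (-η * a) ∧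
      ‖(Complex.exp (-D.trace * a) * (Φ a).det)⁻¹‖ ≤ Q := by
  -- The scalar semigroup is constant and q = 0, so any gap above η will do; η + 1 is one.
  obtain ⟨Q₁, hQ₁, H₁⟩ := exists_norm_le_and_decay (𝔐 := ℂ)
    1 (n * c) κ (η + 1) η 1 (by positivity) hκ hηκ (by linarith)
  obtain ⟨Q₂, hQ₂, H₂⟩ := exists_norm_sub_le (𝔐 := ℂ)
    1 (n * c) κ (η + 1) η 1 (by positivity) hκ hηκ (by linarith)
  refine ⟨Q₁ + Q₂, by positivity, ?_⟩
  intro D ℓ Φ Φ₀ Ξ Ω a ha hΞc hΩc hΦ hΦ₀ hΞ hΩ hΞΩ hL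
  have hd : ∀ {B Ψ : ℝ → Matrix (Fin n) (Fin n) ℂ} (hΨ : IsFundamentalMatrix (fun x => D + B x) Ψ)
      (x : ℝ), HasDerivAt (fun x : ℝ => Complex.exp (-D.trace * x) * (Ψ x).det)
      ((B x).trace * (Complex.exp (-D.trace * x) * (Ψ x).det)) x := by
    intro B Ψ hΨ x
    refine ((hasDerivAt_cexp_mul (-D.trace) x).mul (hasDerivAt_det (hΨ.2 x))).congr_deriv ?_
    rw [Matrix.trace_add]
    ring
  have h0 : ∀ {B Ψ : ℝ → Matrix (Fin n) (Fin n) ℂ} (hΨ : IsFundamentalMatrix (fun x => D + B x) Ψ),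
      Complex.exp (-D.trace * (0 : ℝ)) * (Ψ 0).det = 1 := by
    intro B Ψ hΨ
    rw [hΨ.1]; simp
  have hA : Continuous fun x => D + Ξ x := continuous_const.add hΞc
  have hne : ∀ x : ℝ, Complex.exp (-D.trace * x) * (Φ x).det ≠ 0 := fun x =>
    mul_ne_zero (Complex.exp_ne_zero _) (hΦ.isUnit_det hA x).ne_zero
  have htr : ∀ M : Matrix (Fin n) (Fin n) ℂ, ‖M.trace‖ ≤ n * ‖M‖ := fun M => by
    simpa using norm_trace_le M
  have hΞt : ∀ s ∈ Icc 0 a, ‖(Ξ s).trace‖ ≤ n * c * Real.exp (-κ * s) := fun s hs => by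
    have := hΞ s (by rw [abs_of_nonneg hs.1]; exact hs.2)
    rw [abs_of_nonneg hs.1] at this
    rw [mul_assoc]
    exact (htr _).trans (by gcongr)
  have hΩt : ∀ s, 0 ≤ s → ‖(Ω s).trace‖ ≤ n * c * Real.exp (-κ * s) := fun s hs => by
    have := hΩ s
    rw [abs_of_nonneg hs] at this
    rw [mul_assoc]
    exact (htr _).trans (by gcongr)
  have hΞΩt : ∀ s ∈ Icc 0 a, ‖(Ξ s).trace - (Ω s).trace‖ ≤ n * c * Real.exp (-κ * a) :=
    fun s hs => by
      have := hΞΩ s (by rw [abs_of_nonneg hs.1]; exact hs.2)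
      rw [mul_assoc, ← Matrix.trace_sub]
      exact (htr _).trans (by gcongr)
  have hΞtc : Continuous fun s => (Ξ s).trace := hΞc.matrix_trace
  have hΩtc : Continuous fun s => (Ω s).trace := hΩc.matrix_trace
  have hS : ∀ t : ℝ, HasDerivAt (fun _ : ℝ => (1 : ℂ)) (1 * 0) t := fun t => by
    simpa using hasDerivAt_const t (1 : ℂ)
  constructor
  · refine le_of_tendsto (tendsto_const_nhds.sub hL).norm
      ((eventually_ge_atTop a).mono fun x hx => ?_)
    refine (H₂ (fun _ => 1) _ _ (fun s => (Ξ s).trace) (fun s => (Ω s).trace) 0 1 0 a ha hS rfl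
      (by simp) (fun t _ => by simp; positivity) (by simp) hΞtc hΩtc
      (fun x => (hd hΦ x).congr_deriv (by simp)) (by simp)
      (fun x => (hd hΦ₀ x).congr_deriv (by simp)) (by simp) (by simp) hΞt hΩt hΞΩt
      (by rw [h0 hΦ, h0 hΦ₀]) (by rw [h0 hΦ₀]; simp) x hx).trans ?_
    gcongr
    linarith
  · refine ((H₁ (fun _ => 1) (fun x : ℝ => (Complex.exp (-D.trace * x) * (Φ x).det)⁻¹)
      (fun s => -(Ξ s).trace) 0 1 0 a ha hS rfl (by simp) (fun t _ => by simp; positivity)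
      hΞtc.neg (fun x => ((hd hΦ x).inv (hne x)).congr_deriv ?_) (by simp) (by simp)
      (fun s hs => by rw [norm_neg]; exact hΞt s hs)
      (by rw [h0 hΦ]; simp)).1 a ⟨ha, le_rfl⟩).trans (le_add_of_nonneg_right hQ₂)
    have := hne x
    field_simp
    ring

end minorAsymptotics

/-! ### Limits expressed through conjugators. -/

section conjugator
open NormedSpace Filter Topology Set
variable {n : ℕ}

theorem IsConjugator.conj {A P : ℝ → Matrix (Fin n) (Fin n) ℂ} {B T : Matrix (Fin n) (Fin n) ℂ}
    {s : Set ℝ} (h : IsConjugator A B s P) (hT : IsUnit T.det) :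
    IsConjugator (fun x => T⁻¹ * A x * T) (T⁻¹ * B * T) s fun x => T⁻¹ * P x * T := by
  have hTT : T * T⁻¹ = 1 := Matrix.mul_nonsing_inv _ hT
  have hTT' : T⁻¹ * T = 1 := Matrix.nonsing_inv_mul _ hT
  have hc : ∀ M N : Matrix (Fin n) (Fin n) ℂ, T⁻¹ * M * T * (T⁻¹ * N * T) = T⁻¹ * (M * N) * T := by
    intro M N
    calc T⁻¹ * M * T * (T⁻¹ * N * T) = T⁻¹ * M * (T * T⁻¹) * N * T := by noncomm_ring
      _ = _ := by rw [hTT]; noncomm_ring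
  obtain ⟨hd, K, θ, hθ, hK⟩ := h
  refine ⟨fun x hx => (((hd x hx).const_mul T⁻¹).mul_const T).congr_deriv ?_,
    ‖T⁻¹‖ * K * ‖T‖, θ, hθ, fun x hx => ?_⟩
  · rw [hc, hc]; noncomm_ring
  · have : T⁻¹ * P x * T - 1 = T⁻¹ * (P x - 1) * T := by
      rw [mul_sub, sub_mul, mul_one, hTT']
    rw [this]
    calc _ ≤ ‖T⁻¹‖ * ‖P x - 1‖ * ‖T‖ := (norm_mul_le _ _).trans (by gcongr; exact norm_mul_le _ _)
      _ ≤ ‖T⁻¹‖ * (K * Real.exp (-θ * |x|)) * ‖T‖ := by gcongr; exact hK x hx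
      _ = _ := by ring

/-- P(x) e^(xB) solves W' = A W, so uniqueness expresses it through its value at 0. -/
theorem IsConjugator.mul_exp_eq {A P Φ : ℝ → Matrix (Fin n) (Fin n) ℂ}
    {B : Matrix (Fin n) (Fin n) ℂ} {s : Set ℝ} (h : IsConjugator A B s P) (hA : Continuous A)
    (hΦ : IsFundamentalMatrix A Φ) (hs : Convex ℝ s) (h0 : (0 : ℝ) ∈ s) {x : ℝ} (hx : x ∈ s) :
    P x * exp (x • B) = Φ x * P 0 := by
  have := hΦ.eq_mul_of_hasDerivWithinAt hA hs h0 (W := fun x => P x * exp (x • B)) (fun x hx => by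
    refine ((h.1 x hx).mul (hasDerivAt_exp_smul_const' B x).hasDerivWithinAt).congr_deriv ?_
    rw [sub_mul, ← mul_assoc, ← mul_assoc, sub_add_cancel]
    rfl) hx
  simpa using this

theorem IsConjugator.tendsto {A P : ℝ → Matrix (Fin n) (Fin n) ℂ}
    {B : Matrix (Fin n) (Fin n) ℂ} {s : Set ℝ} (h : IsConjugator A B s P) {f : ℝ → ℝ}
    (hf : ∀ᶠ x in atTop, f x ∈ s) (hf' : Tendsto (fun x => |f x|) atTop atTop) :
    Tendsto (fun x => P (f x)) atTop (𝓝 1) := by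
  obtain ⟨-, K, θ, hθ, hK⟩ := h
  refine tendsto_iff_norm_sub_tendsto_zero.2 ?_
  have h1 : Tendsto (fun x => K * Real.exp (-θ * |f x|)) atTop (𝓝 0) := by
    have h2 : Tendsto (fun x => -θ * |f x|) atTop atBot :=
      hf'.const_mul_atTop_of_neg (neg_lt_zero.2 hθ)
    simpa using (Real.tendsto_exp_atBot.comp h2).const_mul K
  exact squeeze_zero' (Eventually.of_forall fun _ => norm_nonneg _)
    (hf.mono fun x hx => hK (f x) hx) h1

/-- P tends to the identity, hence is invertible far out, and the relation P(x) e^(xB) = Φ(x) P(0)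
carries invertibility back to 0. -/
theorem IsConjugator.isUnit_det {A P Φ : ℝ → Matrix (Fin n) (Fin n) ℂ}
    {B : Matrix (Fin n) (Fin n) ℂ} {s : Set ℝ} (h : IsConjugator A B s P) (hA : Continuous A)
    (hΦ : IsFundamentalMatrix A Φ) (hs : Convex ℝ s) (h0 : (0 : ℝ) ∈ s) {f : ℝ → ℝ}
    (hf : ∀ᶠ x in atTop, f x ∈ s) (hf' : Tendsto (fun x => |f x|) atTop atTop) :
    IsUnit (P 0).det := by
  have h1 : Tendsto (fun x => (P (f x)).det) atTop (𝓝 1) := by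
    have := ((contDiff_det (m := Fin n) (N := 0)).continuous.tendsto 1).comp (h.tendsto hf hf')
    simpa [Function.comp_def] using this
  obtain ⟨x, hx, hx'⟩ := ((h1.eventually_ne one_ne_zero).and hf).exists
  have h2 := congrArg Matrix.det (h.mul_exp_eq hA hΦ hs h0 hx')
  rw [Matrix.det_mul, Matrix.det_mul, det_exp_smul] at h2
  rw [isUnit_iff_ne_zero]
  intro h3
  rw [h3, mul_zero] at h2
  exact mul_ne_zero hx (Complex.exp_ne_zero _) h2

theorem IsDominantMinor.tendsto {k : ℕ} {D : Matrix (Fin n) (Fin n) ℂ} {σ : ℂ}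
    {p : Matrix (Fin k → Fin n) (Fin k → Fin n) ℂ} {C g : ℝ} (h : IsDominantMinor k D σ p C g)
    (hg : 0 < g) : Tendsto (scaledCompound k σ fun t => exp (t • D)) atTop (𝓝 p) := by
  refine tendsto_iff_norm_sub_tendsto_zero.2 ?_
  have h1 : Tendsto (fun t : ℝ => C * Real.exp (-g * t)) atTop (𝓝 0) := by
    have h2 : Tendsto (fun x : ℝ => -g * x) atTop atBot :=
      tendsto_id.const_mul_atTop_of_neg (neg_lt_zero.2 hg)
    simpa using (Real.tendsto_exp_atBot.comp h2).const_mul C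
  refine squeeze_zero' (Eventually.of_forall fun _ => norm_nonneg _)
    ((eventually_ge_atTop 0).mono fun t ht => ?_) h1
  have : scaledCompound k σ (fun t => exp (t • D)) t - p
      = Complex.exp (-σ * t) • (compound k (exp (t • D)) - Complex.exp (σ * t) • p) := by
    rw [scaledCompound, smul_sub, smul_smul, ← Complex.exp_add]
    simp
  rw [this, norm_smul, norm_cexp_mul_ofReal]
  calc _ ≤ Real.exp ((-σ).re * t) * (C * Real.exp ((σ.re - g) * t)) := by
        gcongr; exact h.norm_le t ht
    _ = C * (Real.exp ((-σ).re * t) * Real.exp ((σ.re - g) * t)) := by ring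
    _ = _ := by rw [← Real.exp_add]; congr 2; simp; ring

theorem tendsto_abs_id_atTop : Tendsto (fun x : ℝ => |id x|) atTop atTop := tendsto_abs_atTop_atTop

theorem tendsto_abs_neg_atTop : Tendsto (fun x : ℝ => |-x|) atTop atTop := by
  simpa using tendsto_abs_atTop_atTop (G := ℝ)

theorem IsConjugator.isUnit_det_Ici {A P Φ : ℝ → Matrix (Fin n) (Fin n) ℂ}
    {B : Matrix (Fin n) (Fin n) ℂ} (h : IsConjugator A B (Ici 0) P) (hA : Continuous A)
    (hΦ : IsFundamentalMatrix A Φ) : IsUnit (P 0).det :=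
  h.isUnit_det hA hΦ (convex_Ici 0) self_mem_Ici (f := id) (eventually_ge_atTop 0)
    tendsto_abs_id_atTop

/-- In Φ(x) = P(x) e^(xD) P(0)⁻¹ the first factor tends to the identity and the normalised exterior
power of the second to p. -/
theorem IsDominantMinor.tendsto_right {k : ℕ} {D : Matrix (Fin n) (Fin n) ℂ} {σ : ℂ}
    {p : Matrix (Fin k → Fin n) (Fin k → Fin n) ℂ} {C g : ℝ} (h : IsDominantMinor k D σ p C g)
    (hg : 0 < g) {A P Φ : ℝ → Matrix (Fin n) (Fin n) ℂ} (hP : IsConjugator A D (Ici 0) P)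
    (hA : Continuous A) (hΦ : IsFundamentalMatrix A Φ) :
    Tendsto (scaledCompound k σ Φ) atTop (𝓝 (p * compound k (P 0)⁻¹)) := by
  have h1 : Tendsto (fun x => compound k (P x)) atTop (𝓝 (compound k 1)) :=
    ((contDiff_compound (m := Fin n) (N := 0) k).continuous.tendsto 1).comp
      (hP.tendsto (f := id) (eventually_ge_atTop 0) tendsto_abs_id_atTop)
  have h2 := (h1.mul (h.tendsto hg)).mul_const (compound k (P 0)⁻¹)
  rw [h.compound_one_mul] at h2
  refine h2.congr' ((eventually_ge_atTop 0).mono fun x hx => ?_)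
  have h3 := hP.mul_exp_eq hA hΦ (convex_Ici 0) self_mem_Ici hx
  have h4 : Φ x = P x * exp (x • D) * (P 0)⁻¹ := by
    rw [h3, mul_assoc, Matrix.mul_nonsing_inv _ (hP.isUnit_det_Ici hA hΦ), mul_one]
  rw [scaledCompound, scaledCompound, h4, compound_mul, compound_mul, mul_smul_comm, smul_mul_assoc]

theorem IsDominantMinor.tendsto_left {k : ℕ} {D : Matrix (Fin n) (Fin n) ℂ} {σ : ℂ}
    {p : Matrix (Fin k → Fin n) (Fin k → Fin n) ℂ} {C g : ℝ} (h : IsDominantMinor k D σ p C g)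
    (hg : 0 < g) {A P Φ : ℝ → Matrix (Fin n) (Fin n) ℂ} (hP : IsConjugator A D (Iic 0) P)
    (hA : Continuous A) (hΦ : IsFundamentalMatrix A Φ) :
    Tendsto (scaledCompound k σ fun x => (Φ (-x))⁻¹) atTop (𝓝 (compound k (P 0) * p)) := by
  have hlim : Tendsto (fun x => P (-x)) atTop (𝓝 1) :=
    hP.tendsto (f := fun x => -x) ((eventually_ge_atTop 0).mono fun x hx => by simpa using hx)
      tendsto_abs_neg_atTop
  have hinv : Tendsto (fun x => (P (-x))⁻¹) atTop (𝓝 1) := by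
    have h1 : Tendsto (fun M : Matrix (Fin n) (Fin n) ℂ => M⁻¹) (𝓝 1) (𝓝 1) := by
      have h2 := (NormedRing.inverse_continuousAt (1 : (Matrix (Fin n) (Fin n) ℂ)ˣ)).tendsto
      simp only [Units.val_one, Ring.inverse_one] at h2
      refine h2.congr fun M => ?_
      rw [Matrix.nonsing_inv_eq_ringInverse]
    exact h1.comp hlim
  have h1 : Tendsto (fun x => compound k (P (-x))⁻¹) atTop (𝓝 (compound k 1)) :=
    ((contDiff_compound (m := Fin n) (N := 0) k).continuous.tendsto 1).comp hinv
  have h2 := ((h.tendsto hg).mul h1).const_mul (compound k (P 0))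
  rw [h.mul_compound_one] at h2
  have hdet : ∀ᶠ x in atTop, IsUnit (P (-x)).det := by
    have h1 : Tendsto (fun x => (P (-x)).det) atTop (𝓝 1) := by
      have := ((contDiff_det (m := Fin n) (N := 0)).continuous.tendsto 1).comp hlim
      simpa [Function.comp_def] using this
    exact (h1.eventually_ne one_ne_zero).mono fun x hx => isUnit_iff_ne_zero.2 hx
  refine h2.congr' (((eventually_ge_atTop 0).and hdet).mono fun x hx => ?_)
  have h3 := hP.mul_exp_eq hA hΦ (convex_Iic 0) self_mem_Iic (x := -x) (by simpa using hx.1)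
  have hE : exp (-x • D) * exp (x • D) = 1 := by
    rw [← Matrix.exp_add_of_commute _ _ (((Commute.refl D).smul_left _).smul_right _), ← add_smul]
    simp
  have h4 : (Φ (-x))⁻¹ = P 0 * (exp (x • D) * (P (-x))⁻¹) := by
    refine Matrix.inv_eq_right_inv ?_
    rw [← mul_assoc, ← h3, mul_assoc, ← mul_assoc (exp (-x • D)), hE, one_mul,
      Matrix.mul_nonsing_inv _ hx.2]
  rw [scaledCompound, scaledCompound, h4, compound_mul, compound_mul, smul_mul_assoc, mul_smul_comm]

theorem IsConjugator.tendsto_scaledDet {D : Matrix (Fin n) (Fin n) ℂ}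
    {A P Φ : ℝ → Matrix (Fin n) (Fin n) ℂ} (hP : IsConjugator A D (Ici 0) P)
    (hA : Continuous A) (hΦ : IsFundamentalMatrix A Φ) :
    Tendsto (fun x : ℝ => Complex.exp (-D.trace * x) * (Φ x).det) atTop (𝓝 ((P 0).det)⁻¹) := by
  have h1 : Tendsto (fun x => (P x).det * ((P 0).det)⁻¹) atTop (𝓝 ((P 0).det)⁻¹) := by
    have := (((contDiff_det (m := Fin n) (N := 0)).continuous.tendsto 1).comp
      (hP.tendsto (f := id) (eventually_ge_atTop 0) tendsto_abs_id_atTop)).mul_const ((P 0).det)⁻¹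
    simpa using this
  refine h1.congr' ((eventually_ge_atTop 0).mono fun x hx => ?_)
  have h3 := congrArg Matrix.det (hP.mul_exp_eq hA hΦ (convex_Ici 0) self_mem_Ici hx)
  rw [Matrix.det_mul, Matrix.det_mul, det_exp_smul] at h3
  have h0 := (hP.isUnit_det_Ici hA hΦ).ne_zero
  have he : Complex.exp (-D.trace * x) * Complex.exp (D.trace * x) = 1 := by
    rw [← Complex.exp_add]; simp
  field_simp
  calc (P x).det = Complex.exp (-D.trace * x) * ((P x).det * Complex.exp (D.trace * x)) := by
        rw [mul_left_comm, he, mul_one]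
    _ = _ := by rw [h3, neg_mul]; ring

end conjugator

/-! ### From traces of exterior powers to homoclinic Evans functions. -/

section evansValue
open NormedSpace Filter Topology Set
variable {n : ℕ}

/-- The q-component of v is recovered from the orbit of v by the backward flow. The orbit grows at
most at rate a and the backward flow on the range of q at most at rate b, so a + b < 0 forces the
component to vanish. -/
theorem mulVec_eq_zero_of_mem_growthSubmodule {B T q : Matrix (Fin n) (Fin n) ℂ} {C a b : ℝ}
    (hT : IsUnit T.det) (hq : (T⁻¹ * B * T) * q = q * (T⁻¹ * B * T))
    (h : ∀ t : ℝ, 0 ≤ t → ‖exp (t • (-(T⁻¹ * B * T))) * q‖ ≤ C * Real.exp (b * t))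
    (hab : a + b < 0) {v : Fin n → ℂ} (hv : v ∈ growthSubmodule B a) :
    q.mulVec (T⁻¹.mulVec v) = 0 := by
  obtain ⟨C', hC'⟩ := hv
  set D := T⁻¹ * B * T with hD
  have hTT : T * T⁻¹ = 1 := Matrix.mul_nonsing_inv _ hT
  have hbound : ∀ t : ℝ, 0 ≤ t →
      ‖q.mulVec (T⁻¹.mulVec v)‖ ≤ (C * ‖T⁻¹‖ * C') * Real.exp ((a + b) * t) := by
    intro t ht
    have h1 : exp (t • D) * T⁻¹ = T⁻¹ * exp (t • B) := by
      rw [hD, exp_real_smul_conj hT, mul_assoc, hTT, mul_one]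
    have h2 : exp (t • (-D)) * exp (t • D) = 1 := by
      rw [← Matrix.exp_add_of_commute _ _
        ((((Commute.refl D).neg_left).smul_left _).smul_right _), ← smul_add]
      simp
    have h3 : exp (t • D) * q = q * exp (t • D) :=
      ((show Commute D q from hq).smul_left t).exp_left.eq
    have h4 : q * T⁻¹ = exp (t • (-D)) * q * (T⁻¹ * exp (t • B)) := by
      rw [← h1, mul_assoc, ← mul_assoc q, ← h3, mul_assoc, ← mul_assoc, h2, one_mul]
    have h5 : q.mulVec (T⁻¹.mulVec v)
        = (exp (t • (-D)) * q).mulVec (T⁻¹.mulVec ((exp (t • B)).mulVec v)) := by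
      rw [Matrix.mulVec_mulVec, Matrix.mulVec_mulVec, Matrix.mulVec_mulVec, h4, ← mul_assoc]
    rw [h5]
    have hC0 : 0 ≤ C * Real.exp (b * t) := (norm_nonneg _).trans (h t ht)
    calc _ ≤ ‖exp (t • (-D)) * q‖ * (‖T⁻¹‖ * ‖(exp (t • B)).mulVec v‖) :=
          (Matrix.linfty_opNorm_mulVec _ _).trans (by
            gcongr; exact Matrix.linfty_opNorm_mulVec _ _)
      _ ≤ (C * Real.exp (b * t)) * (‖T⁻¹‖ * (C' * Real.exp (a * t))) := by
          gcongr
          · exact h t ht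
          · exact hC' t ht
      _ = (C * ‖T⁻¹‖ * C') * (Real.exp (a * t) * Real.exp (b * t)) := by ring
      _ = _ := by rw [← Real.exp_add, ← add_mul]
  have hlim : Tendsto (fun t : ℝ => (C * ‖T⁻¹‖ * C') * Real.exp ((a + b) * t)) atTop (𝓝 0) := by
    simpa using (Real.tendsto_exp_atBot.comp
      (tendsto_id.const_mul_atTop_of_neg hab)).const_mul (C * ‖T⁻¹‖ * C')
  exact norm_le_zero_iff.1 (ge_of_tendsto hlim ((eventually_ge_atTop 0).mono hbound))

/-- The homoclinic Evans function in coordinates in which the splitting is a coordinate one. -/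
theorem IsHomoclinicEvansValue.eq_det {A : ℝ → Matrix (Fin n) (Fin n) ℂ}
    {B T : Matrix (Fin n) (Fin n) ℂ} {J : Finset (Fin n)} {c C b b' : ℝ} {d : ℂ}
    (h : IsHomoclinicEvansValue A B c d) (hT : IsUnit T.det)
    (hJ : (T⁻¹ * B * T) * coordProj J = coordProj J * (T⁻¹ * B * T))
    (hb : b < c) (hb' : b' < -c)
    (hbelow : ∀ t : ℝ, 0 ≤ t → ‖exp (t • (T⁻¹ * B * T)) * coordProj Jᶜ‖ ≤ C * Real.exp (b * t))
    (habove : ∀ t : ℝ, 0 ≤ t →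
      ‖exp (t • (-(T⁻¹ * B * T))) * coordProj J‖ ≤ C * Real.exp (b' * t)) :
    ∃ Pm Pp : ℝ → Matrix (Fin n) (Fin n) ℂ,
      IsConjugator (fun x => T⁻¹ * A x * T) (T⁻¹ * B * T) (Iic 0) Pm ∧
      IsConjugator (fun x => T⁻¹ * A x * T) (T⁻¹ * B * T) (Ici 0) Pp ∧
      d = (Pm 0 * coordProj J + Pp 0 * coordProj Jᶜ).det := by
  obtain ⟨Pm, Pp, R, S, hPm, hPp, hR, hS, hS', rfl⟩ := h
  refine ⟨_, _, hPm.conj hT, hPp.conj hT, ?_⟩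
  have hTT : T * T⁻¹ = 1 := Matrix.mul_nonsing_inv _ hT
  have hTT' : T⁻¹ * T = 1 := Matrix.nonsing_inv_mul _ hT
  set e := (coordProj J : Matrix (Fin n) (Fin n) ℂ) with he
  have hJc : (T⁻¹ * B * T) * coordProj Jᶜ = coordProj Jᶜ * (T⁻¹ * B * T) := by
    rw [coordProj_compl, mul_sub, sub_mul, ← he, hJ, mul_one, one_mul]
  have hneg : T⁻¹ * (-B) * T = -(T⁻¹ * B * T) := by noncomm_ring
  have hcol : ∀ (q : Matrix (Fin n) (Fin n) ℂ) i j,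
      (q * (T⁻¹ * R)) i j = q.mulVec (T⁻¹.mulVec fun i => R i j) i := by
    intro q i j
    rw [Matrix.mulVec_mulVec, ← mul_assoc, Matrix.mul_apply]
    simp only [Matrix.mulVec, dotProduct]
  have h1 : coordProj Jᶜ * (T⁻¹ * R) * coordProj S = 0 := by
    ext i j
    rw [mul_coordProj_apply, Matrix.zero_apply]
    split_ifs with hj
    · rw [hcol, mulVec_eq_zero_of_mem_growthSubmodule (B := -B) (C := C) (a := -c) (b := b) hT
        (by rw [hneg, neg_mul, mul_neg, hJc]) (by rw [hneg, neg_neg]; exact hbelow) (by linarith)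
        (spectralAbove_le_growthSubmodule B c (hS j hj))]
      rfl
    · rfl
  have h2 : e * (T⁻¹ * R) * coordProj Sᶜ = 0 := by
    ext i j
    rw [mul_coordProj_apply, Matrix.zero_apply]
    split_ifs with hj
    · rw [hcol, mulVec_eq_zero_of_mem_growthSubmodule (B := B) (C := C) (a := c) (b := b') hT
        hJ habove (by linarith)
        (spectralBelow_le_growthSubmodule B c (hS' j (Finset.mem_compl.1 hj)))]
      rfl
    · rfl
  rw [coordProj_compl, ← he] at h1
  rw [coordProj_compl] at h2
  -- By `h1` and `h2` the columns of T⁻¹R in S lie in the coordinate space of `J` and the others in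
  -- the complementary one. Thus T⁻¹R intertwines the two projections, which lets R be factored out
  -- and its determinant cancelled.
  have h3 : T⁻¹ * R * coordProj S = e * (T⁻¹ * R) := by
    have e1 : T⁻¹ * R * coordProj S - e * (T⁻¹ * R)
        = (1 - e) * (T⁻¹ * R) * coordProj S - e * (T⁻¹ * R) * (1 - coordProj S) := by
      noncomm_ring
    rw [h1, h2, sub_zero] at e1
    exact sub_eq_zero.1 e1
  have h4 : R * coordProj S = T * e * T⁻¹ * R := by
    calc R * coordProj S = (T * T⁻¹) * R * coordProj S := by rw [hTT, one_mul]
      _ = T * (T⁻¹ * R * coordProj S) := by noncomm_ring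
      _ = _ := by rw [h3]; noncomm_ring
  have h5 : (Matrix.of fun i j => if j ∈ S then (Pm 0 * R) i j else (Pp 0 * R) i j)
      = (Pm 0 * (T * e * T⁻¹) + Pp 0 * (1 - T * e * T⁻¹)) * R := by
    have : (Matrix.of fun i j => if j ∈ S then (Pm 0 * R) i j else (Pp 0 * R) i j)
        = Pm 0 * R * coordProj S + Pp 0 * R * coordProj Sᶜ := by
      ext i j
      rw [Matrix.add_apply, mul_coordProj_apply, mul_coordProj_apply, Matrix.of_apply]
      by_cases hj : j ∈ S <;> simp [hj]
    rw [this, coordProj_compl, mul_assoc, h4, mul_sub, mul_one, mul_assoc (Pp 0), h4]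
    noncomm_ring
  rw [h5, Matrix.det_mul, mul_div_assoc, div_self hR, mul_one]
  have h6 : T⁻¹ * Pm 0 * T * e + T⁻¹ * Pp 0 * T * coordProj Jᶜ
      = T⁻¹ * (Pm 0 * (T * e * T⁻¹) + Pp 0 * (1 - T * e * T⁻¹)) * T := by
    have e1 : T⁻¹ * (Pm 0 * (T * e * T⁻¹) + Pp 0 * (1 - T * e * T⁻¹)) * T
        = T⁻¹ * Pm 0 * T * e * (T⁻¹ * T) + T⁻¹ * Pp 0 * T - T⁻¹ * Pp 0 * T * e * (T⁻¹ * T) := by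
      noncomm_ring
    rw [e1, hTT', coordProj_compl]
    noncomm_ring
  rw [h6, Matrix.det_mul, Matrix.det_mul, mul_right_comm, ← Matrix.det_mul, hTT', Matrix.det_one,
    one_mul]

/-- Cyclicity of the trace gathers the factors into the exterior power of the compression of Pp⁻¹ Pm
to `J`, whose trace is a block determinant. -/
theorem trace_compound_mul_minorProj {k : ℕ} (J : Finset (Fin n))
    {Pm Pp : Matrix (Fin n) (Fin n) ℂ} (hPp : IsUnit Pp.det) :
    (compound k Pm * minorProj k J * (minorProj k J * compound k Pp⁻¹)).trace
      = if J.card = k then (Pm * coordProj J + Pp * coordProj Jᶜ).det * (Pp.det)⁻¹ else 0 := by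
  unfold minorProj
  split_ifs with h
  · rw [Matrix.trace_mul_comm, ← compound_mul, ← compound_mul, ← compound_mul]
    have e1 : coordProj J * Pp⁻¹ * (Pm * coordProj J) = coordProj J * (Pp⁻¹ * Pm) * coordProj J := by
      noncomm_ring
    rw [e1, trace_compound_coordProj _ _ h]
    have e2 : Pm * coordProj J + Pp * coordProj Jᶜ
        = Pp * (Pp⁻¹ * Pm * coordProj J + coordProj Jᶜ) := by
      rw [mul_add, ← mul_assoc, ← mul_assoc, Matrix.mul_nonsing_inv _ hPp, one_mul]
    rw [e2, Matrix.det_mul]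
    field_simp [hPp.ne_zero]
  · simp

/-- Asymptotics of the periodic Evans function in terms of the homoclinic ones. -/
theorem exists_evans_asymptotics (u : ℕ) (hu : u + 1 ≤ n) (C : ℕ → ℝ) (c κ g η : ℝ) (hc : 0 ≤ c)
    (hηκ : η < κ) (hηg : η < g) (hη : 0 < η) :
    ∃ Q : ℝ, 0 ≤ Q ∧ ∀ (D : Matrix (Fin n) (Fin n) ℂ) (J : ℕ → Finset (Fin n)) (U V : Finset (Fin n))
      (Φ Φ₀ Ξ Ω Pm Pp : ℝ → Matrix (Fin n) (Fin n) ℂ) (a : ℝ) (γ μ d₁ d₂ : ℂ),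
      (∀ k, J k = if k = u + 1 then V else U) → U.card = u → V.card = u + 1 →
      μ = (D * coordProj V).trace - (D * coordProj U).trace →
      (∀ k ≤ n, IsDominantMinor k D (D * coordProj (J k)).trace (minorProj k (J k)) (C k) g) →
      0 ≤ a → Continuous Ξ → Continuous Ω →
      IsFundamentalMatrix (fun x => D + Ξ x) Φ → IsFundamentalMatrix (fun x => D + Ω x) Φ₀ →
      (∀ s, |s| ≤ a → ‖Ξ s‖ ≤ c * Real.exp (-κ * |s|)) →
      (∀ s, ‖Ω s‖ ≤ c * Real.exp (-κ * |s|)) →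
      (∀ s, |s| ≤ a → ‖Ξ s - Ω s‖ ≤ c * Real.exp (-κ * a)) →
      IsConjugator (fun x => D + Ω x) D (Iic 0) Pm → IsConjugator (fun x => D + Ω x) D (Ici 0) Pp →
      d₁ = (Pm 0 * coordProj V + Pp 0 * coordProj Vᶜ).det →
      d₂ = (Pm 0 * coordProj U + Pp 0 * coordProj Uᶜ).det → ‖γ‖ = 1 →
      ‖((Φ (-a))⁻¹ * Φ a - γ • (1 : Matrix (Fin n) (Fin n) ℂ)).det
          * Complex.exp (-(D * coordProj U).trace * (2 * a)) * ((-γ) ^ (n - (u + 1)))⁻¹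
          * (Complex.exp (-D.trace * a) * (Φ a).det)⁻¹
        - (Complex.exp (μ * (2 * a)) * d₁ - γ * d₂)‖
        ≤ Q * (1 + ‖Complex.exp (μ * (2 * a))‖) * (1 + ‖d₁‖ + ‖d₂‖) * Real.exp (-η * a) := by
  have hκ : 0 < κ := hη.trans hηκ
  choose q hq0 hq using fun k => exists_scaledCompound_sub_le (n := n) k (C k) c κ g η hc hκ hηκ hηg hη
  obtain ⟨Q₁, hQ₁, H₁⟩ := exists_scaledDet_bounds (n := n) c κ η hc hκ hηκ
  set N : ℕ → ℝ := fun k => ((Fintype.card (Fin k → Fin n) : ℕ) : ℝ) with hN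
  set Q₀ := ∑ k ∈ Finset.range (n + 1), N k * q k with hQ₀
  have hQ₀0 : 0 ≤ Q₀ := Finset.sum_nonneg fun k _ => mul_nonneg (Nat.cast_nonneg _) (hq0 k)
  refine ⟨Q₀ * Q₁ + Q₁ * Q₁, by positivity, ?_⟩
  intro D J U V Φ Φ₀ Ξ Ω Pm Pp a γ μ d₁ d₂ hJ hU hV hμ hdom ha hΞc hΩc hΦ hΦ₀ hΞ hΩ hΞΩ hPm hPp
    hd₁ hd₂ hγ
  have hg : 0 < g := hη.trans hηg
  have hAc : Continuous fun x => D + Ω x := continuous_const.add hΩc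
  have hPpu := hPp.isUnit_det_Ici hAc hΦ₀
  set ℓ := ((Pp 0).det)⁻¹ with hℓ
  set Y := (Φ (-a))⁻¹ * Φ a with hY
  set σ : ℕ → ℂ := fun k => (D * coordProj (J k)).trace with hσ
  set τ : ℕ → ℂ := fun k =>
    if (J k).card = k then (Pm 0 * coordProj (J k) + Pp 0 * coordProj (J k)ᶜ).det * ℓ else 0 with hτ
  set w : ℕ → ℂ := fun k => Complex.exp (-σ k * (2 * a)) * (compound k Y).trace with hw
  have hwτ : ∀ k ≤ n, ‖w k - τ k‖ ≤ N k * q k * Real.exp (-η * a) := by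
    intro k hkn
    have hdom := hdom k hkn
    have h1 := hq k D (σ k) (minorProj k (J k)) (minorProj k (J k) * compound k (Pp 0)⁻¹)
      (compound k (Pm 0) * minorProj k (J k)) Φ Φ₀ Ξ Ω a hdom ha hΞc hΩc hΦ hΦ₀ hΞ hΩ hΞΩ
      (hdom.tendsto_right hg hPp hAc hΦ₀) (hdom.tendsto_left hg hPm hAc hΦ₀)
    have h2 := norm_trace_le (Complex.exp (-σ k * (2 * a)) • compound k Y
      - compound k (Pm 0) * minorProj k (J k) * (minorProj k (J k) * compound k (Pp 0)⁻¹))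
    rw [Matrix.trace_sub, Matrix.trace_smul, trace_compound_mul_minorProj _ hPpu] at h2
    rw [mul_assoc]
    exact h2.trans (by gcongr)
  have hγ0 : -γ ≠ 0 := by
    rw [neg_ne_zero]
    rintro rfl
    simp at hγ
  have hγn : ‖-γ‖ = 1 := by rw [norm_neg, hγ]
  set X := Complex.exp (μ * (2 * a)) with hX
  -- All powers are normalised by the rate of U. Only the power u + 1 has a rate of its own,
  -- differing from it by μ, hence the factor e^(2aμ).
  set β : ℕ → ℂ := fun k => if k = u + 1 then X else 1 with hβ
  set ω : ℕ → ℂ := fun k => (-γ) ^ (n - k) * ((-γ) ^ (n - (u + 1)))⁻¹ with hω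
  have hβn : ∀ k, ‖β k‖ ≤ 1 + ‖X‖ := fun k => by
    simp only [hβ]
    split_ifs
    · linarith
    · rw [norm_one]; linarith [norm_nonneg X]
  have hωn : ∀ k, ‖ω k‖ = 1 := fun k => by simp [hω, hγn, norm_pow]
  have hσu : Complex.exp (-(D * coordProj U).trace * (2 * a)) ≠ 0 := Complex.exp_ne_zero _
  have hdet : (Y - γ • (1 : Matrix (Fin n) (Fin n) ℂ)).det
      * Complex.exp (-(D * coordProj U).trace * (2 * a)) * ((-γ) ^ (n - (u + 1)))⁻¹
      = ∑ k ∈ Finset.range (n + 1), ω k * β k * w k := by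
    rw [sub_eq_add_neg, ← neg_smul, det_add_smul_one, Fintype.card_fin, Finset.sum_mul,
      Finset.sum_mul]
    refine Finset.sum_congr rfl fun k _ => ?_
    have h1 : Complex.exp (-(D * coordProj U).trace * (2 * a))
        = β k * Complex.exp (-σ k * (2 * a)) := by
      simp only [hβ, hσ, hJ]
      split_ifs
      · rw [hX, ← Complex.exp_add, hμ]
        congr 1
        ring
      · rw [one_mul]
    rw [h1]
    simp only [hω, hw]
    ring
  -- `minorProj` vanishes unless the size of the set is k, so only k = u + 1 (set V) and k = u (set
  -- U) have a nonzero limit.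
  have hsum : ∑ k ∈ Finset.range (n + 1), ω k * β k * τ k = (X * d₁ - γ * d₂) * ℓ := by
    have h1 : ∀ k ∈ Finset.range (n + 1), ω k * β k * τ k
        = (if k = u + 1 then X * d₁ * ℓ else 0) + if k = u then -γ * d₂ * ℓ else 0 := by
      intro k hk
      by_cases h1 : k = u + 1
      · have hne : k ≠ u := by omega
        have : ω k = 1 := by
          simp only [hω, h1]
          exact mul_inv_cancel₀ (pow_ne_zero _ hγ0)
        simp only [this, hβ, hτ, hJ, if_pos h1, if_neg hne, hV]
        rw [if_pos h1.symm, hd₁]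
        ring
      · by_cases h2 : k = u
        · have : ω k = -γ := by
            simp only [hω, h2]
            have : n - u = (n - (u + 1)) + 1 := by omega
            rw [this, pow_succ', mul_assoc, mul_inv_cancel₀ (pow_ne_zero _ hγ0), mul_one]
          simp only [this, hβ, hτ, hJ, if_neg h1, if_pos h2, hU]
          rw [if_pos h2.symm, hd₂]
          ring
        · simp only [hτ, hJ, if_neg h1, if_neg h2, hU]
          rw [if_neg (Ne.symm h2)]
          ring
    rw [Finset.sum_congr rfl h1, Finset.sum_add_distrib, Finset.sum_ite_eq', Finset.sum_ite_eq',
      if_pos (by simp; omega), if_pos (by simp; omega)]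
    ring
  have hdiff : ‖∑ k ∈ Finset.range (n + 1), ω k * β k * w k - (X * d₁ - γ * d₂) * ℓ‖
      ≤ (1 + ‖X‖) * (Q₀ * Real.exp (-η * a)) := by
    rw [← hsum, ← Finset.sum_sub_distrib, hQ₀, Finset.sum_mul, Finset.mul_sum]
    refine norm_sum_le_of_le _ fun k hk => ?_
    rw [← mul_sub, norm_mul, norm_mul, hωn, one_mul]
    exact mul_le_mul (hβn k) (hwτ k (Nat.lt_succ_iff.1 (Finset.mem_range.1 hk))) (norm_nonneg _) (by positivity)
  obtain ⟨hv1, hv2⟩ := H₁ D ℓ Φ Φ₀ Ξ Ω a ha hΞc hΩc hΦ hΦ₀ hΞ hΩ hΞΩ (hPp.tendsto_scaledDet hAc hΦ₀)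
  -- The common factor ℓ = det Pp(0)⁻¹ is cancelled by its approximation v and not by itself: v
  -- depends analytically on the parameter and never vanishes, whereas analyticity of the
  -- conjugators is not assumed.
  set v := Complex.exp (-D.trace * a) * (Φ a).det with hv
  have hv0 : v ≠ 0 := mul_ne_zero (Complex.exp_ne_zero _)
    (hΦ.isUnit_det (continuous_const.add hΞc) a).ne_zero
  have hY1 : ‖X * d₁ - γ * d₂‖ ≤ (1 + ‖X‖) * (‖d₁‖ + ‖d₂‖) := by
    refine (norm_sub_le _ _).trans ?_
    rw [norm_mul, norm_mul, hγ]
    nlinarith [norm_nonneg X, norm_nonneg d₁, norm_nonneg d₂,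
      mul_nonneg (norm_nonneg X) (norm_nonneg d₂)]
  rw [hdet]
  set Z := ∑ k ∈ Finset.range (n + 1), ω k * β k * w k
  set E := Real.exp (-η * a)
  have hE : 0 ≤ E := Real.exp_nonneg _
  calc ‖Z * v⁻¹ - (X * d₁ - γ * d₂)‖
      = ‖(Z - (X * d₁ - γ * d₂) * ℓ) * v⁻¹ - (X * d₁ - γ * d₂) * ((v - ℓ) * v⁻¹)‖ := by
        congr 1; field_simp; ring
    _ ≤ ‖Z - (X * d₁ - γ * d₂) * ℓ‖ * ‖v⁻¹‖ + ‖X * d₁ - γ * d₂‖ * (‖v - ℓ‖ * ‖v⁻¹‖) := by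
        rw [← norm_mul, ← norm_mul, ← norm_mul]
        exact norm_sub_le _ _
    _ ≤ ((1 + ‖X‖) * (Q₀ * E)) * Q₁ + ((1 + ‖X‖) * (‖d₁‖ + ‖d₂‖)) * ((Q₁ * E) * Q₁) := by
        gcongr
    _ = (1 + ‖X‖) * E * (Q₀ * Q₁ * 1 + Q₁ * Q₁ * (‖d₁‖ + ‖d₂‖)) := by ring
    _ ≤ (1 + ‖X‖) * E * (Q₀ * Q₁ * (1 + ‖d₁‖ + ‖d₂‖) + Q₁ * Q₁ * (1 + ‖d₁‖ + ‖d₂‖)) := by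
        gcongr
        · linarith [norm_nonneg d₁, norm_nonneg d₂]
        · linarith
    _ = _ := by ring

end evansValue

/-! ### Counting zeros of analytic functions. -/

section zeros
open Filter Topology Set Metric

/-- The monic polynomial function with the given multiset of zeros. -/
noncomputable def zeroProd (Z : Multiset ℂ) (w : ℂ) : ℂ := (Z.map fun a => w - a).prod

theorem zeroProd_cons (a : ℂ) (Z : Multiset ℂ) (w : ℂ) :
    zeroProd (a ::ₘ Z) w = (w - a) * zeroProd Z w := by simp [zeroProd]

theorem zeroProd_add (Z Z' : Multiset ℂ) (w : ℂ) :
    zeroProd (Z + Z') w = zeroProd Z w * zeroProd Z' w := by simp [zeroProd]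

theorem zeroProd_replicate (m : ℕ) (a w : ℂ) :
    zeroProd (Multiset.replicate m a) w = (w - a) ^ m := by simp [zeroProd]

theorem zeroProd_ne_zero {Z : Multiset ℂ} {w : ℂ} (h : w ∉ Z) : zeroProd Z w ≠ 0 := by
  refine Multiset.prod_ne_zero fun h0 => ?_
  obtain ⟨a, ha, ha0⟩ := Multiset.mem_map.1 h0
  rw [sub_eq_zero.1 ha0] at h
  exact h ha

theorem analyticAt_zeroProd (Z : Multiset ℂ) (w : ℂ) : AnalyticAt ℂ (zeroProd Z) w := by
  induction Z using Multiset.induction with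
  | empty => exact analyticAt_const (v := (1 : ℂ)) |>.congr (Eventually.of_forall fun w => by simp [zeroProd])
  | cons a Z ih =>
    exact ((analyticAt_id.sub analyticAt_const).mul ih).congr
      (Eventually.of_forall fun w => (zeroProd_cons a Z w).symm)

theorem analyticOrderAt_sub_const (a z : ℂ) :
    analyticOrderAt (fun w => w - a) z = if z = a then 1 else 0 := by
  have han : AnalyticAt ℂ (fun w => w - a) z := analyticAt_id.sub analyticAt_const
  split_ifs with h
  · subst h
    have := (han.analyticOrderAt_eq_natCast (n := 1)).2
      ⟨fun _ => 1, analyticAt_const, one_ne_zero, Eventually.of_forall fun w => by simp⟩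
    simp [this]
  · exact han.analyticOrderAt_eq_zero.2 (sub_ne_zero.2 h)

theorem analyticOrderAt_zeroProd (Z : Multiset ℂ) (z : ℂ) :
    analyticOrderAt (zeroProd Z) z = (Z.count z : ℕ∞) := by
  induction Z using Multiset.induction with
  | empty =>
    rw [(analyticAt_zeroProd 0 z).analyticOrderAt_eq_zero.2 (by simp [zeroProd])]
    simp
  | cons a Z ih =>
    have h1 : zeroProd (a ::ₘ Z) = (fun w => w - a) * zeroProd Z := by
      funext w; exact zeroProd_cons a Z w
    have h2 : AnalyticAt ℂ (fun w => w - a) z := analyticAt_id.sub analyticAt_const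
    rw [h1, analyticOrderAt_mul h2 (analyticAt_zeroProd Z z), ih,
      analyticOrderAt_sub_const, Multiset.count_cons]
    split_ifs <;> push_cast <;> ring

/-- Induction on a finite set containing the zeros in K: at each point the full power of the linear
factor is divided out, and the local factorisation removes the singularity of the quotient. -/
theorem exists_zeroProd_factorization_aux {U K : Set ℂ} (hU : IsOpen U) (hKU : K ⊆ U)
    (s : Finset ℂ) : ∀ f : ℂ → ℂ, AnalyticOnNhd ℂ f U → (∀ z ∈ K, analyticOrderAt f z ≠ ⊤) →
      (∀ z ∈ K, f z = 0 → z ∈ s) → ∃ (Z : Multiset ℂ) (F : ℂ → ℂ), AnalyticOnNhd ℂ F U ∧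
      (∀ z ∈ Z, z ∈ K) ∧ (∀ w ∈ U, f w = zeroProd Z w * F w) ∧ ∀ w ∈ K, F w ≠ 0 := by
  classical
  induction s using Finset.induction with
  | empty =>
    intro f hf _ hs
    exact ⟨0, f, hf, by simp, fun w _ => by simp [zeroProd], fun w hw h => by simpa using hs w hw h⟩
  | insert a s ha ih =>
    intro f hf hord hs
    by_cases haK : a ∈ K
    · obtain ⟨m, hm⟩ := ENat.ne_top_iff_exists.1 (hord a haK)
      obtain ⟨g, hg, hg0, hgf⟩ := ((hf a (hKU haK)).analyticOrderAt_eq_natCast (n := m)).1 hm.symm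
      set F : ℂ → ℂ := Function.update (fun w => ((w - a) ^ m)⁻¹ * f w) a (g a) with hF
      have hFa : F =ᶠ[𝓝 a] g := by
        filter_upwards [hgf] with w hw
        by_cases hwa : w = a
        · simp [hF, hwa]
        · rw [hF, Function.update_of_ne hwa, hw, smul_eq_mul, ← mul_assoc, inv_mul_cancel₀, one_mul]
          exact pow_ne_zero _ (sub_ne_zero.2 hwa)
      have hFne : ∀ z, z ≠ a → F =ᶠ[𝓝 z] fun w => ((w - a) ^ m)⁻¹ * f w := fun z hz => by
        filter_upwards [isOpen_ne.mem_nhds hz] with w hw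
        rw [hF, Function.update_of_ne hw]
      have hFan : AnalyticOnNhd ℂ F U := by
        intro z hz
        by_cases hza : z = a
        · subst hza
          exact hg.congr hFa.symm
        · have h1 : AnalyticAt ℂ (fun w => (w - a) ^ m) z :=
            (analyticAt_id.sub analyticAt_const).pow m
          exact ((h1.inv (pow_ne_zero _ (sub_ne_zero.2 hza))).mul (hf z hz)).congr (hFne z hza).symm
      have hfF : ∀ w ∈ U, f w = (w - a) ^ m * F w := by
        intro w hw
        by_cases hwa : w = a
        · subst hwa
          have h1 := hgf.self_of_nhds
          rw [smul_eq_mul] at h1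
          rw [h1]; simp [hF]
        · rw [hF, Function.update_of_ne hwa, ← mul_assoc, mul_inv_cancel₀, one_mul]
          exact pow_ne_zero _ (sub_ne_zero.2 hwa)
      obtain ⟨Z, G, hG, hZ, hFG, hG0⟩ := ih F hFan (fun z hz h => by
        refine hord z hz (analyticOrderAt_eq_top.2 ?_)
        filter_upwards [analyticOrderAt_eq_top.1 h, hU.mem_nhds (hKU hz)] with w hw hwU
        rw [hfF w hwU, hw, mul_zero]) (fun z hz h => by
        have h1 := hs z hz (by rw [hfF z (hKU hz), h, mul_zero])
        rcases Finset.mem_insert.1 h1 with rfl | h1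
        · exact absurd h (by simpa [hF] using hg0)
        · exact h1)
      refine ⟨Multiset.replicate m a + Z, G, hG, fun z hz => ?_, fun w hw => ?_, hG0⟩
      · rcases Multiset.mem_add.1 hz with hz | hz
        · rwa [Multiset.eq_of_mem_replicate hz]
        · exact hZ z hz
      · rw [zeroProd_add, zeroProd_replicate, mul_assoc, ← hFG w hw, hfF w hw]
    · exact ih f hf hord fun z hz h => (Finset.mem_insert.1 (hs z hz h)).resolve_left
        (by rintro rfl; exact haK hz)

theorem finite_zeros_of_isCompact {U K : Set ℂ} {f : ℂ → ℂ} (hf : AnalyticOnNhd ℂ f U)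
    (hKU : K ⊆ U) (hK : IsCompact K) (hord : ∀ z ∈ K, analyticOrderAt f z ≠ ⊤) :
    {z ∈ K | f z = 0}.Finite := by
  have h1 : ∀ z ∈ K, ∃ t ∈ 𝓝 z, t ∩ {z ∈ K | f z = 0} ⊆ {z} := by
    intro z hz
    rcases (hf z (hKU hz)).eventually_eq_zero_or_eventually_ne_zero with h | h
    · exact absurd (analyticOrderAt_eq_top.2 h) (hord z hz)
    · rw [eventually_nhdsWithin_iff] at h
      refine ⟨_, h, fun w hw => ?_⟩
      by_contra hne
      exact hw.1 hne hw.2.2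
  choose! t ht ht' using h1
  obtain ⟨s, hs, hcov⟩ := hK.elim_nhds_subcover t ht
  refine (s.finite_toSet).subset fun z hz => ?_
  obtain ⟨i, hi, hzi⟩ := mem_iUnion₂.1 (hcov hz.1)
  have := ht' i (hs i hi) ⟨hzi, hz⟩
  rw [mem_singleton_iff] at this
  rwa [this]

/-- The zeros of an analytic function on a compact set, with multiplicity. -/
theorem exists_zeroProd_factorization {U K : Set ℂ} {f : ℂ → ℂ} (hU : IsOpen U)
    (hf : AnalyticOnNhd ℂ f U) (hKU : K ⊆ U) (hK : IsCompact K)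
    (hord : ∀ z ∈ K, analyticOrderAt f z ≠ ⊤) :
    ∃ (Z : Multiset ℂ) (F : ℂ → ℂ), AnalyticOnNhd ℂ F U ∧
      (∀ z ∈ Z, z ∈ K) ∧ (∀ w ∈ U, f w = zeroProd Z w * F w) ∧ (∀ w ∈ K, F w ≠ 0) ∧
      ∀ z ∈ K, analyticOrderAt f z = (Z.count z : ℕ∞) := by
  obtain ⟨Z, F, hF, hZ, hfF, hF0⟩ := exists_zeroProd_factorization_aux hU hKU
    (finite_zeros_of_isCompact hf hKU hK hord).toFinset f hf hord
    fun z hz h => by simpa using ⟨hz, h⟩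
  refine ⟨Z, F, hF, hZ, hfF, hF0, fun z hz => ?_⟩
  have h1 : f =ᶠ[𝓝 z] zeroProd Z * F := by
    filter_upwards [hU.mem_nhds (hKU hz)] with w hw
    exact hfF w hw
  rw [analyticOrderAt_congr h1, analyticOrderAt_mul (analyticAt_zeroProd Z z) (hF z (hKU hz)),
    (hF z (hKU hz)).analyticOrderAt_eq_zero.2 (hF0 z hz), add_zero, analyticOrderAt_zeroProd]

theorem continuousOn_logDeriv {f : ℂ → ℂ} {U S : Set ℂ} (hf : AnalyticOnNhd ℂ f U) (hS : S ⊆ U)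
    (h0 : ∀ w ∈ S, f w ≠ 0) : ContinuousOn (logDeriv f) S := fun w hw =>
  (((hf w (hS hw)).deriv.continuousAt).div (hf w (hS hw)).continuousAt (h0 w hw)).continuousWithinAt

/-- Each linear factor contributes 1/(w - a) to the logarithmic derivative, hence 2πi to the
integral; the zero-free factor has a holomorphic logarithmic derivative and contributes nothing. -/
theorem circleIntegral_logDeriv_zeroProd_mul {U : Set ℂ} {F : ℂ → ℂ} {c : ℂ} {R : ℝ} (hR : 0 < R)
    (hKU : closedBall c R ⊆ U) (hF : AnalyticOnNhd ℂ F U) (hF0 : ∀ w ∈ closedBall c R, F w ≠ 0)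
    (Z : Multiset ℂ) (hZ : ∀ z ∈ Z, z ∈ ball c R) :
    (∮ w in C(c, R), logDeriv (fun w => zeroProd Z w * F w) w)
      = 2 * Real.pi * Complex.I * Multiset.card Z := by
  have hSK : sphere c R ⊆ closedBall c R := sphere_subset_closedBall
  induction Z using Multiset.induction with
  | empty =>
    have h1 : (fun w => zeroProd 0 w * F w) = F := by funext w; simp [zeroProd]
    rw [h1]
    have h2 : DiffContOnCl ℂ (logDeriv F) (ball c R) := by
      refine ⟨fun w hw => ?_, ?_⟩
      · have hw' := ball_subset_closedBall hw
        exact (((hF w (hKU hw')).deriv.differentiableAt).div (hF w (hKU hw')).differentiableAt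
          (hF0 w hw')).differentiableWithinAt
      · rw [closure_ball c hR.ne']
        exact continuousOn_logDeriv hF hKU hF0
    rw [h2.circleIntegral_eq_zero hR.le]
    simp
  | cons a Z ih =>
    have ha : a ∈ ball c R := hZ a (Multiset.mem_cons_self a Z)
    have hZ' : ∀ z ∈ Z, z ∈ ball c R := fun z hz => hZ z (Multiset.mem_cons_of_mem hz)
    have hne : ∀ w ∈ sphere c R, w - a ≠ 0 := by
      intro w hw h
      rw [sub_eq_zero.1 h] at hw
      exact absurd hw (by rw [mem_sphere]; exact (mem_ball.1 ha).ne)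
    have hne' : ∀ w ∈ sphere c R, zeroProd Z w * F w ≠ 0 := by
      intro w hw
      refine mul_ne_zero (zeroProd_ne_zero fun h => ?_) (hF0 w (hSK hw))
      exact absurd (mem_sphere.1 hw) (mem_ball.1 (hZ' w h)).ne
    have hGan : AnalyticOnNhd ℂ (fun w => zeroProd Z w * F w) U := fun w hw =>
      (analyticAt_zeroProd Z w).mul (hF w hw)
    have h1 : EqOn (logDeriv fun w => zeroProd (a ::ₘ Z) w * F w)
        (fun w => (w - a)⁻¹ + logDeriv (fun w => zeroProd Z w * F w) w) (sphere c R) := by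
      intro w hw
      have h2 : (fun w => zeroProd (a ::ₘ Z) w * F w)
          = fun w => (w - a) * (zeroProd Z w * F w) := by
        funext w; rw [zeroProd_cons, mul_assoc]
      rw [h2, logDeriv_mul w (hne w hw) (hne' w hw) (by fun_prop)
        (hGan w (hKU (hSK hw))).differentiableAt]
      congr 1
      simp [logDeriv_apply]
    rw [circleIntegral.integral_congr hR.le h1, circleIntegral.integral_add,
      circleIntegral.integral_sub_inv_of_mem_ball ha, ih hZ', Multiset.card_cons]
    · push_cast; ring
    · refine ContinuousOn.circleIntegrable hR.le ?_
      exact ContinuousOn.inv₀ (by fun_prop) hne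
    · exact (continuousOn_logDeriv hGan (hSK.trans hKU) hne').circleIntegrable hR.le

/-- Rouché's argument: on the circle f/h stays in the unit disc about 1, where the principal
logarithm is holomorphic, and log(f/h) is a primitive of the difference of the logarithmic
derivatives. -/
theorem circleIntegral_logDeriv_eq {U : Set ℂ} {f h : ℂ → ℂ} {c : ℂ} {R : ℝ} (hR : 0 < R)
    (hKU : closedBall c R ⊆ U) (hf : AnalyticOnNhd ℂ f U) (hh : AnalyticOnNhd ℂ h U)
    (hfh : ∀ w ∈ sphere c R, ‖f w - h w‖ < ‖h w‖) :
    (∮ w in C(c, R), logDeriv f w) = ∮ w in C(c, R), logDeriv h w := by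
  have hSU : sphere c R ⊆ U := sphere_subset_closedBall.trans hKU
  have hh0 : ∀ w ∈ sphere c R, h w ≠ 0 := fun w hw h0 => by
    have := hfh w hw
    rw [h0, norm_zero] at this
    exact absurd this (not_lt.2 (norm_nonneg _))
  have hf0 : ∀ w ∈ sphere c R, f w ≠ 0 := fun w hw h0 => by
    have := hfh w hw
    rw [h0, zero_sub, norm_neg] at this
    exact lt_irrefl _ this
  rw [← sub_eq_zero, ← circleIntegral.integral_sub
    ((continuousOn_logDeriv hf hSU hf0).circleIntegrable hR.le)
    ((continuousOn_logDeriv hh hSU hh0).circleIntegrable hR.le)]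
  refine circleIntegral.integral_eq_zero_of_hasDerivWithinAt (f := fun w => Complex.log (f w / h w))
    hR.le fun w hw => ?_
  have hslit : f w / h w ∈ Complex.slitPlane := by
    refine Complex.ball_one_subset_slitPlane ?_
    rw [mem_ball, dist_eq_norm, div_sub_one (hh0 w hw), norm_div,
      div_lt_one (norm_pos_iff.2 (hh0 w hw))]
    exact hfh w hw
  have h1 := (((hf w (hSU hw)).differentiableAt.hasDerivAt.div
    (hh w (hSU hw)).differentiableAt.hasDerivAt (hh0 w hw)).clog hslit)
  refine (h1.congr_deriv ?_).hasDerivWithinAt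
  have e1 := hh0 w hw
  have e2 := hf0 w hw
  rw [logDeriv_apply, logDeriv_apply]
  change _ / (f w / h w) = _
  field_simp

/-- A function close to `(z - c) ^ m * H z` on a circle has at least `m` zeros inside. -/
theorem le_card_zeros {U : Set ℂ} {f H : ℂ → ℂ} {c : ℂ} {R : ℝ} {m : ℕ} (hU : IsOpen U)
    (hR : 0 < R) (hKU : closedBall c R ⊆ U) (hf : AnalyticOnNhd ℂ f U) (hH : AnalyticOnNhd ℂ H U)
    (hfh : ∀ w ∈ sphere c R, ‖f w - (w - c) ^ m * H w‖ < ‖(w - c) ^ m * H w‖)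
    (hford : ∀ z ∈ closedBall c R, analyticOrderAt f z ≠ ⊤)
    (hHord : ∀ z ∈ closedBall c R, analyticOrderAt H z ≠ ⊤) :
    ∃ Z : Multiset ℂ, m ≤ Multiset.card Z ∧ (∀ z ∈ Z, z ∈ ball c R) ∧
      ∀ z ∈ ball c R, analyticOrderAt f z = (Z.count z : ℕ∞) := by
  obtain ⟨Z, F, hF, hZ, hfF, hF0, hcount⟩ :=
    exists_zeroProd_factorization hU hf hKU (isCompact_closedBall c R) hford
  obtain ⟨Z', G, hG, hZ', hHG, hG0, -⟩ :=
    exists_zeroProd_factorization hU hH hKU (isCompact_closedBall c R) hHord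
  have hSU : sphere c R ⊆ U := sphere_subset_closedBall.trans hKU
  have hball : ∀ z, z ∈ closedBall c R → (z ∈ sphere c R → False) → z ∈ ball c R := by
    intro z hz h
    rw [mem_ball]
    exact lt_of_le_of_ne (mem_closedBall.1 hz) h
  have hZb : ∀ z ∈ Z, z ∈ ball c R := fun z hz => hball z (hZ z hz) fun hs => by
    have h1 : f z = 0 := by
      rw [hfF z (hSU hs)]
      obtain ⟨Y, rfl⟩ := Multiset.exists_cons_of_mem hz
      rw [zeroProd_cons, sub_self, zero_mul, zero_mul]
    have := hfh z hs
    rw [h1, zero_sub, norm_neg] at this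
    exact lt_irrefl _ this
  have hZb' : ∀ z ∈ Multiset.replicate m c + Z', z ∈ ball c R := fun z hz => by
    rcases Multiset.mem_add.1 hz with hz | hz
    · rw [Multiset.eq_of_mem_replicate hz]; exact mem_ball_self hR
    · refine hball z (hZ' z hz) fun hs => ?_
      have h1 : H z = 0 := by
        rw [hHG z (hSU hs)]
        obtain ⟨Y, rfl⟩ := Multiset.exists_cons_of_mem hz
        rw [zeroProd_cons, sub_self, zero_mul, zero_mul]
      have := hfh z hs
      rw [h1, mul_zero, norm_zero] at this
      exact absurd this (not_lt.2 (norm_nonneg _))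
  have h1 := circleIntegral_logDeriv_zeroProd_mul hR hKU hF hF0 Z hZb
  have h2 := circleIntegral_logDeriv_zeroProd_mul hR hKU hG hG0 _ hZb'
  have hf' : AnalyticOnNhd ℂ (fun w => zeroProd Z w * F w) U := fun w hw =>
    (analyticAt_zeroProd Z w).mul (hF w hw)
  have hh' : AnalyticOnNhd ℂ (fun w => zeroProd (Multiset.replicate m c + Z') w * G w) U :=
    fun w hw => (analyticAt_zeroProd _ w).mul (hG w hw)
  have h3 := circleIntegral_logDeriv_eq hR hKU hf' hh' (fun w hw => by
    have := hfh w hw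
    rwa [hfF w (hSU hw), hHG w (hSU hw), ← mul_assoc, ← zeroProd_replicate, ← zeroProd_add] at this)
  rw [h1, h2] at h3
  have h4 : (Multiset.card Z : ℂ) = Multiset.card (Multiset.replicate m c + Z') := by
    have hpi : (2 * Real.pi * Complex.I : ℂ) ≠ 0 := Complex.two_pi_I_ne_zero
    exact mul_left_cancel₀ hpi h3
  have h5 : Multiset.card Z = Multiset.card (Multiset.replicate m c + Z') := by exact_mod_cast h4
  refine ⟨Z, ?_, hZb, fun z hz => hcount z (ball_subset_closedBall hz)⟩
  rw [h5, Multiset.card_add, Multiset.card_replicate]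
  omega

end zeros

/-! ### The two groups of zeros of the model function. -/

section zeroGroups
open Filter Topology Set Metric

/-- Quantitative form of the regularity of `a₁`, `a₂`, `μ` near `c`. -/
structure HasLocalBounds (a₁ a₂ μ : ℂ → ℂ) (c μ' : ℂ) (r K : ℝ) : Prop where
  pos : 0 < r
  one_le : 1 ≤ K
  lip₁ : ∀ z ∈ ball c r, ‖a₁ z - a₁ c‖ ≤ K * ‖z - c‖
  lip₂ : ∀ z ∈ ball c r, ‖a₂ z - a₂ c‖ ≤ K * ‖z - c‖
  lip : ∀ z ∈ ball c r, ‖μ z - μ c‖ ≤ K * ‖z - c‖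
  strict : ∀ z ∈ ball c r, ∀ w ∈ ball c r, ‖μ z - μ w - μ' * (z - w)‖ ≤ ‖μ'‖ / 24 * ‖z - w‖
  lower₁ : ∀ z ∈ ball c r, ‖a₁ c‖ / 2 ≤ ‖a₁ z‖
  upper₁ : ∀ z ∈ ball c r, ‖a₁ z‖ ≤ 2 * ‖a₁ c‖
  lower₂ : ∀ z ∈ ball c r, ‖a₂ c‖ / 2 ≤ ‖a₂ z‖
  upper₂ : ∀ z ∈ ball c r, ‖a₂ z‖ ≤ 2 * ‖a₂ c‖

theorem exists_hasLocalBounds {a₁ a₂ μ : ℂ → ℂ} {c : ℂ} (h₁ : AnalyticAt ℂ a₁ c)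
    (h₂ : AnalyticAt ℂ a₂ c) (hμ : AnalyticAt ℂ μ c) (h10 : a₁ c ≠ 0) (h20 : a₂ c ≠ 0)
    (hμ0 : deriv μ c ≠ 0) : ∃ r K : ℝ, HasLocalBounds a₁ a₂ μ c (deriv μ c) r K := by
  have hlip : ∀ f : ℂ → ℂ, AnalyticAt ℂ f c → ∃ K : ℝ, ∀ᶠ z in 𝓝 c, ‖f z - f c‖ ≤ K * ‖z - c‖ :=
    fun f hf => (hf.differentiableAt.hasDerivAt.isBigO_sub).bound
  have hnorm : ∀ f : ℂ → ℂ, AnalyticAt ℂ f c → f c ≠ 0 →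
      ∀ᶠ z in 𝓝 c, ‖f c‖ / 2 ≤ ‖f z‖ ∧ ‖f z‖ ≤ 2 * ‖f c‖ := by
    intro f hf h0
    have hp := norm_pos_iff.2 h0
    exact ((hf.continuousAt.norm.eventually (lt_mem_nhds (by linarith : ‖f c‖ / 2 < ‖f c‖))).and
      (hf.continuousAt.norm.eventually (gt_mem_nhds (by linarith : ‖f c‖ < 2 * ‖f c‖)))).mono
      fun z hz => ⟨hz.1.le, hz.2.le⟩
  obtain ⟨K₁, hK₁⟩ := hlip a₁ h₁
  obtain ⟨K₂, hK₂⟩ := hlip a₂ h₂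
  obtain ⟨K₃, hK₃⟩ := hlip μ hμ
  have hstrict : ∀ᶠ p : ℂ × ℂ in 𝓝 c ×ˢ 𝓝 c,
      ‖μ p.1 - μ p.2 - deriv μ c * (p.1 - p.2)‖ ≤ ‖deriv μ c‖ / 24 * ‖p.1 - p.2‖ := by
    have h1 := (hμ.hasStrictDerivAt.isLittleO).def (c := ‖deriv μ c‖ / 24)
      (by have := norm_pos_iff.2 hμ0; positivity)
    rw [nhds_prod_eq] at h1
    refine h1.mono fun p hp => ?_
    simpa [mul_comm] using hp
  obtain ⟨s, hs, hs'⟩ := (eventually_prod_self_iff (r := fun z w =>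
    ‖μ z - μ w - deriv μ c * (z - w)‖ ≤ ‖deriv μ c‖ / 24 * ‖z - w‖)).1 hstrict
  obtain ⟨r, hr, hball⟩ := Metric.eventually_nhds_iff_ball.1 (((hK₁.and (hK₂.and hK₃)).and
    ((hnorm a₁ h₁ h10).and (hnorm a₂ h₂ h20))).and hs)
  refine ⟨r, 1 + |K₁| + |K₂| + |K₃|, hr, by linarith [abs_nonneg K₁, abs_nonneg K₂, abs_nonneg K₃],
    fun z hz => ?_, fun z hz => ?_, fun z hz => ?_, fun z hz w hw => ?_,
    fun z hz => (hball z hz).1.2.1.1, fun z hz => (hball z hz).1.2.1.2,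
    fun z hz => (hball z hz).1.2.2.1, fun z hz => (hball z hz).1.2.2.2⟩
  · refine (hball z hz).1.1.1.trans ?_
    gcongr
    linarith [le_abs_self K₁, abs_nonneg K₂, abs_nonneg K₃]
  · refine (hball z hz).1.1.2.1.trans ?_
    gcongr
    linarith [le_abs_self K₂, abs_nonneg K₁, abs_nonneg K₃]
  · refine (hball z hz).1.1.2.2.trans ?_
    gcongr
    linarith [le_abs_self K₃, abs_nonneg K₁, abs_nonneg K₂]
  · exact hs' z (hball z hz).2 w (hball w hw).2

namespace HasLocalBounds
variable {a₁ a₂ μ : ℂ → ℂ} {c μ' : ℂ} {r K : ℝ}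

/-- Strict differentiability with nonzero derivative makes μ injective with Lipschitz inverse; this
carries distances between values of μ back to the spectral plane. -/
theorem norm_sub_le (h : HasLocalBounds a₁ a₂ μ c μ' r K) (hμ' : μ' ≠ 0) {z w : ℂ}
    (hz : z ∈ ball c r) (hw : w ∈ ball c r) : ‖z - w‖ ≤ 2 / ‖μ'‖ * ‖μ z - μ w‖ := by
  have h1 := h.strict z hz w hw
  have hp := norm_pos_iff.2 hμ'
  have h2 : ‖μ'‖ * ‖z - w‖ ≤ ‖μ z - μ w‖ + ‖μ z - μ w - μ' * (z - w)‖ := by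
    rw [← norm_mul]
    calc ‖μ' * (z - w)‖ = ‖(μ z - μ w) - (μ z - μ w - μ' * (z - w))‖ := by congr 1; ring
      _ ≤ _ := _root_.norm_sub_le _ _
  rw [div_mul_eq_mul_div, le_div_iff₀ hp]
  nlinarith [norm_nonneg (z - w), mul_nonneg hp.le (norm_nonneg (z - w))]

/-- The exponential varies on the scale 1/X, so its linear term dominates the variation. The errors
are the quadratic remainder of the exponential, the product of two increments, the increments of a₁
and a₂, and the nonlinearity of μ. -/
theorem norm_linear_remainder_le (h : HasLocalBounds a₁ a₂ μ c μ' r K) {γ : ℂ} (hγ : ‖γ‖ = 1)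
    {X : ℝ} (hX : 0 ≤ X) (hc : (μ c).re = 0) {z : ℂ} (hz : z ∈ ball c r)
    (hKX : K * (X * ‖z - c‖) ≤ 1) :
    ‖(Complex.exp (μ z * X) * a₁ z - γ * a₂ z) - (Complex.exp (μ c * X) * a₁ c - γ * a₂ c)
        - Complex.exp (μ c * X) * a₁ c * μ' * X * (z - c)‖
      ≤ (2 * ‖a₁ c‖ * K ^ 2 * (X * ‖z - c‖) * X + K ^ 2 * ‖z - c‖ * X + 2 * K
        + ‖a₁ c‖ * ‖μ'‖ / 24 * X) * ‖z - c‖ := by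
  have hK0 : 0 ≤ K := zero_le_one.trans h.one_le
  set e := Complex.exp (μ c * X) with he
  have hen : ‖e‖ = 1 := by rw [he, norm_cexp_mul_ofReal, hc, zero_mul, Real.exp_zero]
  set w := (μ z - μ c) * X with hw
  have hwn : ‖w‖ ≤ K * (X * ‖z - c‖) := by
    rw [hw, norm_mul, Complex.norm_real, Real.norm_of_nonneg hX]
    nlinarith [h.lip z hz]
  have hez : Complex.exp (μ z * X) = e * Complex.exp w := by
    rw [he, hw, ← Complex.exp_add]; congr 1; ring
  have hrem := Complex.norm_exp_sub_one_sub_id_le (hwn.trans hKX)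
  have key : (Complex.exp (μ z * X) * a₁ z - γ * a₂ z) - (e * a₁ c - γ * a₂ c)
      - e * a₁ c * μ' * X * (z - c)
      = e * ((Complex.exp w - 1 - w) * a₁ z) + e * (w * (a₁ z - a₁ c)) + e * (a₁ z - a₁ c)
        + e * (a₁ c * X * (μ z - μ c - μ' * (z - c))) - γ * (a₂ z - a₂ c) := by
    rw [hez, hw]; ring
  rw [key]
  have b1 : ‖e * ((Complex.exp w - 1 - w) * a₁ z)‖
      ≤ (K * (X * ‖z - c‖)) ^ 2 * (2 * ‖a₁ c‖) := by
    rw [norm_mul, hen, one_mul, norm_mul]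
    gcongr
    · exact hrem.trans (by gcongr)
    · exact h.upper₁ z hz
  have b2 : ‖e * (w * (a₁ z - a₁ c))‖ ≤ K * (X * ‖z - c‖) * (K * ‖z - c‖) := by
    rw [norm_mul, hen, one_mul, norm_mul]
    gcongr
    exact h.lip₁ z hz
  have b3 : ‖e * (a₁ z - a₁ c)‖ ≤ K * ‖z - c‖ := by
    rw [norm_mul, hen, one_mul]; exact h.lip₁ z hz
  have b4 : ‖e * (a₁ c * X * (μ z - μ c - μ' * (z - c)))‖
      ≤ ‖a₁ c‖ * X * (‖μ'‖ / 24 * ‖z - c‖) := by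
    rw [norm_mul, hen, one_mul, norm_mul, norm_mul, Complex.norm_real, Real.norm_of_nonneg hX]
    gcongr
    exact h.strict z hz c (mem_ball_self h.pos)
  have b5 : ‖γ * (a₂ z - a₂ c)‖ ≤ K * ‖z - c‖ := by
    rw [norm_mul, hγ, one_mul]; exact h.lip₂ z hz
  refine (_root_.norm_sub_le _ _).trans ((add_le_add ((norm_add_le _ _).trans (add_le_add
    ((norm_add_le _ _).trans (add_le_add ((norm_add_le _ _).trans (add_le_add b1 b2)) b3)) b4))
    b5).trans (le_of_eq (by ring)))

/-- On one of the circles of radius `ρ` and `3 ρ` the linearly varying factor is bounded below. -/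
theorem exists_circle (h : HasLocalBounds a₁ a₂ μ c μ' r K) {γ : ℂ} (hγ : ‖γ‖ = 1) {X ρ : ℝ}
    (hX : 1 ≤ X) (hρ : 0 < ρ) (hc : (μ c).re = 0) (h3 : 3 * ρ < r) (hKX : K * (X * (3 * ρ)) ≤ 1)
    (hs₁ : 2 * ‖a₁ c‖ * K ^ 2 * (X * (3 * ρ)) ≤ ‖a₁ c‖ * ‖μ'‖ / 24)
    (hs₂ : K ^ 2 * (3 * ρ) ≤ ‖a₁ c‖ * ‖μ'‖ / 24)
    (hs₃ : 2 * K ≤ ‖a₁ c‖ * ‖μ'‖ / 24 * X) :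
    ∃ R, ρ ≤ R ∧ R ≤ 3 * ρ ∧ ∀ z ∈ sphere c R,
      ‖a₁ c‖ * ‖μ'‖ * X * ρ / 2 ≤ ‖Complex.exp (μ z * X) * a₁ z - γ * a₂ z‖ := by
  have hK0 : 0 ≤ K := zero_le_one.trans h.one_le
  have hX0 : 0 ≤ X := by linarith
  set Λ := ‖a₁ c‖ * ‖μ'‖ with hΛ
  have hΛ0 : 0 ≤ Λ := by positivity
  set H₀ := Complex.exp (μ c * X) * a₁ c - γ * a₂ c with hH₀
  -- Four error terms of relative size 1/24 add up to one sixth of the linear term.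
  have hrem : ∀ z, ‖z - c‖ ≤ 3 * ρ →
      ‖(Complex.exp (μ z * X) * a₁ z - γ * a₂ z) - H₀
        - Complex.exp (μ c * X) * a₁ c * μ' * X * (z - c)‖ ≤ Λ * X / 6 * ‖z - c‖ := by
    intro z hz
    refine (h.norm_linear_remainder_le hγ hX0 hc
      (by rw [mem_ball, dist_eq_norm]; linarith) (le_trans (by gcongr) hKX)).trans ?_
    have e1 : 2 * ‖a₁ c‖ * K ^ 2 * (X * ‖z - c‖) * X ≤ Λ / 24 * X := by
      gcongr; exact le_trans (by gcongr) hs₁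
    have e2 : K ^ 2 * ‖z - c‖ * X ≤ Λ / 24 * X := by
      gcongr; exact le_trans (by gcongr) hs₂
    gcongr
    linarith
  have hlin : ∀ z, ‖Complex.exp (μ c * X) * a₁ c * μ' * X * (z - c)‖ = Λ * X * ‖z - c‖ := by
    intro z
    rw [norm_mul, norm_mul, norm_mul, norm_mul, norm_cexp_mul_ofReal, hc, zero_mul, Real.exp_zero,
      one_mul, Complex.norm_real, Real.norm_of_nonneg hX0]
  have hΛXρ : 0 ≤ Λ * X * ρ := by positivity
  -- In units of ΛXρ: if the constant term is at most 2, the linear term 3 on the large circle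
  -- leaves 3 - 2 - 1/2; if it is at least 2, the small circle leaves 2 - 1 - 1/6. Both are at least
  -- 1/2.
  rcases le_total ‖H₀‖ (2 * (Λ * X * ρ)) with hle | hle
  · refine ⟨3 * ρ, by linarith, le_rfl, fun z hz => ?_⟩
    have hzn : ‖z - c‖ = 3 * ρ := by rw [← dist_eq_norm]; exact hz
    have h1 := hrem z hzn.le
    have h2 := hlin z
    rw [hzn] at h1 h2
    set Y := Complex.exp (μ z * X) * a₁ z - γ * a₂ z
    set l := Complex.exp (μ c * X) * a₁ c * μ' * X * (z - c)
    have h3 : ‖l‖ ≤ ‖Y‖ + ‖H₀‖ + ‖Y - H₀ - l‖ := by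
      calc ‖l‖ = ‖Y - H₀ - (Y - H₀ - l)‖ := by congr 1; ring
        _ ≤ _ := (_root_.norm_sub_le _ _).trans (by gcongr; exact _root_.norm_sub_le _ _)
    nlinarith
  · refine ⟨ρ, le_rfl, by linarith, fun z hz => ?_⟩
    have hzn : ‖z - c‖ = ρ := by rw [← dist_eq_norm]; exact hz
    have h1 := hrem z (by linarith)
    have h2 := hlin z
    rw [hzn] at h1 h2
    set Y := Complex.exp (μ z * X) * a₁ z - γ * a₂ z
    set l := Complex.exp (μ c * X) * a₁ c * μ' * X * (z - c)
    have h3 : ‖H₀‖ ≤ ‖Y‖ + ‖l‖ + ‖Y - H₀ - l‖ := by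
      calc ‖H₀‖ = ‖Y - l - (Y - H₀ - l)‖ := by congr 1; ring
        _ ≤ _ := (_root_.norm_sub_le _ _).trans (by gcongr; exact _root_.norm_sub_le _ _)
    nlinarith

/-- The bound for `|Re μ| X` at points where the two terms nearly balance. -/
noncomputable def rateBound (α β K : ℝ) : ℝ :=
  |Real.log (β / (8 * α))| + |Real.log (6 * β / α)| + K

/-- If the difference is small against |a₂|, the two terms have comparable moduli. This confines
|e^(μX)| between two positive constants, and logarithms confine Re μ X. -/
theorem abs_re_mul_le (h : HasLocalBounds a₁ a₂ μ c μ' r K) (h10 : a₁ c ≠ 0) (h20 : a₂ c ≠ 0)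
    {γ : ℂ} (hγ : ‖γ‖ = 1) {X : ℝ} {z : ℂ} (hz : z ∈ ball c r)
    (hH : ‖Complex.exp (μ z * X) * a₁ z - γ * a₂ z‖ ≤ ‖a₂ c‖ / 4) :
    |(μ z).re * X| ≤ rateBound ‖a₁ c‖ ‖a₂ c‖ K := by
  have hα := norm_pos_iff.2 h10
  have hβ := norm_pos_iff.2 h20
  set E := Real.exp ((μ z).re * X) with hE
  have hE0 : 0 < E := Real.exp_pos _
  have hen : ‖Complex.exp (μ z * X) * a₁ z‖ = E * ‖a₁ z‖ := by
    rw [norm_mul, norm_cexp_mul_ofReal]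
  have hgn : ‖γ * a₂ z‖ = ‖a₂ z‖ := by rw [norm_mul, hγ, one_mul]
  have h1 := norm_sub_norm_le (Complex.exp (μ z * X) * a₁ z) (γ * a₂ z)
  have h2 := norm_sub_norm_le (γ * a₂ z) (Complex.exp (μ z * X) * a₁ z)
  rw [norm_sub_rev] at h2
  rw [hen, hgn] at h1 h2
  have hup : E ≤ 6 * ‖a₂ c‖ / ‖a₁ c‖ := by
    rw [le_div_iff₀ hα]
    nlinarith [h.lower₁ z hz, h.upper₂ z hz]
  have hlow : ‖a₂ c‖ / (8 * ‖a₁ c‖) ≤ E := by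
    rw [div_le_iff₀ (by positivity)]
    nlinarith [h.upper₁ z hz, h.lower₂ z hz]
  have hlu : (μ z).re * X ≤ Real.log (6 * ‖a₂ c‖ / ‖a₁ c‖) := by
    rw [Real.le_log_iff_exp_le (by positivity)]; exact hup
  have hll : Real.log (‖a₂ c‖ / (8 * ‖a₁ c‖)) ≤ (μ z).re * X := by
    rw [Real.log_le_iff_le_exp (by positivity)]; exact hlow
  have hK := h.one_le
  rw [abs_le, rateBound]
  constructor
  · linarith [neg_abs_le (Real.log (‖a₂ c‖ / (8 * ‖a₁ c‖))),
      abs_nonneg (Real.log (6 * ‖a₂ c‖ / ‖a₁ c‖))]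
  · linarith [le_abs_self (Real.log (6 * ‖a₂ c‖ / ‖a₁ c‖)),
      abs_nonneg (Real.log (‖a₂ c‖ / (8 * ‖a₁ c‖)))]

/-- Points where `Re μ` is small lie close to the lattice on the arc. -/
theorem exists_latticeOnArc (h : HasLocalBounds a₁ a₂ μ c μ' r K) (hμ' : μ' ≠ 0) {lamj : ℝ → ℂ}
    {J : Set ℝ} {ks s X k B : ℝ} (hc : μ c = Complex.I * ks)
    (hs : ∀ κ, |κ - ks| < s → κ ∈ J ∧ μ (lamj κ) = Complex.I * κ ∧ lamj κ ∈ ball c r)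
    (hX : 0 < X) {z : ℂ} (hz : z ∈ ball c r) (hB : |(μ z).re * X| ≤ B)
    (hzs : Real.pi / X + K * ‖z - c‖ < s) :
    ∃ w ∈ latticeOnArc lamj J X k, dist z w ≤ 2 / ‖μ'‖ * (B + Real.pi) / X := by
  -- The lattice frequency nearest to Im μ(z); rounding to spacing 2π/X leaves an error of at most
  -- π/X.
  set p : ℤ := round (((μ z).im - k) * (X / (2 * Real.pi))) with hp
  set κ : ℝ := k + p * (2 * Real.pi / X) with hκ
  have hpi := Real.pi_pos
  have hκz : |κ - (μ z).im| ≤ Real.pi / X := by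
    have h1 := abs_sub_round (((μ z).im - k) * (X / (2 * Real.pi)))
    rw [← hp] at h1
    have h2 : κ - (μ z).im
        = -((((μ z).im - k) * (X / (2 * Real.pi)) - p) * (2 * Real.pi / X)) := by
      rw [hκ]; field_simp; ring
    rw [h2, abs_neg, abs_mul, abs_of_pos (by positivity : 0 < 2 * Real.pi / X)]
    calc _ ≤ 1 / 2 * (2 * Real.pi / X) := by gcongr
      _ = _ := by ring
  have him : |(μ z).im - ks| ≤ K * ‖z - c‖ := by
    have h1 := (Complex.abs_im_le_norm (μ z - μ c)).trans (h.lip z hz)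
    rw [hc] at h1
    simpa using h1
  have hκs : |κ - ks| < s := by
    calc |κ - ks| ≤ |κ - (μ z).im| + |(μ z).im - ks| := abs_sub_le _ _ _
      _ < s := by linarith
  obtain ⟨hJ, hμκ, hmem⟩ := hs κ hκs
  refine ⟨lamj κ, ⟨κ, hJ, ⟨p, hκ⟩, rfl⟩, ?_⟩
  rw [dist_eq_norm]
  refine (h.norm_sub_le hμ' hz hmem).trans ?_
  rw [mul_div_assoc]
  gcongr
  rw [hμκ, le_div_iff₀ hX]
  have h1 := Complex.norm_le_abs_re_add_abs_im (μ z - Complex.I * κ)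
  simp only [Complex.sub_re, Complex.sub_im, Complex.mul_re, Complex.mul_im, Complex.I_re,
    Complex.I_im, Complex.ofReal_re, Complex.ofReal_im, zero_mul, mul_zero, one_mul, sub_zero,
    zero_add, sub_self] at h1
  have h2 : |(μ z).re| * X ≤ B := by
    rwa [abs_mul, abs_of_pos hX] at hB
  have h3 : |(μ z).im - κ| * X ≤ Real.pi := by
    rw [abs_sub_comm]; exact (le_div_iff₀ hX).1 hκz
  nlinarith

end HasLocalBounds

theorem analyticOrderAt_ne_top_of_ne_zero {f : ℂ → ℂ} {U : Set ℂ} (hf : AnalyticOnNhd ℂ f U)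
    (hU : IsPreconnected U) {w : ℂ} (hw : w ∈ U) (hfw : f w ≠ 0) {z : ℂ} (hz : z ∈ U) :
    analyticOrderAt f z ≠ ⊤ := fun h =>
  hfw (hf.eqOn_zero_of_preconnected_of_eventuallyEq_zero hU hz (analyticOrderAt_eq_top.1 h) hw)

theorem tendsto_pow_mul_exp_neg_mul (j : ℕ) {b : ℝ} (hb : 0 < b) :
    Tendsto (fun x : ℝ => x ^ j * Real.exp (-b * x)) atTop (𝓝 0) := by
  have := tendsto_rpow_mul_exp_neg_mul_atTop_nhds_zero j b hb
  simpa using this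

set_option maxHeartbeats 1000000 in
/-- The zeros of a small perturbation of
`(z - c) ^ m * (exp (μ z * X) * a₁ z - exp (I k X) * a₂ z)` near `c`. -/
theorem exists_zero_groups {c : ℂ} {ks r₀ : ℝ} {a₁ a₂ μ : ℂ → ℂ} {lamj : ℝ → ℂ} {J : Set ℝ} (m : ℕ)
    (hr₀ : 0 < r₀) (h₁ : AnalyticOnNhd ℂ a₁ (ball c r₀)) (h₂ : AnalyticOnNhd ℂ a₂ (ball c r₀))
    (hμ : AnalyticOnNhd ℂ μ (ball c r₀)) (h10 : a₁ c ≠ 0) (h20 : a₂ c ≠ 0) (hμ0 : deriv μ c ≠ 0)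
    (hc : μ c = Complex.I * ks) (hJ : ∀ᶠ κ in 𝓝 ks, κ ∈ J ∧ μ (lamj κ) = Complex.I * κ)
    (hlamj : Tendsto lamj (𝓝 ks) (𝓝 c)) :
    ∃ C₁ : ℝ, 0 < C₁ ∧ ∀ C : ℝ, 0 < C → ∀ η : ℝ, 0 < η → ∀ Q : ℝ, 0 ≤ Q → ∀ r : ℝ, 0 < r →
      r ≤ r₀ → ∃ X₀ : ℝ, 0 < X₀ ∧ ∀ X : ℝ, X₀ ≤ X → ∀ (k : ℝ) (f : ℂ → ℂ),
        AnalyticOnNhd ℂ f (ball c r) →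
        (∀ z ∈ ball c r, z ≠ c → ‖f z - (z - c) ^ m *
          (Complex.exp (μ z * X) * a₁ z - Complex.exp (Complex.I * k * X) * a₂ z)‖
            ≤ Q * (1 + ‖Complex.exp (μ z * X)‖) * Real.exp (-η * (X / 2))) →
        ∃ S T : Multiset ℂ, (∀ z ∈ S + T, z ∈ ball c (C / X)) ∧
          (∀ z ∈ ball c (C / X), analyticOrderAt f z = ((S + T).count z : ℕ∞)) ∧
          (∀ z ∈ S, ∃ w ∈ latticeOnArc lamj J X k, dist z w ≤ C₁ / X) ∧
          Multiset.card T = m ∧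
          ∀ z ∈ T, dist z c ≤ C₁ * Real.exp (-η * X / (2 * (m + 1))) := by
  classical
  have hc0 : c ∈ ball c r₀ := mem_ball_self hr₀
  obtain ⟨r₁, K, hb⟩ := exists_hasLocalBounds (h₁ c hc0) (h₂ c hc0) (hμ c hc0) h10 h20 hμ0
  have hα := norm_pos_iff.2 h10
  have hβ := norm_pos_iff.2 h20
  have hμ'p := norm_pos_iff.2 hμ0
  have hK0 : 0 < K := zero_lt_one.trans_le hb.one_le
  obtain ⟨s, hs0, hs⟩ := Metric.eventually_nhds_iff_ball.1
    (hJ.and (hlamj.eventually (isOpen_ball.mem_nhds (mem_ball_self hb.pos))))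
  have hs' : ∀ κ, |κ - ks| < s →
      κ ∈ J ∧ μ (lamj κ) = Complex.I * κ ∧ lamj κ ∈ ball c r₁ := fun κ hκ => by
    have := hs κ (by rwa [mem_ball, Real.dist_eq])
    exact ⟨this.1.1, this.1.2, this.2⟩
  set B := HasLocalBounds.rateBound ‖a₁ c‖ ‖a₂ c‖ K with hB
  have hBK : K ≤ B := by
    rw [hB, HasLocalBounds.rateBound]
    linarith [abs_nonneg (Real.log (‖a₂ c‖ / (8 * ‖a₁ c‖))),
      abs_nonneg (Real.log (6 * ‖a₂ c‖ / ‖a₁ c‖))]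
  have hpi := Real.pi_pos
  -- The first summand is the distance to the lattice on the arc, the 3 comes from the larger circle
  -- of radius 3ρ. Neither involves C, η or Q.
  refine ⟨2 / ‖deriv μ c‖ * (B + Real.pi) + 3, by
    have : 0 < B + Real.pi := by linarith
    positivity, ?_⟩
  set C₁ := 2 / ‖deriv μ c‖ * (B + Real.pi) with hC₁
  have hC₁0 : 0 ≤ C₁ := by
    have : 0 < B + Real.pi := by linarith
    positivity
  intro C hC η hη Q hQ r hr hrr₀
  -- Chosen so that ρ = e^(-bX) satisfies ρ^(m+1) = e^(-ηX/2): the m-fold zero together with the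
  -- linear factor then balances the error, and the slope of order X decides in favour of the main
  -- term.
  set b := η / (2 * (m + 1)) with hbdef
  have hb0 : 0 < b := by positivity
  set Λ := ‖a₁ c‖ * ‖deriv μ c‖ with hΛ
  have hΛ0 : 0 < Λ := by positivity
  set E₀ := Q * (1 + Real.exp (K * C)) with hE₀
  have hE₀0 : 0 ≤ E₀ := by positivity
  have hsmall : ∀ t : ℝ, 0 < t → ∀ᶠ X : ℝ in atTop, X * Real.exp (-b * X) < t := fun t ht => by
    have := tendsto_pow_mul_exp_neg_mul 1 hb0
    simp only [pow_one] at this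
    exact this.eventually (gt_mem_nhds ht)
  have hlarge : ∀ t : ℝ, ∀ᶠ X : ℝ in atTop, t < X := fun t => eventually_gt_atTop t
  have hpoly : ∀ᶠ X : ℝ in atTop, X ^ m * Real.exp (-(η / 2) * X) * E₀ < ‖a₂ c‖ / 4 := by
    have h1 := (tendsto_pow_mul_exp_neg_mul m (half_pos hη)).mul_const E₀
    rw [zero_mul] at h1
    exact h1.eventually (gt_mem_nhds (by positivity))
  obtain ⟨X₁, hX₁⟩ := eventually_atTop.1 ((((hlarge 1).and (hlarge (C / min r r₁))).and
    ((hlarge ((Real.pi + K * C) / s)).and (hlarge (2 * E₀ / Λ)))).and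
    (((hlarge (48 * K / Λ)).and (hpoly.and (hsmall (C / 3) (by positivity)))).and
    ((hsmall (1 / (3 * K)) (by positivity)).and ((hsmall (Λ / 24 / (6 * ‖a₁ c‖ * K ^ 2))
      (by positivity)).and (hsmall (Λ / 24 / (3 * K ^ 2)) (by positivity))))))
  refine ⟨max X₁ 1, by positivity, fun X hX k f hf hfe => ?_⟩
  obtain ⟨⟨⟨e1, e2⟩, e3, e4⟩, ⟨e5, e6, e7⟩, e8, e9, e10⟩ := hX₁ X ((le_max_left _ _).trans hX)
  have hX0 : 0 < X := by linarith
  set γ := Complex.exp (Complex.I * k * X) with hγdef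
  have hγ : ‖γ‖ = 1 := by
    rw [hγdef, Complex.norm_exp]; simp
  have hcre : (μ c).re = 0 := by rw [hc]; simp
  set ρ := Real.exp (-b * X) with hρ
  have hρ0 : 0 < ρ := Real.exp_pos _
  have hCX : C / X < min r r₁ := by
    rw [div_lt_iff₀ hX0]
    have := (div_lt_iff₀ (lt_min hr hb.pos)).1 e2
    linarith
  have hCr : C / X < r := hCX.trans_le (min_le_left _ _)
  have hCr₁ : C / X < r₁ := hCX.trans_le (min_le_right _ _)
  have h3ρ : 3 * ρ < C / X := by
    rw [lt_div_iff₀ hX0]; linarith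
  have hsub : ball c r ⊆ ball c r₀ := ball_subset_ball hrr₀
  have hexp : ∀ z, ‖z - c‖ ≤ C / X → ‖Complex.exp (μ z * X)‖ ≤ Real.exp (K * C) := by
    intro z hz
    have hzr : z ∈ ball c r₁ := by rw [mem_ball, dist_eq_norm]; linarith
    rw [norm_cexp_mul_ofReal, Real.exp_le_exp]
    have h1 := (Complex.re_le_norm (μ z - μ c)).trans (hb.lip z hzr)
    rw [Complex.sub_re, hcre, sub_zero] at h1
    have h2 : K * ‖z - c‖ ≤ K * (C / X) := by gcongr
    calc (μ z).re * X ≤ K * (C / X) * X := by gcongr; linarith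
      _ = K * C := by field_simp
  have herr : ∀ z, ‖z - c‖ ≤ C / X → z ≠ c → ‖f z - (z - c) ^ m *
      (Complex.exp (μ z * X) * a₁ z - γ * a₂ z)‖ ≤ E₀ * Real.exp (-η * (X / 2)) := by
    intro z hz hzc
    refine (hfe z (by rw [mem_ball, dist_eq_norm]; linarith) hzc).trans ?_
    rw [hE₀]
    gcongr
    exact hexp z hz
  obtain ⟨R, hR1, hR2, hRz⟩ := hb.exists_circle hγ (X := X) (ρ := ρ) e1.le hρ0 hcre (by linarith)
    (by
      have := (lt_div_iff₀ (by positivity)).1 e8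
      nlinarith)
    (by
      have := (lt_div_iff₀ (by positivity)).1 e9
      nlinarith)
    (by
      have := (lt_div_iff₀ (by positivity)).1 e10
      have h2 : ρ ≤ X * ρ := le_mul_of_one_le_left hρ0.le e1.le
      have h3 : ρ * (3 * K ^ 2) ≤ X * ρ * (3 * K ^ 2) := by gcongr
      nlinarith)
    (by
      have := (div_lt_iff₀ hΛ0).1 e5
      nlinarith)
  have hR0 : 0 < R := hρ0.trans_le hR1
  have hRr : closedBall c R ⊆ ball c r := closedBall_subset_ball (by linarith)
  have hpowρ : ρ ^ (m + 1) = Real.exp (-η * (X / 2)) := by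
    rw [hρ, ← Real.exp_nat_mul]
    congr 1
    rw [hbdef]
    push_cast
    field_simp
  have hHan : AnalyticOnNhd ℂ (fun z => Complex.exp (μ z * X) * a₁ z - γ * a₂ z) (ball c r) := by
    intro z hz
    have hz' := hsub hz
    exact ((((hμ z hz').mul analyticAt_const).cexp).mul (h₁ z hz')).sub
      (analyticAt_const.mul (h₂ z hz'))
  have hcirc : ∀ z ∈ sphere c R, ‖f z - (z - c) ^ m *
      (Complex.exp (μ z * X) * a₁ z - γ * a₂ z)‖
      < ‖(z - c) ^ m * (Complex.exp (μ z * X) * a₁ z - γ * a₂ z)‖ := by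
    intro z hz
    have hzR : ‖z - c‖ = R := by rw [← dist_eq_norm]; exact hz
    refine (herr z (by linarith) (by
      rintro rfl
      rw [sub_self, norm_zero] at hzR
      linarith)).trans_lt ?_
    have h1 := hRz z hz
    rw [norm_mul, norm_pow, hzR]
    calc E₀ * Real.exp (-η * (X / 2)) < (Λ * X / 2) * Real.exp (-η * (X / 2)) := by
          gcongr
          have := (div_lt_iff₀ hΛ0).1 e4
          linarith
      _ = ρ ^ m * (Λ * X * ρ / 2) := by rw [← hpowρ]; ring
      _ ≤ _ := by gcongr
  obtain ⟨w, hw⟩ : (sphere c R).Nonempty := NormedSpace.sphere_nonempty.2 hR0.le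
  have hwball : w ∈ ball c r := hRr (sphere_subset_closedBall hw)
  have hwne := hcirc w hw
  have hfw : f w ≠ 0 := fun h0 => by
    rw [h0, zero_sub, norm_neg] at hwne; exact lt_irrefl _ hwne
  have hHw : Complex.exp (μ w * X) * a₁ w - γ * a₂ w ≠ 0 := fun h0 => by
    rw [h0, mul_zero, norm_zero] at hwne
    exact absurd hwne (not_lt.2 (norm_nonneg _))
  have hpre : IsPreconnected (ball c r) := (convex_ball c r).isPreconnected
  have hford : ∀ z ∈ ball c r, analyticOrderAt f z ≠ ⊤ := fun z hz =>
    analyticOrderAt_ne_top_of_ne_zero hf hpre hwball hfw hz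
  obtain ⟨Z', hZ'card, hZ'mem, hZ'count⟩ := le_card_zeros (m := m) isOpen_ball hR0 hRr hf hHan hcirc
    (fun z hz => hford z (hRr hz))
    (fun z hz => analyticOrderAt_ne_top_of_ne_zero hHan hpre hwball hHw (hRr hz))
  have hKCr : closedBall c (C / X) ⊆ ball c r := closedBall_subset_ball hCr
  obtain ⟨Z, F, -, hZmem, hfF, -, hZcount⟩ := exists_zeroProd_factorization isOpen_ball hf hKCr
    (isCompact_closedBall c (C / X)) fun z hz => hford z (hKCr hz)
  -- The disc may contain more than m zeros, for instance one produced by the exponential factor.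
  -- Any m of them are taken; the others go to the first group, where the lattice estimate holds for
  -- every zero.
  obtain ⟨T, hTZ', hTcard⟩ : ∃ T ≤ Z', Multiset.card T = m := by
    obtain ⟨T, hT⟩ := Multiset.card_pos_iff_exists_mem.1
      (by rw [Multiset.card_powersetCard]; exact Nat.choose_pos hZ'card :
        0 < Multiset.card (Multiset.powersetCard m Z'))
    exact ⟨T, (Multiset.mem_powersetCard.1 hT).1, (Multiset.mem_powersetCard.1 hT).2⟩
  set Zb := Z.filter (· ∈ ball c (C / X)) with hZb
  have hTZ : T ≤ Zb := by
    refine hTZ'.trans (Multiset.le_iff_count.2 fun z => ?_)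
    by_cases hz : z ∈ ball c R
    · have hzC : z ∈ ball c (C / X) := ball_subset_ball (by linarith) hz
      rw [hZb, Multiset.count_filter_of_pos hzC]
      have h1 := hZ'count z hz
      rw [hZcount z (ball_subset_closedBall hzC)] at h1
      exact_mod_cast h1.ge
    · rw [Multiset.count_eq_zero_of_notMem fun h => hz (hZ'mem z h)]
      exact Nat.zero_le _
  have hST : Zb - T + T = Zb := Multiset.sub_add_cancel hTZ
  refine ⟨Zb - T, T, ?_, ?_, ?_, hTcard, ?_⟩
  · rw [hST]
    exact fun z hz => (Multiset.mem_filter.1 hz).2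
  · intro z hz
    rw [hST, hZb, Multiset.count_filter_of_pos hz]
    exact hZcount z (ball_subset_closedBall hz)
  · intro z hz
    have hzZ : z ∈ Zb := Multiset.mem_of_le (Multiset.sub_le_self _ _) hz
    obtain ⟨hzZ, hzb⟩ := Multiset.mem_filter.1 hzZ
    have hfz : f z = 0 := by
      rw [hfF z (hKCr (hZmem z hzZ))]
      obtain ⟨Y, rfl⟩ := Multiset.exists_cons_of_mem hzZ
      rw [zeroProd_cons, sub_self, zero_mul, zero_mul]
    have hzn : ‖z - c‖ < C / X := by rw [← dist_eq_norm]; exact hzb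
    have hzr₁ : z ∈ ball c r₁ := by rw [mem_ball, dist_eq_norm]; linarith
    have hre : |(μ z).re * X| ≤ B := by
      -- Within 1/X of c the Lipschitz bound of μ suffices, which is why K enters `rateBound`.
      -- Farther out, (z - c)^m may be divided out at the cost of X^m, which the exponentially small
      -- error tolerates.
      rcases le_or_gt ‖z - c‖ (1 / X) with hle | hgt
      · have h1 := (Complex.abs_re_le_norm (μ z - μ c)).trans (hb.lip z hzr₁)
        rw [Complex.sub_re, hcre, sub_zero] at h1
        rw [abs_mul, abs_of_pos hX0]
        calc |(μ z).re| * X ≤ (K * (1 / X)) * X := by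
              gcongr
              exact h1.trans (by gcongr)
          _ = K := by field_simp
          _ ≤ B := hBK
      · refine hb.abs_re_mul_le h10 h20 hγ hzr₁ ?_
        have hzc : z ≠ c := by
          rintro rfl
          rw [sub_self, norm_zero] at hgt
          have : 0 < 1 / X := by positivity
          linarith
        have h1 := herr z hzn.le hzc
        rw [hfz, zero_sub, norm_neg, norm_mul, norm_pow] at h1
        have h2 : (1 / X) ^ m * ‖Complex.exp (μ z * X) * a₁ z - γ * a₂ z‖
            ≤ E₀ * Real.exp (-η * (X / 2)) := le_trans (by gcongr) h1
        rw [one_div, inv_pow, inv_mul_le_iff₀ (by positivity)] at h2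
        refine h2.trans (le_trans (le_of_eq ?_) e6.le)
        have : -η * (X / 2) = -(η / 2) * X := by ring
        rw [this]; ring
    obtain ⟨w, hw, hdist⟩ := hb.exists_latticeOnArc (k := k) hμ0 hc hs' hX0 hzr₁ hre (by
      have h1 : K * ‖z - c‖ ≤ K * (C / X) := by gcongr
      have h2 : (Real.pi + K * C) / X < s := by
        rw [div_lt_iff₀ hX0]
        have := (div_lt_iff₀ hs0).1 e3
        linarith
      calc Real.pi / X + K * ‖z - c‖ ≤ Real.pi / X + K * (C / X) := by gcongr
        _ = (Real.pi + K * C) / X := by ring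
        _ < s := h2)
    refine ⟨w, hw, hdist.trans ?_⟩
    gcongr
    linarith
  · intro z hz
    have h1 := hZ'mem z (Multiset.mem_of_le hTZ' hz)
    rw [mem_ball] at h1
    have h2 : -η * X / (2 * ((m : ℝ) + 1)) = -b * X := by rw [hbdef]; ring
    rw [h2]
    nlinarith [mul_nonneg hC₁0 hρ0.le]

end zeroGroups

/-! ### Separation of the unstable, centre and stable parts. -/

section centerFrame
open NormedSpace Filter Topology Set Metric Module
variable {n : ℕ}

/-- The limiting matrix is a uniform limit of functions holomorphic in the parameter. -/
theorem differentiableOn_of_exponential_limit {A : ℝ → ℂ → Matrix (Fin n) (Fin n) ℂ}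
    {Ainf : ℂ → Matrix (Fin n) (Fin n) ℂ} {M K ν : ℝ} (hν : 0 < ν)
    (hA : ∀ x, DifferentiableOn ℂ (A x) (ball 0 M))
    (h : ∀ x : ℝ, ∀ z : ℂ, ‖z‖ < M → ‖A x z - Ainf z‖ ≤ K * Real.exp (-ν * |x|)) :
    DifferentiableOn ℂ Ainf (ball 0 M) := by
  have hlim : Tendsto (fun x : ℝ => K * Real.exp (-ν * |x|)) atTop (𝓝 0) := by
    simpa using (Real.tendsto_exp_atBot.comp
      (tendsto_abs_atTop_atTop.const_mul_atTop_of_neg (neg_lt_zero.2 hν))).const_mul K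
  have hu : TendstoUniformlyOn A Ainf atTop (ball 0 M) := by
    refine Metric.tendstoUniformlyOn_iff.2 ?_
    intro ε hε
    filter_upwards [hlim.eventually (gt_mem_nhds hε)] with x hx z hz
    rw [dist_comm, dist_eq_norm]
    exact (h x z (by simpa using hz)).trans_lt hx
  exact hu.tendstoLocallyUniformlyOn.differentiableOn (Eventually.of_forall hA) isOpen_ball

theorem mul_coordProj_comm_of_blockPart {ι : Type*} [DecidableEq ι] {col : Fin n → ι}
    {M : Matrix (Fin n) (Fin n) ℂ} (hM : blockPart col M = M) {J : Finset (Fin n)}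
    (hJ : ∀ i j, col i = col j → (i ∈ J ↔ j ∈ J)) : M * coordProj J = coordProj J * M := by
  ext i j
  rw [mul_coordProj_apply, coordProj_mul_apply, ← hM, blockPart_apply]
  by_cases hij : col i = col j
  · simp [hJ i j hij]
  · simp [hij]

theorem trace_mul_coordProj (M : Matrix (Fin n) (Fin n) ℂ) (J : Finset (Fin n)) :
    (M * coordProj J).trace = ∑ j ∈ J, M j j := by
  simp only [Matrix.trace, Matrix.diag_apply, mul_coordProj_apply]
  rw [Finset.sum_ite_mem, Finset.univ_inter]

/-- A block diagonalisation of `Ainf` near `lams` separating the unstable part, the simple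
eigenvalue near `i ks` and the stable part at `lams`. -/
structure IsCenterFrame (Ainf : ℂ → Matrix (Fin n) (Fin n) ℂ) (lams : ℂ) (ks g : ℝ)
    (T D : ℂ → Matrix (Fin n) (Fin n) ℂ) (ρ : Fin n → ℝ) (c : Fin n) (r b : ℝ) : Prop where
  pos : 0 < r
  isUnit_det : ∀ z ∈ ball lams r, IsUnit (T z).det
  conj_eq : ∀ z ∈ ball lams r, (T z)⁻¹ * Ainf z * T z = D z
  norm_le : ∀ z ∈ ball lams r, ‖T z‖ ≤ b
  norm_inv_le : ∀ z ∈ ball lams r, ‖(T z)⁻¹‖ ≤ b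
  differentiableOn : DifferentiableOn ℂ D (ball lams r)
  comm_unstable : ∀ z, D z * coordProj (Finset.univ.filter (0 < ρ ·))
    = coordProj (Finset.univ.filter (0 < ρ ·)) * D z
  comm_centerUnstable : ∀ z, D z * coordProj (Finset.univ.filter (0 ≤ ρ ·))
    = coordProj (Finset.univ.filter (0 ≤ ρ ·)) * D z
  rate_center : ρ c = 0
  le_abs_rate : ∀ j, j ≠ c → g ≤ |ρ j|
  growth : ∀ δ > 0, ∃ C : ℝ, 1 ≤ C ∧ ∀ t : ℝ, 0 ≤ t → ∀ i j,
    ‖exp (t • D lams) i j‖ ≤ C * Real.exp ((ρ j + δ) * t)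
  growth_neg : ∀ δ > 0, ∃ C : ℝ, 1 ≤ C ∧ ∀ t : ℝ, 0 ≤ t → ∀ i j,
    ‖exp (t • (-D lams)) i j‖ ≤ C * Real.exp ((-ρ j + δ) * t)
  center_eq : D lams c c = Complex.I * ks
  eq_center : ∀ z ∈ ball lams r, ∀ s : ℂ, ‖s - Complex.I * ks‖ < r → s ∈ spectrum ℂ (Ainf z) →
    s = D z c c

theorem exists_eigenvector_of_mem_spectrum {B : Matrix (Fin n) (Fin n) ℂ} {s : ℂ}
    (hs : s ∈ spectrum ℂ B) : ∃ v : Fin n → ℂ, v ≠ 0 ∧ B.mulVec v = s • v := by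
  rw [← Matrix.spectrum_toLin', ← End.hasEigenvalue_iff_mem_spectrum] at hs
  obtain ⟨v, hv⟩ := hs.exists_hasEigenvector
  exact ⟨v, hv.2, by simpa using hv.apply_eq_smul⟩

/-- An eigenvalue isolated in its own coordinate is the only one nearby. -/
theorem eventually_eq_of_eigenvector {D : ℂ → Matrix (Fin n) (Fin n) ℂ} {z₀ s₀ : ℂ} {c : Fin n}
    (hD : ContinuousAt D z₀) (hrow : ∀ z j, j ≠ c → D z c j = 0) (hc : D z₀ c c = s₀)
    (hker : ∀ w : Fin n → ℂ, (D z₀).mulVec w = s₀ • w → w c = 0 → w = 0) :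
    ∀ᶠ p : ℂ × ℂ in 𝓝 (z₀, s₀), ∀ w : Fin n → ℂ, w ≠ 0 → (D p.1).mulVec w = p.2 • w →
      p.2 = D p.1 c c := by
  have hcomp : ∀ z (w : Fin n → ℂ), (D z).mulVec w c = D z c c * w c := fun z w => by
    simp only [Matrix.mulVec, dotProduct]
    exact Finset.sum_eq_single c (fun j _ hj => by rw [hrow z j hj, zero_mul]) (by simp)
  -- Subtracting the unit entry at (c, c) removes the kernel of D z₀ - s₀, so N is invertible at the
  -- base point and hence nearby. An eigenvector whose eigenvalue is not the (c, c) entry has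
  -- vanishing component c and would lie in the kernel of N.
  set N : ℂ × ℂ → Matrix (Fin n) (Fin n) ℂ :=
    fun p => D p.1 - p.2 • 1 - Matrix.single c c (1 : ℂ) with hN
  have hNv : ∀ p (w : Fin n → ℂ), (N p).mulVec w
      = (D p.1).mulVec w - p.2 • w - Pi.single c (w c) := fun p w => by
    rw [hN]
    simp only [Matrix.sub_mulVec, Matrix.smul_mulVec, Matrix.one_mulVec]
    congr 1
    ext i
    by_cases hi : i = c
    · subst hi; simp [Matrix.mulVec, dotProduct, Matrix.single_apply]
    · simp [Matrix.mulVec, dotProduct, hi, Ne.symm hi]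
  have hdet0 : (N (z₀, s₀)).det ≠ 0 := by
    intro h
    obtain ⟨w, hw0, hw⟩ := Matrix.exists_mulVec_eq_zero_iff.2 h
    rw [hNv] at hw
    have h1 := congrFun hw c
    simp only [Pi.sub_apply, Pi.smul_apply, Pi.single_eq_same, Pi.zero_apply, hcomp, hc,
      smul_eq_mul, sub_self, zero_sub, neg_eq_zero] at h1
    rw [h1, Pi.single_zero, sub_zero, sub_eq_zero] at hw
    exact hw0 (hker w hw h1)
  have hNc : ContinuousAt N (z₀, s₀) := by
    have h1 : ContinuousAt (fun p : ℂ × ℂ => D p.1) (z₀, s₀) :=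
      ContinuousAt.comp (f := Prod.fst) (g := D) hD continuousAt_fst
    have h2 : ContinuousAt (fun p : ℂ × ℂ => p.2 • (1 : Matrix (Fin n) (Fin n) ℂ)) (z₀, s₀) :=
      continuousAt_snd.smul continuousAt_const
    exact (h1.sub h2).sub continuousAt_const
  have hdetc : ContinuousAt (fun p => (N p).det) (z₀, s₀) :=
    (contDiff_det (m := Fin n) (N := 0)).continuous.continuousAt.comp hNc
  filter_upwards [hdetc.eventually_ne hdet0] with p hp w hw0 hw
  by_contra hne
  have hwc : w c = 0 := by
    have h1 := congrFun hw c
    rw [hcomp, Pi.smul_apply, smul_eq_mul, ← sub_eq_zero, ← sub_mul] at h1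
    exact (mul_eq_zero.1 h1).resolve_left (sub_ne_zero.2 (Ne.symm hne))
  refine hp (Matrix.exists_mulVec_eq_zero_iff.1 ⟨w, hw0, ?_⟩)
  rw [hNv, hw, hwc, Pi.single_zero, sub_zero, sub_self]

/-- Take a basis of generalised eigenvectors at `lams` and colour the indices by the sign of the
real part; by simplicity and the gap the colour zero belongs to `c` alone. A matrix commuting with
the limiting one cannot link different colours, so the block diagonalisation extends to nearby
parameters, and the one-by-one centre block is the continued eigenvalue. -/
theorem exists_isCenterFrame {Ainf : ℂ → Matrix (Fin n) (Fin n) ℂ} {lams : ℂ} {ks g : ℝ}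
    (hg : 0 < g) (hA : ∀ᶠ z in 𝓝 lams, DifferentiableAt ℂ Ainf z)
    (hsimple : (Ainf lams).charpoly.rootMultiplicity (Complex.I * ks) = 1)
    (hgap : ∀ μ ∈ spectrum ℂ (Ainf lams), μ ≠ Complex.I * ks → g ≤ |μ.re|) :
    ∃ T D ρ c r b, IsCenterFrame Ainf lams ks g T D ρ c r b := by
  obtain ⟨T₀, μ, hT₀, hcol, hinv, hmult⟩ := exists_spectral_basis (Ainf lams)
  have hTT : T₀ * T₀⁻¹ = 1 := Matrix.mul_nonsing_inv _ hT₀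
  have hTT' : T₀⁻¹ * T₀ = 1 := Matrix.nonsing_inv_mul _ hT₀
  have hone := hmult (Complex.I * ks)
  rw [hsimple, Finset.card_eq_one] at hone
  obtain ⟨c, hc⟩ := hone
  have hmemc : ∀ j, μ j = Complex.I * ks ↔ j = c := fun j => by
    have := Finset.ext_iff.1 hc j
    simpa using this
  have hμc : μ c = Complex.I * ks := (hmemc c).2 rfl
  have hspec : ∀ j, μ j ∈ spectrum ℂ (Ainf lams) := by
    intro j
    by_contra h
    have h1 := hcol j
    rw [maxGenEigenspace_eq_bot_of_notMem _ _ h, Submodule.mem_bot] at h1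
    exact hT₀.ne_zero (Matrix.det_eq_zero_of_column_eq_zero j fun i => congrFun h1 i)
  set ρ : Fin n → ℝ := fun j => (μ j).re with hρ
  have hρc : ρ c = 0 := by simp [hρ, hμc]
  have hρj : ∀ j, j ≠ c → g ≤ |ρ j| := fun j hj => hgap _ (hspec j) fun h => hj ((hmemc j).1 h)
  set col : Fin n → SignType := fun j => SignType.sign (ρ j) with hcoldef
  have hcolc : ∀ j, col c = col j → j = c := by
    intro j hj
    by_contra hne
    have h1 := hρj j hne
    simp only [hcoldef, hρc, sign_zero] at hj
    rw [sign_eq_zero_iff.1 hj.symm, abs_zero] at h1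
    linarith
  have hpos_iff : ∀ i j, col i = col j → (0 < ρ i ↔ 0 < ρ j) := fun i j hij => by
    rw [← sign_eq_one_iff, ← sign_eq_one_iff]
    exact Eq.congr_left hij
  have hneg_iff : ∀ i j, col i = col j → (ρ i < 0 ↔ ρ j < 0) := fun i j hij => by
    rw [← sign_eq_neg_one_iff, ← sign_eq_neg_one_iff]
    exact Eq.congr_left hij
  set B : ℂ → Matrix (Fin n) (Fin n) ℂ := fun z => T₀⁻¹ * Ainf z * T₀ with hB
  have hBd : ContDiffAt ℂ 1 B lams := by
    have h1 : ∀ᶠ z in 𝓝 lams, DifferentiableAt ℂ B z := hA.mono fun z hz =>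
      (hz.const_mul T₀⁻¹).mul_const T₀
    have h2 : AnalyticAt ℂ B lams := Complex.analyticAt_iff_eventually_differentiableAt.2 h1
    exact h2.contDiffAt
  have hzero : ∀ h, h * B lams = B lams * h → ∀ i j, μ i ≠ μ j → h i j = 0 := fun h hh i j hij =>
    apply_eq_zero_of_commute hT₀ hcol hinv hh hij
  have hblock : ∀ h, h * B lams = B lams * h → blockPart col h = h := by
    intro h hh
    ext i j
    rw [blockPart_apply]
    split_ifs with hij
    · rfl
    · exact (hzero h hh i j fun he => hij (by simp only [hcoldef, hρ, he])).symm
  obtain ⟨H, D, hHc, hH0, hDs, hD0, hDb, hconj⟩ :=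
    exists_block_diagonalization col hBd (hblock _ rfl) hblock
  set T : ℂ → Matrix (Fin n) (Fin n) ℂ := fun z => T₀ * (1 + H z) with hT
  have hTc : ContinuousAt T lams := continuousAt_const.mul (continuousAt_const.add hHc)
  have hTl : T lams = T₀ := by simp [hT, hH0]
  have hTinv : ContinuousAt (fun z => (T z)⁻¹) lams := by
    have h1 : ContinuousAt (fun M : Matrix (Fin n) (Fin n) ℂ => M⁻¹) (T lams) := by
      rw [hTl]
      obtain ⟨u, hu⟩ := (Matrix.isUnit_iff_isUnit_det T₀).2 hT₀
      have h2 := NormedRing.inverse_continuousAt u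
      rw [hu] at h2
      refine h2.congr (Eventually.of_forall fun M => ?_)
      exact (Matrix.nonsing_inv_eq_ringInverse M).symm
    exact ContinuousAt.comp (g := fun M : Matrix (Fin n) (Fin n) ℂ => M⁻¹) h1 hTc
  have hDdiff : ∀ᶠ z in 𝓝 lams, DifferentiableAt ℂ D z :=
    (hDs.eventually (by simp)).mono fun z hz => hz.differentiableAt one_ne_zero
  have hDrow : ∀ z j, j ≠ c → D z c j = 0 := fun z j hj => by
    rw [← hDb z, blockPart_apply, if_neg fun h => hj (hcolc j h)]
  have hBl : B lams = T₀⁻¹ * Ainf lams * T₀ := rfl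
  have hDcol : ∀ i, i ≠ c → D lams i c = 0 := fun i hi => by
    rw [hD0]
    exact hzero _ rfl i c fun h => hi ((hmemc i).1 (h.trans hμc))
  have hcenter : D lams c c = Complex.I * ks := by
    set v : Fin n → ℂ := fun i => T₀ i c with hv
    have hv0 : v ≠ 0 := fun h =>
      hT₀.ne_zero (Matrix.det_eq_zero_of_column_eq_zero c fun i => congrFun h i)
    have hAv : (Ainf lams).mulVec v = D lams c c • v := by
      have h1 : Ainf lams * T₀ = T₀ * D lams := by
        rw [hD0, hBl, ← mul_assoc, ← mul_assoc, hTT, one_mul]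
      funext i
      have h2 : (Ainf lams).mulVec v i = (Ainf lams * T₀) i c := by
        rw [Matrix.mul_apply]; rfl
      rw [h2, h1, Matrix.mul_apply, Finset.sum_eq_single c
        (fun j _ hj => by rw [hDcol j hj, mul_zero]) (by simp), Pi.smul_apply, smul_eq_mul, mul_comm]
    obtain ⟨k, hk⟩ := (End.mem_maxGenEigenspace _ _ _).1 (hcol c)
    have hpow : ∀ k : ℕ, ((Matrix.toLin' (Ainf lams) - μ c • (1 : End ℂ (Fin n → ℂ))) ^ k) v
        = (D lams c c - μ c) ^ k • v := by
      intro k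
      induction k with
      | zero => simp
      | succ k ih =>
        rw [pow_succ', End.mul_apply, ih, map_smul, LinearMap.sub_apply, Matrix.toLin'_apply, hAv,
          LinearMap.smul_apply, End.one_apply, ← sub_smul, smul_smul, ← pow_succ]
    rw [hpow k, smul_eq_zero] at hk
    rw [← hμc]
    exact sub_eq_zero.1 (eq_zero_of_pow_eq_zero (hk.resolve_right hv0))
  have hker : ∀ w : Fin n → ℂ, (D lams).mulVec w = (Complex.I * ks) • w → w c = 0 → w = 0 := by
    intro w hw hwc
    have h1 : (Ainf lams).mulVec (T₀.mulVec w) = (Complex.I * ks) • T₀.mulVec w := by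
      have h2 : Ainf lams * T₀ = T₀ * D lams := by
        rw [hD0, hBl, ← mul_assoc, ← mul_assoc, hTT, one_mul]
      rw [Matrix.mulVec_mulVec, h2, ← Matrix.mulVec_mulVec, hw, Matrix.mulVec_smul]
    have h3 : T₀.mulVec w ∈ End.maxGenEigenspace (Matrix.toLin' (Ainf lams)) (Complex.I * ks) := by
      rw [End.mem_maxGenEigenspace]
      refine ⟨1, ?_⟩
      rw [pow_one, LinearMap.sub_apply, Matrix.toLin'_apply, h1]
      simp
    funext i
    by_cases hi : i = c
    · rw [hi, hwc]; rfl
    · have h4 := hinv _ _ h3 i fun h => hi ((hmemc i).1 h)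
      rw [Matrix.mulVec_mulVec, hTT', Matrix.one_mulVec] at h4
      exact h4
  have hiso := eventually_eq_of_eigenvector hDs.continuousAt hDrow hcenter hker
  obtain ⟨r₁, hr₁, hiso'⟩ := Metric.eventually_nhds_iff_ball.1 hiso
  obtain ⟨r₂, hr₂, hall⟩ := Metric.eventually_nhds_iff_ball.1 ((hconj.and hDdiff).and
    ((hTc.norm.eventually (gt_mem_nhds (lt_add_one ‖T lams‖))).and
    (hTinv.norm.eventually (gt_mem_nhds (lt_add_one ‖(T lams)⁻¹‖)))))
  have hsub : ball lams (min r₁ r₂) ⊆ ball lams r₂ := ball_subset_ball (min_le_right _ _)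
  have hTu : ∀ z ∈ ball lams r₂, IsUnit (T z).det := fun z hz => by
    rw [hT]
    simp only [Matrix.det_mul]
    exact hT₀.mul ((Matrix.isUnit_iff_isUnit_det _).1 (hall z hz).1.1.1)
  have hconj' : ∀ z ∈ ball lams r₂, (T z)⁻¹ * Ainf z * T z = D z := fun z hz => by
    have h1 := (hall z hz).1.1.2
    have h2 : Ainf z * T z = T z * D z := by
      calc Ainf z * T z = (T₀ * T₀⁻¹) * Ainf z * (T₀ * (1 + H z)) := by rw [hTT, one_mul]
        _ = T₀ * (B z * (1 + H z)) := by rw [hB]; noncomm_ring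
        _ = _ := by rw [h1, hT, mul_assoc]
    rw [mul_assoc, h2, ← mul_assoc, Matrix.nonsing_inv_mul _ (hTu z hz), one_mul]
  refine ⟨T, D, ρ, c, min r₁ r₂, max (‖T lams‖ + 1) (‖(T lams)⁻¹‖ + 1), lt_min hr₁ hr₂,
    fun z hz => hTu z (hsub hz), fun z hz => hconj' z (hsub hz),
    fun z hz => (hall z (hsub hz)).2.1.le.trans (le_max_left _ _),
    fun z hz => (hall z (hsub hz)).2.2.le.trans (le_max_right _ _),
    fun z hz => (hall z (hsub hz)).1.2.differentiableWithinAt,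
    fun z => mul_coordProj_comm_of_blockPart (hDb z) fun i j hij => ?_,
    fun z => mul_coordProj_comm_of_blockPart (hDb z) fun i j hij => ?_, hρc, hρj,
    fun δ hδ => ?_, fun δ hδ => ?_, hcenter, fun z hz s hs hsp => ?_⟩
  · simpa using hpos_iff i j hij
  · simpa using not_congr (hneg_iff i j hij)
  · rw [hD0, hBl]
    exact exists_norm_exp_apply_le hT₀ (ρ := fun j => ρ j + δ) fun j =>
      exists_norm_exp_mulVec_le _ (μ j) (by simp only [hρ]; linarith) (hcol j)
  · have : -D lams = T₀⁻¹ * (-Ainf lams) * T₀ := by rw [hD0, hBl]; noncomm_ring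
    rw [this]
    exact exists_norm_exp_apply_le hT₀ (ρ := fun j => -ρ j + δ) fun j =>
      exists_norm_exp_mulVec_le _ (-μ j) (by simp only [hρ, Complex.neg_re]; linarith)
        (mem_maxGenEigenspace_neg (hcol j))
  · obtain ⟨v, hv0, hv⟩ := exists_eigenvector_of_mem_spectrum hsp
    have hz2 := hsub hz
    refine hiso' (z, s) ?_ ((T z)⁻¹.mulVec v) (fun h => hv0 ?_) ?_
    · rw [mem_ball, Prod.dist_eq, max_lt_iff]
      exact ⟨(mem_ball.1 hz).trans_le (min_le_left _ _), by
        rw [dist_eq_norm]; exact hs.trans_le (min_le_left _ _)⟩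
    · have h1 := congrArg (T z).mulVec h
      rwa [Matrix.mulVec_mulVec, Matrix.mul_nonsing_inv _ (hTu z hz2), Matrix.one_mulVec,
        Matrix.mulVec_zero] at h1
    · change (D z).mulVec _ = _
      rw [← hconj' z hz2, Matrix.mulVec_mulVec, mul_assoc, Matrix.mul_nonsing_inv _ (hTu z hz2),
        mul_one, ← Matrix.mulVec_mulVec, hv, Matrix.mulVec_smul]

end centerFrame

/-! ### The periodic Evans function near the embedded eigenvalue. -/

section localEstimate
open NormedSpace Filter Topology Set Metric
variable {n : ℕ}

/-- The determinant does not depend on the choice of the conjugators. -/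
theorem det_conjugator_unique {D : Matrix (Fin n) (Fin n) ℂ} {J : Finset (Fin n)} {σ : ℂ} {C g : ℝ}
    (h : IsDominantMinor J.card D σ (minorProj J.card J) C g) (hg : 0 < g)
    {A Φ Pm Pp Pm' Pp' : ℝ → Matrix (Fin n) (Fin n) ℂ} (hA : Continuous A)
    (hΦ : IsFundamentalMatrix A Φ) (hPm : IsConjugator A D (Iic 0) Pm)
    (hPp : IsConjugator A D (Ici 0) Pp) (hPm' : IsConjugator A D (Iic 0) Pm')
    (hPp' : IsConjugator A D (Ici 0) Pp') :
    (Pm 0 * coordProj J + Pp 0 * coordProj Jᶜ).det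
      = (Pm' 0 * coordProj J + Pp' 0 * coordProj Jᶜ).det := by
  -- The determinant is composed of three limits along one and the same fundamental matrix, and
  -- limits are unique.
  have h1 := tendsto_nhds_unique (h.tendsto_right hg hPp hA hΦ) (h.tendsto_right hg hPp' hA hΦ)
  have h2 := tendsto_nhds_unique (h.tendsto_left hg hPm hA hΦ) (h.tendsto_left hg hPm' hA hΦ)
  have h3 := tendsto_nhds_unique (hPp.tendsto_scaledDet hA hΦ) (hPp'.tendsto_scaledDet hA hΦ)
  have h4 := trace_compound_mul_minorProj (k := J.card) J (Pm := Pm 0) (hPp.isUnit_det_Ici hA hΦ)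
  have h5 := trace_compound_mul_minorProj (k := J.card) J (Pm := Pm' 0) (hPp'.isUnit_det_Ici hA hΦ)
  rw [h1, h2, h5, if_pos rfl, if_pos rfl, h3] at h4
  exact (mul_right_cancel₀ (inv_ne_zero (hPp'.isUnit_det_Ici hA hΦ).ne_zero) h4).symm

theorem IsFundamentalMatrix.conj {A Psi : ℝ → Matrix (Fin n) (Fin n) ℂ}
    (h : IsFundamentalMatrix A Psi) {T : Matrix (Fin n) (Fin n) ℂ} (hT : IsUnit T.det) :
    IsFundamentalMatrix (fun x => T⁻¹ * A x * T) fun x => T⁻¹ * Psi x * T := by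
  have hTT : T * T⁻¹ = 1 := Matrix.mul_nonsing_inv _ hT
  refine ⟨by simp only [h.1]; rw [mul_one, Matrix.nonsing_inv_mul _ hT], fun x => ?_⟩
  refine (((h.2 x).const_mul T⁻¹).mul_const T).congr_deriv ?_
  calc T⁻¹ * (A x * Psi x) * T = T⁻¹ * A x * 1 * Psi x * T := by noncomm_ring
    _ = _ := by rw [← hTT]; noncomm_ring

theorem IsFundamentalMatrix.eq_inv_mul {A Psi : ℝ → Matrix (Fin n) (Fin n) ℂ}
    (h : IsFundamentalMatrix A Psi) (hA : Continuous A) {X : ℝ} (hX : ∀ x, A (x + X) = A x) :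
    Psi X = (Psi (-(X / 2)))⁻¹ * Psi (X / 2) := by
  have h1 := h.add_period hA hX (-(X / 2))
  rw [show -(X / 2) + X = X / 2 by ring] at h1
  rw [h1, ← mul_assoc, h.inv_mul_cancel hA, one_mul]

namespace IsCenterFrame
variable {Ainf : ℂ → Matrix (Fin n) (Fin n) ℂ} {lams : ℂ} {ks g : ℝ}
  {T D : ℂ → Matrix (Fin n) (Fin n) ℂ} {ρ : Fin n → ℝ} {c : Fin n} {r b : ℝ}

theorem centerUnstable_eq (hg : 0 < g) (h : IsCenterFrame Ainf lams ks g T D ρ c r b) :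
    Finset.univ.filter (0 ≤ ρ ·) = insert c (Finset.univ.filter (0 < ρ ·)) := by
  ext j
  simp only [Finset.mem_filter, Finset.mem_univ, true_and, Finset.mem_insert]
  constructor
  · intro hj
    by_cases hjc : j = c
    · exact Or.inl hjc
    · have := h.le_abs_rate j hjc
      rw [abs_of_nonneg hj] at this
      exact Or.inr (hg.trans_le this)
  · rintro (rfl | hj)
    · exact h.rate_center.ge
    · exact hj.le

theorem center_notMem (h : IsCenterFrame Ainf lams ks g T D ρ c r b) :
    c ∉ Finset.univ.filter (0 < ρ ·) := by simp [h.rate_center]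

theorem card_centerUnstable (hg : 0 < g) (h : IsCenterFrame Ainf lams ks g T D ρ c r b) :
    (Finset.univ.filter (0 ≤ ρ ·)).card = (Finset.univ.filter (0 < ρ ·)).card + 1 := by
  rw [h.centerUnstable_eq hg, Finset.card_insert_of_notMem h.center_notMem]

theorem trace_sub_trace (hg : 0 < g) (h : IsCenterFrame Ainf lams ks g T D ρ c r b) (z : ℂ) :
    D z c c = (D z * coordProj (Finset.univ.filter (0 ≤ ρ ·))).trace
      - (D z * coordProj (Finset.univ.filter (0 < ρ ·))).trace := by
  rw [trace_mul_coordProj, trace_mul_coordProj, h.centerUnstable_eq hg,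
    Finset.sum_insert h.center_notMem, add_sub_cancel_right]

/-- Any other set of indices has a total rate smaller by the gap. -/
theorem sum_rate_le (hg : 0 < g) (h : IsCenterFrame Ainf lams ks g T D ρ c r b)
    (K : Finset (Fin n)) (hU : K ≠ Finset.univ.filter (0 < ρ ·))
    (hV : K ≠ Finset.univ.filter (0 ≤ ρ ·)) :
    ∑ j ∈ K, ρ j ≤ ∑ j ∈ Finset.univ.filter (0 < ρ ·), ρ j - g := by
  set U := Finset.univ.filter (0 < ρ ·) with hUdef
  have hmemU : ∀ j, j ∈ U ↔ 0 < ρ j := fun j => by simp [hUdef]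
  have hout : ∀ j, j ∉ U → ρ j ≤ 0 := fun j hj => not_lt.1 fun h0 => hj ((hmemU j).2 h0)
  have h1 := Finset.sum_sdiff_sub_sum_sdiff (s₁ := K) (s₂ := U) (f := ρ)
  have hs1 : 0 ≤ ∑ j ∈ U \ K, ρ j := Finset.sum_nonneg fun j hj =>
    ((hmemU j).1 (Finset.mem_sdiff.1 hj).1).le
  have hs2 : ∑ j ∈ K \ U, ρ j ≤ 0 := Finset.sum_nonpos fun j hj =>
    hout j (Finset.mem_sdiff.1 hj).2
  -- Either K contains a non-centre index outside U, of rate at most -g, or it misses an index of U,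
  -- of rate at least g.
  by_cases hUK : U ⊆ K
  · obtain ⟨j, hjK, hjU, hjc⟩ : ∃ j ∈ K, j ∉ U ∧ j ≠ c := by
      by_contra hcon
      push Not at hcon
      by_cases hcK : c ∈ K
      · apply hV
        rw [h.centerUnstable_eq hg, ← hUdef]
        ext j
        rw [Finset.mem_insert]
        refine ⟨fun hj => ?_, ?_⟩
        · by_cases hjU : j ∈ U
          · exact Or.inr hjU
          · exact Or.inl (hcon j hj hjU)
        · rintro (rfl | hj)
          · exact hcK
          · exact hUK hj
      · apply hU
        ext j
        refine ⟨fun hj => ?_, fun hj => hUK hj⟩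
        by_contra hjU
        exact hcK (hcon j hj hjU ▸ hj)
    have h2 := h.le_abs_rate j hjc
    rw [abs_of_nonpos (hout j hjU)] at h2
    have h3 : ∑ i ∈ K \ U, ρ i ≤ ρ j := by
      have hj : j ∈ K \ U := Finset.mem_sdiff.2 ⟨hjK, hjU⟩
      rw [← Finset.add_sum_erase _ _ hj]
      have : ∑ i ∈ (K \ U).erase j, ρ i ≤ 0 := Finset.sum_nonpos fun i hi =>
        hout i (Finset.mem_sdiff.1 (Finset.mem_of_mem_erase hi)).2
      linarith
    linarith
  · obtain ⟨j, hjU, hjK⟩ := Finset.not_subset.1 hUK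
    have hjc : j ≠ c := fun hc => h.center_notMem (hc ▸ hjU)
    have h2 := h.le_abs_rate j hjc
    rw [abs_of_pos ((hmemU j).1 hjU)] at h2
    have h3 : ρ j ≤ ∑ i ∈ U \ K, ρ i := Finset.single_le_sum (f := ρ)
      (fun i hi => ((hmemU i).1 (Finset.mem_sdiff.1 hi).1).le) (Finset.mem_sdiff.2 ⟨hjU, hjK⟩)
    linarith

theorem continuousAt (h : IsCenterFrame Ainf lams ks g T D ρ c r b) : ContinuousAt D lams :=
  (h.differentiableOn.differentiableAt (isOpen_ball.mem_nhds (mem_ball_self h.pos))).continuousAt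

/-- The index set carrying the dominant minor of size `k`. -/
noncomputable def domSet (ρ : Fin n → ℝ) (k : ℕ) : Finset (Fin n) :=
  if k = (Finset.univ.filter (0 < ρ ·)).card + 1 then Finset.univ.filter (0 ≤ ρ ·)
  else Finset.univ.filter (0 < ρ ·)

/-- The unstable and the centre-unstable index sets have the same total rate at `lams`, since the
centre rate is zero, but different cardinalities. In each exterior power at most one of them occurs,
and all other sets lag behind by the gap. -/
theorem eventually_dominant (hg : 0 < g) (h : IsCenterFrame Ainf lams ks g T D ρ c r b) {g' : ℝ}
    (hgg : g' < g) (k : ℕ) : ∃ C : ℝ, ∀ᶠ z in 𝓝 lams, IsDominantMinor k (D z)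
      (D z * coordProj (domSet ρ k)).trace (minorProj k (domSet ρ k)) C g' := by
  have hVU : ∑ j ∈ Finset.univ.filter (0 ≤ ρ ·), ρ j = ∑ j ∈ Finset.univ.filter (0 < ρ ·), ρ j := by
    rw [h.centerUnstable_eq hg, Finset.sum_insert h.center_notMem, h.rate_center, zero_add]
  have hsum : ∑ j ∈ domSet ρ k, ρ j = ∑ j ∈ Finset.univ.filter (0 < ρ ·), ρ j := by
    unfold domSet
    split_ifs
    · exact hVU
    · rfl
  refine eventually_isDominantMinor hgg h.continuousAt (fun z => ?_) h.growth h.growth_neg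
    fun K hK hKJ => ?_
  · unfold domSet
    split_ifs
    · exact h.comm_centerUnstable z
    · exact h.comm_unstable z
  · rw [hsum]
    have hcard := h.card_centerUnstable hg
    refine h.sum_rate_le hg K (fun hKU => ?_) fun hKV => ?_
    · apply hKJ
      have hk : k ≠ (Finset.univ.filter (0 < ρ ·)).card + 1 := by rw [← hK, ← hKU]; omega
      rw [domSet, if_neg hk, hKU]
    · apply hKJ
      have hk : k = (Finset.univ.filter (0 < ρ ·)).card + 1 := by rw [← hK, hKV, hcard]
      rw [domSet, if_pos hk, hKV]

/-- At `lams` the centre rate is 0 and all others are at least g in modulus; a neighbourhood costs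
g/4. Hence the abscissae -g/2 and g/2 still separate the spectrum, with the centre direction counted
as unstable and as stable respectively. -/
theorem eventually_splitting (hg : 0 < g) (h : IsCenterFrame Ainf lams ks g T D ρ c r b) :
    ∃ C : ℝ, ∀ᶠ z in 𝓝 lams, ∀ t : ℝ, 0 ≤ t →
      ‖exp (t • D z) * coordProj (Finset.univ.filter (0 ≤ ρ ·))ᶜ‖
        ≤ C * Real.exp (-(3 / 4 * g) * t) ∧
      ‖exp (t • (-D z)) * coordProj (Finset.univ.filter (0 ≤ ρ ·))‖
        ≤ C * Real.exp (1 / 4 * g * t) ∧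
      ‖exp (t • D z) * coordProj (Finset.univ.filter (0 < ρ ·))ᶜ‖
        ≤ C * Real.exp (1 / 4 * g * t) ∧
      ‖exp (t • (-D z)) * coordProj (Finset.univ.filter (0 < ρ ·))‖
        ≤ C * Real.exp (-(3 / 4 * g) * t) := by
  have hcompl : ∀ {J : Finset (Fin n)} {M : Matrix (Fin n) (Fin n) ℂ},
      M * coordProj J = coordProj J * M → M * coordProj Jᶜ = coordProj Jᶜ * M := fun h => by
    rw [coordProj_compl, mul_sub, sub_mul, h, mul_one, one_mul]
  have hneg : ∀ {J : Finset (Fin n)} {M : Matrix (Fin n) (Fin n) ℂ},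
      M * coordProj J = coordProj J * M → -M * coordProj J = coordProj J * -M := fun h => by
    rw [neg_mul, mul_neg, h]
  have hge : ∀ j, 0 < ρ j → g ≤ ρ j := fun j hj => by
    have := h.le_abs_rate j (by rintro rfl; exact hj.ne' h.rate_center)
    rwa [abs_of_pos hj] at this
  have hle : ∀ j, ρ j < 0 → ρ j ≤ -g := fun j hj => by
    have := h.le_abs_rate j (by rintro rfl; exact hj.ne h.rate_center)
    rw [abs_of_neg hj] at this
    linarith
  obtain ⟨C₁, h₁⟩ := eventually_norm_exp_mul_coordProj_le
    (J := (Finset.univ.filter (0 ≤ ρ ·))ᶜ) (b := -g) (b' := -(3 / 4 * g)) (by linarith)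
    h.continuousAt (fun z => hcompl (h.comm_centerUnstable z)) h.growth
    (fun j hj => hle j (by simpa using hj))
  obtain ⟨C₂, h₂⟩ := eventually_norm_exp_mul_coordProj_le (D := fun z => -D z) (ρ := fun j => -ρ j)
    (J := Finset.univ.filter (0 ≤ ρ ·)) (b := 0) (b' := 1 / 4 * g) (by linarith)
    h.continuousAt.neg (fun z => hneg (h.comm_centerUnstable z)) h.growth_neg
    (fun j hj => by have : 0 ≤ ρ j := by simpa using hj
                    linarith)
  obtain ⟨C₃, h₃⟩ := eventually_norm_exp_mul_coordProj_le
    (J := (Finset.univ.filter (0 < ρ ·))ᶜ) (b := 0) (b' := 1 / 4 * g) (by linarith)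
    h.continuousAt (fun z => hcompl (h.comm_unstable z)) h.growth
    (fun j hj => by simpa using hj)
  obtain ⟨C₄, h₄⟩ := eventually_norm_exp_mul_coordProj_le (D := fun z => -D z) (ρ := fun j => -ρ j)
    (J := Finset.univ.filter (0 < ρ ·)) (b := -g) (b' := -(3 / 4 * g)) (by linarith)
    h.continuousAt.neg (fun z => hneg (h.comm_unstable z)) h.growth_neg
    (fun j hj => by have := hge j (by simpa using hj)
                    linarith)
  refine ⟨|C₁| + |C₂| + |C₃| + |C₄|, ?_⟩
  have a1 := abs_nonneg C₁
  have a2 := abs_nonneg C₂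
  have a3 := abs_nonneg C₃
  have a4 := abs_nonneg C₄
  have b1 := le_abs_self C₁
  have b2 := le_abs_self C₂
  have b3 := le_abs_self C₃
  have b4 := le_abs_self C₄
  filter_upwards [h₁, h₂, h₃, h₄] with z z1 z2 z3 z4 t ht
  refine ⟨(z1 t ht).trans ?_, (z2 t ht).trans ?_, (z3 t ht).trans ?_, (z4 t ht).trans ?_⟩ <;>
    gcongr <;> linarith

/-- Asymptotics of the periodic Evans function near the eigenvalue, off the eigenvalue itself. -/
theorem exists_evans_estimate (hg : 0 < g) (h : IsCenterFrame Ainf lams ks g T D ρ c r b)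
    {A₀ : ℝ → ℂ → Matrix (Fin n) (Fin n) ℂ} {K ν θ η M : ℝ} (hη : 0 < η)
    (hη' : η < min (min θ ν) g)
    (hA₀ : ∀ z, ‖z‖ < M → Continuous fun x => A₀ x z) (hM : ‖lams‖ < M)
    (H2 : ∀ x : ℝ, ∀ z : ℂ, ‖z‖ < M → ‖A₀ x z - Ainf z‖ ≤ K * Real.exp (-ν * |x|)) :
    ∃ Q : ℝ, 0 ≤ Q ∧ ∀ᶠ z in 𝓝 lams, ∀ d₁ d₂ : ℂ,
      IsHomoclinicEvansValue (fun x => A₀ x z) (Ainf z) (-(g / 2)) d₁ →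
      IsHomoclinicEvansValue (fun x => A₀ x z) (Ainf z) (g / 2) d₂ →
      ∀ (A : ℝ → Matrix (Fin n) (Fin n) ℂ) (X : ℝ) (γ : ℂ), Continuous A → 0 < X →
      (∀ x, A (x + X) = A x) →
      (∀ x, |x| ≤ X / 2 → ‖A x - A₀ x z‖ ≤ K * Real.exp (-θ * X / 2)) → ‖γ‖ = 1 →
      ‖(solutionOperator A X - γ • (1 : Matrix (Fin n) (Fin n) ℂ)).det
          * (Complex.exp (-(D z * coordProj (Finset.univ.filter (0 < ρ ·))).trace * X)
          * ((-γ) ^ (n - ((Finset.univ.filter (0 < ρ ·)).card + 1)))⁻¹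
          * (Complex.exp (-(Ainf z).trace * (X / 2)) * (solutionOperator A (X / 2)).det)⁻¹)
        - (Complex.exp (D z c c * X) * d₁ - γ * d₂)‖
        ≤ Q * (1 + ‖Complex.exp (D z c c * X)‖) * (1 + ‖d₁‖ + ‖d₂‖) * Real.exp (-η * (X / 2)) := by
  set U := Finset.univ.filter (0 < ρ ·) with hU
  set V := Finset.univ.filter (0 ≤ ρ ·) with hV
  set u := U.card with hu
  have hVcard : V.card = u + 1 := h.card_centerUnstable hg
  have hun : u + 1 ≤ n := by
    rw [← hVcard]
    exact (Finset.card_le_univ V).trans (Fintype.card_fin n).le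
  have hηg : η < g := hη'.trans_le (min_le_right _ _)
  set κ := min θ ν with hκ
  have hηκ : η < κ := hη'.trans_le (min_le_left _ _)
  -- An intermediate gap: dominance is stable near `lams` for any gap below g, and the decay rate η
  -- must stay below that gap.
  set g' := (η + g) / 2 with hg'
  have hηg' : η < g' := by rw [hg']; linarith
  have hg'g : g' < g := by rw [hg']; linarith
  choose C hC using fun k => h.eventually_dominant hg hg'g k
  obtain ⟨C', hC'⟩ := h.eventually_splitting hg
  have hK : 0 ≤ K := by
    have := (norm_nonneg _).trans (H2 0 lams hM)
    simpa using this
  have hb : 0 ≤ b := (norm_nonneg _).trans (h.norm_le lams (mem_ball_self h.pos))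
  -- Conjugation by T costs b on either side, and 2K bounds the sum of the deviations of the
  -- periodic from the homoclinic system and of the latter from its limit.
  obtain ⟨Q, hQ, HQ⟩ := exists_evans_asymptotics (n := n) u hun C (b * (2 * K) * b) κ g' η
    (by positivity) hηκ hηg' hη
  refine ⟨Q, hQ, ?_⟩
  have hdomev : ∀ᶠ z in 𝓝 lams, ∀ k ∈ Finset.range (n + 1), IsDominantMinor k (D z)
      (D z * coordProj (domSet ρ k)).trace (minorProj k (domSet ρ k)) (C k) g' :=
    (Filter.eventually_all_finset _).2 fun k _ => hC k
  have hMev : ∀ᶠ z in 𝓝 lams, ‖z‖ < M := continuous_norm.continuousAt.eventually (gt_mem_nhds hM)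
  filter_upwards [hdomev, hMev, hC', isOpen_ball.mem_nhds (mem_ball_self h.pos)] with z hdom hzM hspl hzr
  intro d₁ d₂ hd₁ hd₂ A X γ hA hX hper hH3 hγ
  have hT := h.isUnit_det z hzr
  have hconj := h.conj_eq z hzr
  have hTT : T z * (T z)⁻¹ = 1 := Matrix.mul_nonsing_inv _ hT
  have hTT' : (T z)⁻¹ * T z = 1 := Matrix.nonsing_inv_mul _ hT
  set Ξ : ℝ → Matrix (Fin n) (Fin n) ℂ := fun x => (T z)⁻¹ * (A x - Ainf z) * T z with hΞ
  set Ω : ℝ → Matrix (Fin n) (Fin n) ℂ := fun x => (T z)⁻¹ * (A₀ x z - Ainf z) * T z with hΩ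
  have hA₀c := hA₀ z hzM
  have hΞc : Continuous Ξ := (continuous_const.mul (hA.sub continuous_const)).mul continuous_const
  have hΩc : Continuous Ω := (continuous_const.mul (hA₀c.sub continuous_const)).mul continuous_const
  have hΞe : (fun x => (T z)⁻¹ * A x * T z) = fun x => D z + Ξ x := by
    funext x; rw [hΞ, ← hconj]; noncomm_ring
  have hΩe : (fun x => (T z)⁻¹ * A₀ x z * T z) = fun x => D z + Ω x := by
    funext x; rw [hΩ, ← hconj]; noncomm_ring
  set Ψ := solutionOperator A with hΨdef
  have hΨ : IsFundamentalMatrix A Ψ := isFundamentalMatrix_solutionOperator hA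
  have hΨ₀ := isFundamentalMatrix_solutionOperator hA₀c
  have hΦ := hΨ.conj hT
  have hΦ₀ := hΨ₀.conj hT
  rw [hΞe] at hΦ
  rw [hΩe] at hΦ₀
  set Φ : ℝ → Matrix (Fin n) (Fin n) ℂ := fun x => (T z)⁻¹ * Ψ x * T z with hΦdef
  set Φ₀ : ℝ → Matrix (Fin n) (Fin n) ℂ :=
    fun x => (T z)⁻¹ * solutionOperator (fun x => A₀ x z) x * T z with hΦ₀def
  have hΩcc : Continuous fun x => D z + Ω x := continuous_const.add hΩc
  have hcommU : ((T z)⁻¹ * Ainf z * T z) * coordProj U = coordProj U * ((T z)⁻¹ * Ainf z * T z) := by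
    rw [hconj]; exact h.comm_unstable z
  have hcommV : ((T z)⁻¹ * Ainf z * T z) * coordProj V = coordProj V * ((T z)⁻¹ * Ainf z * T z) := by
    rw [hconj]; exact h.comm_centerUnstable z
  obtain ⟨Pm, Pp, hPm, hPp, hd₁e⟩ := hd₁.eq_det (C := C') (b := -(3 / 4 * g)) (b' := 1 / 4 * g) hT
    hcommV (by linarith) (by linarith) (fun t ht => by rw [hconj]; exact (hspl t ht).1)
    (fun t ht => by rw [hconj]; exact (hspl t ht).2.1)
  obtain ⟨Pm', Pp', hPm', hPp', hd₂e⟩ := hd₂.eq_det (C := C') (b := 1 / 4 * g) (b' := -(3 / 4 * g)) hT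
    hcommU (by linarith) (by linarith) (fun t ht => by rw [hconj]; exact (hspl t ht).2.2.1)
    (fun t ht => by rw [hconj]; exact (hspl t ht).2.2.2)
  rw [hconj, hΩe] at hPm hPp hPm' hPp'
  have hJk : ∀ k, domSet ρ k = if k = u + 1 then V else U := fun k => rfl
  have hdomU : IsDominantMinor U.card (D z) (D z * coordProj U).trace (minorProj U.card U)
      (C U.card) g' := by
    have h1 := hdom U.card (Finset.mem_range.2 (by omega))
    rwa [hJk, if_neg (by omega)] at h1
  -- The two Evans values may come with different conjugators, while the asymptotics requires one
  -- pair for both.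
  rw [det_conjugator_unique hdomU (hη.trans hηg') hΩcc hΦ₀ hPm' hPp' hPm hPp] at hd₂e
  have hnormT : ∀ N : Matrix (Fin n) (Fin n) ℂ, ∀ B : ℝ, ‖N‖ ≤ B →
      ‖(T z)⁻¹ * N * T z‖ ≤ b * B * b := fun N B hN => by
    have hB : 0 ≤ B := (norm_nonneg _).trans hN
    refine (norm_mul_le _ _).trans ?_
    gcongr
    · exact (norm_mul_le _ _).trans (by gcongr; exact h.norm_inv_le z hzr)
    · exact h.norm_le z hzr
  have hexp1 : ∀ s : ℝ, Real.exp (-ν * |s|) ≤ Real.exp (-κ * |s|) := fun s => by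
    have : κ ≤ ν := min_le_right _ _
    gcongr
  have hexp2 : Real.exp (-θ * X / 2) ≤ Real.exp (-κ * (X / 2)) := by
    have : κ ≤ θ := min_le_left _ _
    rw [Real.exp_le_exp]
    nlinarith
  have hκ0 : 0 < κ := hη.trans hηκ
  have hbb : ∀ E : ℝ, b * (2 * K * E) * b = b * (2 * K) * b * E := fun E => by ring
  have key := HQ (D z) (domSet ρ) U V Φ Φ₀ Ξ Ω Pm Pp (X / 2) γ (D z c c) d₁ d₂ hJk rfl hVcard
    (h.trace_sub_trace hg z) (fun k hk => hdom k (Finset.mem_range.2 (by omega))) (by linarith)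
    hΞc hΩc hΦ hΦ₀ (fun s hs => by
      rw [← hbb]
      refine hnormT _ _ ?_
      have h1 : A s - Ainf z = (A s - A₀ s z) + (A₀ s z - Ainf z) := by abel
      rw [h1]
      refine (norm_add_le _ _).trans ((add_le_add (hH3 s hs) (H2 s z hzM)).trans ?_)
      have h2 : Real.exp (-κ * (X / 2)) ≤ Real.exp (-κ * |s|) := by
        rw [Real.exp_le_exp]; nlinarith
      have h3 := mul_le_mul_of_nonneg_left (hexp2.trans h2) hK
      have h4 := mul_le_mul_of_nonneg_left (hexp1 s) hK
      linarith)
    (fun s => by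
      rw [← hbb]
      refine hnormT _ _ ((H2 s z hzM).trans ?_)
      have h4 := mul_le_mul_of_nonneg_left (hexp1 s) hK
      have := mul_nonneg hK (Real.exp_nonneg (-κ * |s|))
      linarith)
    (fun s hs => by
      rw [← hbb]
      have h1 : Ξ s - Ω s = (T z)⁻¹ * (A s - A₀ s z) * T z := by
        simp only [hΞ, hΩ]; noncomm_ring
      rw [h1]
      refine hnormT _ _ ((hH3 s hs).trans ?_)
      have h4 := mul_le_mul_of_nonneg_left hexp2 hK
      have := mul_nonneg hK (Real.exp_nonneg (-κ * (X / 2)))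
      linarith)
    hPm hPp hd₁e hd₂e hγ
  have hΨX := hΨ.eq_inv_mul hA hper
  have hE : ((Φ (-(X / 2)))⁻¹ * Φ (X / 2) - γ • (1 : Matrix (Fin n) (Fin n) ℂ)).det
      = (Ψ X - γ • (1 : Matrix (Fin n) (Fin n) ℂ)).det := by
    have h1 : (Φ (-(X / 2)))⁻¹ = (T z)⁻¹ * (Ψ (-(X / 2)))⁻¹ * T z := by
      refine Matrix.inv_eq_right_inv ?_
      simp only [hΦdef]
      calc (T z)⁻¹ * Ψ (-(X / 2)) * T z * ((T z)⁻¹ * (Ψ (-(X / 2)))⁻¹ * T z)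
          = (T z)⁻¹ * Ψ (-(X / 2)) * (T z * (T z)⁻¹) * (Ψ (-(X / 2)))⁻¹ * T z := by noncomm_ring
        _ = (T z)⁻¹ * (Ψ (-(X / 2)) * (Ψ (-(X / 2)))⁻¹) * T z := by rw [hTT]; noncomm_ring
        _ = 1 := by rw [hΨ.mul_inv_cancel hA, mul_one, hTT']
    have h2 : (Φ (-(X / 2)))⁻¹ * Φ (X / 2) - γ • (1 : Matrix (Fin n) (Fin n) ℂ)
        = (T z)⁻¹ * (Ψ X - γ • (1 : Matrix (Fin n) (Fin n) ℂ)) * T z := by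
      rw [h1, hΨX, mul_sub, sub_mul, mul_smul_comm, smul_mul_assoc, mul_one, hTT']
      congr 1
      simp only [hΦdef]
      calc (T z)⁻¹ * (Ψ (-(X / 2)))⁻¹ * T z * ((T z)⁻¹ * Ψ (X / 2) * T z)
          = (T z)⁻¹ * (Ψ (-(X / 2)))⁻¹ * (T z * (T z)⁻¹) * Ψ (X / 2) * T z := by noncomm_ring
        _ = _ := by rw [hTT]; noncomm_ring
    rw [h2, Matrix.det_mul, Matrix.det_mul, mul_right_comm, ← Matrix.det_mul, hTT', Matrix.det_one,
      one_mul]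
  have hdetΦ : (Φ (X / 2)).det = (Ψ (X / 2)).det := by
    simp only [hΦdef]
    rw [Matrix.det_mul, Matrix.det_mul, mul_right_comm, ← Matrix.det_mul, hTT', Matrix.det_one,
      one_mul]
  have htr : (D z).trace = (Ainf z).trace := by
    rw [← hconj, Matrix.trace_mul_comm, ← mul_assoc, hTT, one_mul]
  have hcast : (2 * ((X / 2 : ℝ) : ℂ)) = X := by push_cast; ring
  have hcast2 : ((X / 2 : ℝ) : ℂ) = X / 2 := by push_cast; ring
  rw [hE, hdetΦ, htr, hcast, hcast2] at key
  rw [← mul_assoc, ← mul_assoc]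
  exact key

end IsCenterFrame

/-- Coefficients are bounded only for |x| ≤ X/2, so Ψ(X) is first rewritten by Floquet's relation
through the two endpoints of that interval. -/
theorem differentiableAt_evans {A : ℝ → ℂ → Matrix (Fin n) (Fin n) ℂ} {z₀ γ : ℂ} {r X L : ℝ}
    (hr : 0 < r) (hX : 0 < X) (hA : ∀ z ∈ ball z₀ r, Continuous fun x => A x z)
    (hd : ∀ x, DifferentiableOn ℂ (A x) (ball z₀ r))
    (hper : ∀ z ∈ ball z₀ r, ∀ x, A (x + X) z = A x z)
    (hL : ∀ x, |x| ≤ X / 2 → ∀ z ∈ ball z₀ r, ‖A x z‖ ≤ L) :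
    DifferentiableAt ℂ (fun z => (solutionOperator (fun x => A x z) X
      - γ • (1 : Matrix (Fin n) (Fin n) ℂ)).det) z₀ ∧
    DifferentiableAt ℂ (fun z => (solutionOperator (fun x => A x z) (X / 2)).det) z₀ := by
  have hz₀ := mem_ball_self (x := z₀) hr
  have hsol : ∀ z ∈ ball z₀ r, IsFundamentalMatrix (fun x => A x z)
      (solutionOperator fun x => A x z) := fun z hz => isFundamentalMatrix_solutionOperator (hA z hz)
  have hdiff : ∀ x ∈ Icc (-(X / 2)) (X / 2),
      DifferentiableAt ℂ (fun z => solutionOperator (fun x => A x z) x) z₀ := fun x hx =>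
    differentiableAt_fundamentalMatrix (A := A)
      (Psi := fun x z => solutionOperator (fun x => A x z) x) (L := L) hr hA hsol hd
      (fun x hx => hL x (abs_le.2 hx)) hx
  have h1 := hdiff (X / 2) ⟨by linarith, le_rfl⟩
  have h2 := hdiff (-(X / 2)) ⟨le_rfl, by linarith⟩
  have hdet : Differentiable ℂ fun M : Matrix (Fin n) (Fin n) ℂ => M.det :=
    (contDiff_det (N := 1)).differentiable one_ne_zero
  refine ⟨?_, (hdet _).comp z₀ h1⟩
  have hinv : DifferentiableAt ℂ
      (fun z => Ring.inverse (solutionOperator (fun x => A x z) (-(X / 2)))) z₀ := by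
    obtain ⟨w, hw⟩ := (Matrix.isUnit_iff_isUnit_det _).2
      ((hsol z₀ hz₀).isUnit_det (hA z₀ hz₀) (-(X / 2)))
    have h3 : DifferentiableAt ℂ (Ring.inverse : Matrix (Fin n) (Fin n) ℂ → _)
        (solutionOperator (fun x => A x z₀) (-(X / 2))) := by
      rw [← hw]
      exact differentiableAt_inverse w.isUnit
    exact h3.comp z₀ h2
  have h4 : DifferentiableAt ℂ (fun z => Ring.inverse (solutionOperator (fun x => A x z) (-(X / 2)))
      * solutionOperator (fun x => A x z) (X / 2) - γ • (1 : Matrix (Fin n) (Fin n) ℂ)) z₀ :=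
    (hinv.mul h1).sub_const _
  refine ((hdet _).comp z₀ h4).congr_of_eventuallyEq ?_
  filter_upwards [isOpen_ball.mem_nhds hz₀] with z hz
  rw [(hsol z hz).eq_inv_mul (hA z hz) (hper z hz), Matrix.nonsing_inv_eq_ringInverse]
  rfl

/-- The default value of `homoclinicEvans` is zero, so a nonzero value is a genuine one. This is how
existence of conjugators and spectral bases is obtained at points of a punctured neighbourhood, and
why the estimate is never invoked at the zero itself. -/
theorem isHomoclinicEvansValue_of_ne_zero {A : ℝ → Matrix (Fin n) (Fin n) ℂ}
    {B : Matrix (Fin n) (Fin n) ℂ} {c : ℝ} (h : homoclinicEvans A B c ≠ 0) :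
    IsHomoclinicEvansValue A B c (homoclinicEvans A B c) := by
  unfold homoclinicEvans at h ⊢
  split_ifs at h ⊢ with hd
  · exact hd.choose_spec
  · exact absurd rfl h

end localEstimate

/-! ### The arc in terms of the centre eigenvalue, and the conclusion. -/

section periodicSpectrum

open Filter Topology Set Metric NormedSpace

variable {n : ℕ} {Ainf : ℂ → Matrix (Fin n) (Fin n) ℂ} {lams : ℂ} {ks g : ℝ}
  {T D : ℂ → Matrix (Fin n) (Fin n) ℂ} {ρ : Fin n → ℝ} {c : Fin n} {r b : ℝ}

theorem differentiableOn_entry {F : ℂ → Matrix (Fin n) (Fin n) ℂ} {s : Set ℂ}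
    (hF : DifferentiableOn ℂ F s) (i j : Fin n) : DifferentiableOn ℂ (fun z => F z i j) s :=
  fun z hz => differentiableWithinAt_pi.1 (differentiableWithinAt_pi.1 (hF z hz) i) j

theorem differentiableOn_trace {F : ℂ → Matrix (Fin n) (Fin n) ℂ} {s : Set ℂ}
    (hF : DifferentiableOn ℂ F s) : DifferentiableOn ℂ (fun z => (F z).trace) s :=
  DifferentiableOn.fun_sum fun i _ => differentiableOn_entry hF i i

namespace IsCenterFrame

theorem analyticOnNhd_center (h : IsCenterFrame Ainf lams ks g T D ρ c r b) :
    AnalyticOnNhd ℂ (fun z => D z c c) (ball lams r) :=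
  (differentiableOn_entry h.differentiableOn c c).analyticOnNhd isOpen_ball

theorem eventually_center_eq (h : IsCenterFrame Ainf lams ks g T D ρ c r b) {lamj : ℝ → ℂ}
    {J : Set ℝ} (hJ : J ∈ 𝓝 ks) (hlamj : Tendsto lamj (𝓝 ks) (𝓝 lams))
    (hdisp : ∀ κ ∈ J, Complex.I * κ ∈ spectrum ℂ (Ainf (lamj κ))) :
    ∀ᶠ κ : ℝ in 𝓝 ks, κ ∈ J ∧ D (lamj κ) c c = Complex.I * κ := by
  have hcont : ContinuousAt (fun κ : ℝ => Complex.I * (κ : ℂ)) ks := by fun_prop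
  filter_upwards [hJ, hlamj.eventually (isOpen_ball.mem_nhds (mem_ball_self h.pos)),
    hcont.eventually (isOpen_ball.mem_nhds (mem_ball_self h.pos))] with κ hκ hz hs
  exact ⟨hκ, (h.eq_center _ hz _ (by simpa [dist_eq_norm] using hs) (hdisp κ hκ)).symm⟩

/-- Along the arc the centre eigenvalue equals iκ, so by the chain rule the product of the two
derivatives is i. -/
theorem deriv_center_ne_zero (h : IsCenterFrame Ainf lams ks g T D ρ c r b) {lamj : ℝ → ℂ}
    {J : Set ℝ} (hJ : J ∈ 𝓝 ks) (hlamj : lamj ks = lams)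
    (hdisp : ∀ κ ∈ J, Complex.I * κ ∈ spectrum ℂ (Ainf (lamj κ))) {dlamj : ℂ}
    (hd : HasDerivAt lamj dlamj ks) : deriv (fun z => D z c c) lams ≠ 0 := by
  intro h0
  have hlim : Tendsto lamj (𝓝 ks) (𝓝 lams) := hlamj ▸ hd.continuousAt
  have h1 : HasDerivAt (fun z => D z c c) 0 (lamj ks) := by
    rw [hlamj, ← h0]
    exact (h.analyticOnNhd_center lams (mem_ball_self h.pos)).differentiableAt.hasDerivAt
  have h2 := h1.scomp ks hd
  have h3 : HasDerivAt (fun κ : ℝ => Complex.I * (κ : ℂ)) (Complex.I * 1) ks :=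
    (Complex.ofRealCLM.hasDerivAt (x := ks)).const_mul Complex.I
  have h4 := h3.unique (h2.congr_of_eventuallyEq
    ((h.eventually_center_eq hJ hlim hdisp).mono fun κ hκ => hκ.2.symm))
  simp at h4

end IsCenterFrame

end periodicSpectrum

theorem corollary5p4 {n : ℕ}
    -- the family of first-order systems `W' = A ε x lam W`, with `ε = 0` the homoclinic limit
    (A : ℝ → ℝ → ℂ → Matrix (Fin n) (Fin n) ℂ) (Ainf : ℂ → Matrix (Fin n) (Fin n) ℂ)
    (X : ℝ → ℝ) (ε₀ M K ν θ : ℝ)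
    (hε₀ : 0 < ε₀) (hν : 0 < ν) (hθ : 0 < θ)
    (hC1 : ∀ ε ∈ Set.Ico 0 ε₀, ∀ lam : ℂ, ‖lam‖ < M → ContDiff ℝ 1 (fun x => A ε x lam))
    (hAn : ∀ ε ∈ Set.Ico 0 ε₀, ∀ x : ℝ,
      AnalyticOnNhd ℂ (fun lam => A ε x lam) (Metric.ball 0 M))
    (hper : ∀ ε ∈ Set.Ioo 0 ε₀, ∀ x : ℝ, ∀ lam : ℂ, ‖lam‖ < M →
      A ε (x + X ε) lam = A ε x lam)
    (H1 : Filter.Tendsto X (nhdsWithin 0 (Set.Ioi 0)) Filter.atTop)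
    (H2 : ∀ x : ℝ, ∀ lam : ℂ, ‖lam‖ < M → ‖A 0 x lam - Ainf lam‖ ≤ K * Real.exp (-ν * |x|))
    (H3 : ∀ ε ∈ Set.Ioo 0 ε₀, ∀ x : ℝ, ∀ lam : ℂ, |x| ≤ X ε / 2 → ‖lam‖ < M →
      ‖A ε x lam - A 0 x lam‖ ≤ K * Real.exp (-θ * X ε / 2))
    -- the point `lams = lamj ks` on an isolated arc of essential spectrum
    (lams : ℂ) (hlams : ‖lams‖ < M) (ks g : ℝ) (hg : 0 < g)
    (hsimple : (Ainf lams).charpoly.rootMultiplicity (Complex.I * ks) = 1)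
    (hgap : ∀ μ ∈ spectrum ℂ (Ainf lams), μ ≠ Complex.I * ks → g ≤ |μ.re|)
    (lamj : ℝ → ℂ) (J : Set ℝ) (hJ : J ∈ nhds ks) (hlamj : lamj ks = lams)
    (hdisp : ∀ κ ∈ J, Complex.I * κ ∈ spectrum ℂ (Ainf (lamj κ)))
    (dlamj : ℂ) (hdlamj : HasDerivAt lamj dlamj ks) (hnondeg : dlamj ≠ 0)
    -- the two homoclinic Evans functions bordering the arc have zeros of exact order `m`
    (m : ℕ) (hm : 1 ≤ m)
    (hD1 : analyticOrderAt
      (fun lam => homoclinicEvans (fun x => A 0 x lam) (Ainf lam) (-(g / 2))) lams = m)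
    (hD2 : analyticOrderAt
      (fun lam => homoclinicEvans (fun x => A 0 x lam) (Ainf lam) (g / 2)) lams = m) :
    ∃ C₁ : ℝ, 0 < C₁ ∧ ∀ C : ℝ, 0 < C → ∀ η : ℝ, 0 < η → η < min (min θ ν) g →
      ∃ X₀ : ℝ, 0 < X₀ ∧ ∀ ε ∈ Set.Ioo 0 ε₀, X₀ ≤ X ε → ∀ k : ℝ,
        -- the zeros in the ball, with multiplicity, are the multiset `S + T`
        ∃ S T : Multiset ℂ,
          (∀ z ∈ S + T, z ∈ Metric.ball lams (C / X ε)) ∧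
          (∀ z ∈ Metric.ball lams (C / X ε),
            analyticOrderAt
              (fun lam => periodicEvans (A ε) (X ε) (Complex.exp (Complex.I * k * X ε)) lam) z
              = ((S + T).count z : ℕ∞)) ∧
          (∀ z ∈ S, ∃ w ∈ latticeOnArc lamj J (X ε) k, dist z w ≤ C₁ / X ε) ∧
          Multiset.card T = m ∧
          (∀ z ∈ T, dist z lams ≤ C₁ * Real.exp (-η * X ε / (2 * (m + 1)))) := by
  have hdiff : ∀ ε ∈ Set.Ico 0 ε₀, ∀ x, DifferentiableOn ℂ (A ε x) (Metric.ball 0 M) :=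
    fun ε hε x => (hAn ε hε x).differentiableOn
  have h0mem : (0 : ℝ) ∈ Set.Ico 0 ε₀ := ⟨le_rfl, hε₀⟩
  have hInf : DifferentiableOn ℂ Ainf (Metric.ball 0 M) :=
    differentiableOn_of_exponential_limit hν (hdiff 0 h0mem) H2
  have hMball : lams ∈ Metric.ball (0 : ℂ) M := by simpa using hlams
  have hMnhds : Metric.ball (0 : ℂ) M ∈ nhds lams := Metric.isOpen_ball.mem_nhds hMball
  have hInfcont : ContinuousAt Ainf lams := (hInf.differentiableAt hMnhds).continuousAt
  obtain ⟨T, D, ρ, c, r, b, h⟩ := exists_isCenterFrame hg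
    (Filter.Eventually.mono hMnhds fun z hz =>
      hInf.differentiableAt (Metric.isOpen_ball.mem_nhds hz)) hsimple hgap
  have hcont0 : ∀ ε ∈ Set.Ico 0 ε₀, ∀ z : ℂ, ‖z‖ < M → Continuous fun x => A ε x z :=
    fun ε hε z hz => (hC1 ε hε z hz).continuous
  have hlim : Filter.Tendsto lamj (nhds ks) (nhds lams) := hlamj ▸ hdlamj.continuousAt
  set E₁ : ℂ → ℂ := fun z => homoclinicEvans (fun x => A 0 x z) (Ainf z) (-(g / 2)) with hE₁
  set E₂ : ℂ → ℂ := fun z => homoclinicEvans (fun x => A 0 x z) (Ainf z) (g / 2) with hE₂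
  -- A non-analytic function has order 0 by convention, so m ≥ 1 already implies analyticity.
  have han : ∀ E : ℂ → ℂ, analyticOrderAt E lams = m → AnalyticAt ℂ E lams := fun E hE => by
    by_contra hcon
    rw [analyticOrderAt_of_not_analyticAt hcon] at hE
    exact absurd (Nat.cast_eq_zero.1 hE.symm) (by omega)
  obtain ⟨a₁, ha₁, ha₁0, ha₁e⟩ := ((han E₁ hD1).analyticOrderAt_eq_natCast).1 hD1
  obtain ⟨a₂, ha₂, ha₂0, ha₂e⟩ := ((han E₂ hD2).analyticOrderAt_eq_natCast).1 hD2
  have hev : ∀ᶠ z in nhds lams, (z ∈ Metric.ball (0 : ℂ) M ∧ z ∈ Metric.ball lams r ∧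
      AnalyticAt ℂ a₁ z ∧ AnalyticAt ℂ a₂ z ∧ a₁ z ≠ 0 ∧ a₂ z ≠ 0) ∧
      E₁ z = (z - lams) ^ m • a₁ z ∧ E₂ z = (z - lams) ^ m • a₂ z ∧
      ‖E₁ z‖ < ‖E₁ lams‖ + 1 ∧ ‖E₂ z‖ < ‖E₂ lams‖ + 1 ∧ ‖Ainf z‖ < ‖Ainf lams‖ + 1 := by
    filter_upwards [hMnhds, Metric.isOpen_ball.mem_nhds (Metric.mem_ball_self h.pos),
      ha₁.eventually_analyticAt, ha₂.eventually_analyticAt, ha₁.continuousAt.eventually_ne ha₁0,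
      ha₂.continuousAt.eventually_ne ha₂0, ha₁e, ha₂e,
      (han E₁ hD1).continuousAt.norm.eventually (gt_mem_nhds (lt_add_one _)),
      (han E₂ hD2).continuousAt.norm.eventually (gt_mem_nhds (lt_add_one _)),
      hInfcont.norm.eventually (gt_mem_nhds (lt_add_one _))] with z h1 h2 h3 h4 h5 h6 h7 h8 h9 h10 h11
    exact ⟨⟨h1, h2, h3, h4, h5, h6⟩, h7, h8, h9, h10, h11⟩
  obtain ⟨r₀, hr₀, hball⟩ := Metric.eventually_nhds_iff_ball.1 hev
  obtain ⟨C₁, hC₁, HC⟩ := exists_zero_groups (a₁ := a₁) (a₂ := a₂) (μ := fun z => D z c c)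
    (lamj := lamj) (J := J) m hr₀ (fun z hz => (hball z hz).1.2.2.1)
    (fun z hz => (hball z hz).1.2.2.2.1)
    (fun z hz => h.analyticOnNhd_center z (hball z hz).1.2.1) ha₁0 ha₂0
    (h.deriv_center_ne_zero hJ hlamj hdisp hdlamj) h.center_eq
    (h.eventually_center_eq hJ hlim hdisp) hlim
  refine ⟨C₁, hC₁, fun C hC η hη hη' => ?_⟩
  obtain ⟨Q, hQ, hest⟩ := h.exists_evans_estimate hg (A₀ := A 0) hη hη' (hcont0 0 h0mem) hlams H2
  obtain ⟨r₁, hr₁, hest₁⟩ := Metric.eventually_nhds_iff_ball.1 hest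
  -- A bound, valid on the whole ball, for the factor 1 + |d₁| + |d₂| in the error estimate.
  set B := 1 + (‖E₁ lams‖ + 1) + (‖E₂ lams‖ + 1) with hB
  obtain ⟨X₀, hX₀, HX⟩ := HC C hC η hη (Q * B) (by positivity) (min r₀ r₁) (lt_min hr₀ hr₁)
    (min_le_left _ _)
  have hrmin : 0 < min r₀ r₁ := lt_min hr₀ hr₁
  refine ⟨max X₀ (C / min r₀ r₁), lt_max_of_lt_left hX₀, fun ε hε hXmax k => ?_⟩
  have hXε : X₀ ≤ X ε := (le_max_left _ _).trans hXmax
  have hX : 0 < X ε := hX₀.trans_le hXε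
  have hCX : C / X ε ≤ min r₀ r₁ := by
    rw [div_le_iff₀ hX, ← div_le_iff₀' hrmin]
    exact (le_max_right _ _).trans hXmax
  have hε' : ε ∈ Set.Ico 0 ε₀ := ⟨hε.1.le, hε.2⟩
  set γ := Complex.exp (Complex.I * k * X ε) with hγ
  have hγn : ‖γ‖ = 1 := by
    rw [hγ, Complex.norm_exp]
    simp
  have hγ0 : -γ ≠ 0 := neg_ne_zero.2 (Complex.exp_ne_zero _)
  set U := Finset.univ.filter (0 < ρ ·) with hU
  -- The normalising factor of the asymptotics; it is analytic and zero-free, so multiplication by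
  -- it leaves the zeros and their orders unchanged.
  set N : ℂ → ℂ := fun z => Complex.exp (-(D z * coordProj U).trace * X ε)
    * ((-γ) ^ (n - (U.card + 1)))⁻¹
    * (Complex.exp (-(Ainf z).trace * (X ε / 2))
      * (solutionOperator (fun x => A ε x z) (X ε / 2)).det)⁻¹ with hN
  have hK : 0 ≤ K := by simpa using (norm_nonneg _).trans (H2 0 lams hlams)
  have hsub : Metric.ball lams (min r₀ r₁) ⊆ Metric.ball lams r₀ :=
    Metric.ball_subset_ball (min_le_left _ _)
  have hlt : ∀ z ∈ Metric.ball lams (min r₀ r₁), ‖z‖ < M := fun z hz => by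
    simpa using (hball z (hsub hz)).1.1
  have hbound : ∀ x, |x| ≤ X ε / 2 → ∀ z ∈ Metric.ball lams (min r₀ r₁),
      ‖A ε x z‖ ≤ K + K + (‖Ainf lams‖ + 1) := fun x hx z hz => by
    have e1 := H3 ε hε x z hx (hlt z hz)
    have e2 := H2 x z (hlt z hz)
    have e3 := (hball z (hsub hz)).2.2.2.2.2
    have e4 : K * Real.exp (-θ * X ε / 2) ≤ K := mul_le_of_le_one_right hK
      (Real.exp_le_one_iff.2 (by nlinarith))
    have e5 : K * Real.exp (-ν * |x|) ≤ K := mul_le_of_le_one_right hK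
      (Real.exp_le_one_iff.2 (by nlinarith [abs_nonneg x]))
    have e6 : A ε x z = (A ε x z - A 0 x z) + (A 0 x z - Ainf z) + Ainf z := by abel
    rw [e6]
    exact (norm_add_le _ _).trans (add_le_add ((norm_add_le _ _).trans
      (add_le_add (e1.trans e4) (e2.trans e5))) e3.le)
  have hevans : ∀ z ∈ Metric.ball lams (min r₀ r₁),
      DifferentiableAt ℂ (fun z => (solutionOperator (fun x => A ε x z) (X ε)
        - γ • (1 : Matrix (Fin n) (Fin n) ℂ)).det) z ∧
      DifferentiableAt ℂ (fun z => (solutionOperator (fun x => A ε x z) (X ε / 2)).det) z :=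
    fun z hz => by
    obtain ⟨s, hs, hss⟩ := Metric.isOpen_iff.1 Metric.isOpen_ball z hz
    exact differentiableAt_evans hs hX (fun w hw => hcont0 ε hε' w (hlt w (hss hw)))
      (fun x => (hdiff ε hε' x).mono fun w hw => (hball w (hsub (hss hw))).1.1)
      (fun w hw x => hper ε hε x w (hlt w (hss hw)))
      (fun x hx w hw => hbound x hx w (hss hw))
  have hdet0 : ∀ z ∈ Metric.ball lams (min r₀ r₁),
      (solutionOperator (fun x => A ε x z) (X ε / 2)).det ≠ 0 := fun z hz =>
    ((isFundamentalMatrix_solutionOperator (hcont0 ε hε' z (hlt z hz))).isUnit_det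
      (hcont0 ε hε' z (hlt z hz)) _).ne_zero
  have hNne : ∀ z ∈ Metric.ball lams (min r₀ r₁), N z ≠ 0 := fun z hz =>
    mul_ne_zero (mul_ne_zero (Complex.exp_ne_zero _) (inv_ne_zero (pow_ne_zero _ hγ0)))
      (inv_ne_zero (mul_ne_zero (Complex.exp_ne_zero _) (hdet0 z hz)))
  have hEan : AnalyticOnNhd ℂ (periodicEvans (A ε) (X ε) γ) (Metric.ball lams (min r₀ r₁)) :=
    DifferentiableOn.analyticOnNhd (fun z hz => (hevans z hz).1.differentiableWithinAt)
      Metric.isOpen_ball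
  have hNan : AnalyticOnNhd ℂ N (Metric.ball lams (min r₀ r₁)) := by
    refine DifferentiableOn.analyticOnNhd ?_ Metric.isOpen_ball
    have t1 : DifferentiableOn ℂ (fun z => (D z * coordProj U).trace)
        (Metric.ball lams (min r₀ r₁)) :=
      differentiableOn_trace (DifferentiableOn.mul_const
        (h.differentiableOn.mono fun z hz => (hball z (hsub hz)).1.2.1) _)
    have t2 : DifferentiableOn ℂ (fun z => (Ainf z).trace) (Metric.ball lams (min r₀ r₁)) :=
      differentiableOn_trace (hInf.mono fun z hz => (hball z (hsub hz)).1.1)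
    have t3 : DifferentiableOn ℂ (fun z => (solutionOperator (fun x => A ε x z) (X ε / 2)).det)
        (Metric.ball lams (min r₀ r₁)) := fun z hz => (hevans z hz).2.differentiableWithinAt
    exact ((t1.neg.mul_const _).cexp.mul_const _).mul
      (((t2.neg.mul_const _).cexp.mul t3).inv fun z hz =>
        mul_ne_zero (Complex.exp_ne_zero _) (hdet0 z hz))
  obtain ⟨S, Tm, hball', hord, hS, hcard, hTm⟩ := HX (X ε) hXε k
    (fun z => periodicEvans (A ε) (X ε) γ z * N z) (hEan.mul hNan) fun z hz hzc => by
    obtain ⟨⟨-, -, -, -, b1, b2⟩, b3, b4, b5, b6, -⟩ := hball z (hsub hz)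
    have hpow : (z - lams) ^ m ≠ 0 := pow_ne_zero _ (sub_ne_zero.2 hzc)
    -- Off `lams` both Evans functions are nonzero, hence genuine values to which the estimate
    -- applies.
    have hne1 : E₁ z ≠ 0 := by rw [b3]; exact smul_ne_zero hpow b1
    have hne2 : E₂ z ≠ 0 := by rw [b4]; exact smul_ne_zero hpow b2
    have key := hest₁ z (Metric.ball_subset_ball (min_le_right _ _) hz) (E₁ z) (E₂ z)
      (isHomoclinicEvansValue_of_ne_zero hne1) (isHomoclinicEvansValue_of_ne_zero hne2)
      (fun x => A ε x z) (X ε) γ (hcont0 ε hε' z (hlt z hz)) hX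
      (fun x => hper ε hε x z (hlt z hz)) (fun x hx => H3 ε hε x z hx (hlt z hz)) hγn
    have e1 : (z - lams) ^ m * (Complex.exp (D z c c * X ε) * a₁ z - γ * a₂ z)
        = Complex.exp (D z c c * X ε) * E₁ z - γ * E₂ z := by
      rw [b3, b4, smul_eq_mul, smul_eq_mul]
      ring
    rw [e1]
    refine key.trans ?_
    have e2 : 1 + ‖E₁ z‖ + ‖E₂ z‖ ≤ B := by rw [hB]; linarith
    calc Q * (1 + ‖Complex.exp (D z c c * X ε)‖) * (1 + ‖E₁ z‖ + ‖E₂ z‖)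
          * Real.exp (-η * (X ε / 2))
        ≤ Q * (1 + ‖Complex.exp (D z c c * X ε)‖) * B * Real.exp (-η * (X ε / 2)) := by gcongr
      _ = _ := by ring
  refine ⟨S, Tm, hball', fun z hz => ?_, hS, hcard, hTm⟩
  have hzr := Metric.ball_subset_ball hCX hz
  rw [← hord z hz]
  change _ = analyticOrderAt (periodicEvans (A ε) (X ε) γ * N) z
  rw [analyticOrderAt_mul (hEan z hzr) (hNan z hzr),
    (hNan z hzr).analyticOrderAt_eq_zero.2 (hNne z hzr), add_zero]
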